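/- Let $k$ be a field; all algebras and unadorned tensor products are over $k$. A quasi-Hopf algebra $H=(H,\Delta,\varepsilon,\Phi,S,\alpha,\beta)$ consists of a unital associative algebra $H$, algebra maps $\Delta:H\to H\otimes H$, $\varepsilon:H\to k$, an invertible $\Phi=X^1\otimes X^2\otimes X^3\in H^{\otimes 3}$ with inverse $\Phi^{-1}=x^1\otimes x^2\otimes x^3$, an (in particular bijective) algebra anti-automorphism $S$ and $\alpha,\beta\in H$, such that for all $h\in H$ $$(id\otimes\Delta)\Delta(h)=\Phi\,(\Delta\otimes id)\Delta(h)\,\Phi^{-1},\quad (id\otimes\varepsilon)\Delta(h)=(\varepsilon\otimes id)\Delta(h)=h,$$ $$(1\otimes\Phi)(id\otimes\Delta\otimes id)(\Phi)(\Phi\otimes 1)=(id\otimes id\otimes\Delta)(\Phi)(\Delta\otimes id\otimes id)(\Phi),\quad (id\otimes\varepsilon\otimes id)(\Phi)=1\otimes 1,$$ $$S(h_1)\alpha h_2=\varepsilon(h)\alpha,\quad h_1\beta S(h_2)=\varepsilon(h)\beta,\quad X^1\beta S(X^2)\alpha X^3=1,\quad S(x^1)\alpha x^2\beta S(x^3)=1,$$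 normalized so that $\varepsilon(\alpha)=\varepsilon(\beta)=1$. Put $A^1\otimes A^2\otimes A^3\otimes A^4=(\Phi\otimes1)(\Delta\otimes id\otimes id)(\Phi^{-1})$, $\gamma=S(A^2)\alpha A^3\otimes S(A^1)\alpha A^4$ and let $$f=f^1\otimes f^2=(S\otimes S)(\Delta^{cop}(x^1))\,\gamma\,\Delta(x^2\beta S(x^3))\in H\otimes H$$ be the Drinfeld twist. It is invertible; write $f^{-1}=g^1\otimes g^2$. An $H$-bimodule algebra is an $H$-bimodule $\mathcal A$ (with compatible $k$-structures) with a $k$-bilinear, not necessarily associative, multiplication and a unit $1_{\mathcal A}$ such that $(\varphi\varphi')\varphi''=(X^1\cdot\varphi\cdot x^1)[(X^2\cdot\varphi'\cdot x^2)(X^3\cdot\varphi''\cdot x^3)]$, $h\cdot(\varphi\varphi')=(h_1\cdot\varphi)(h_2\cdot\varphi')$, $(\varphi\varphi')\cdot h=(\varphi\cdot h_1)(\varphi'\cdot h_2)$ and $h\cdot1_{\mathcal A}=\varepsilon(h)1_{\mathcal A}=1_{\mathcal A}\cdot h$. A two-sided coaction of $H$ on a unital associative algebra $\mathbb A$ is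 a pair $(\delta,\Psi)$, $\delta:\mathbb A\to H\otimes\mathbb A\otimes H$ an algebra map and $\Psi\in H^{\otimes2}\otimes\mathbb A\otimes H^{\otimes2}$ invertible, with $$(id\otimes\delta\otimes id)(\delta(u))\Psi=\Psi(\Delta\otimes id\otimes\Delta)(\delta(u)),\qquad(\varepsilon\otimes id\otimes\varepsilon)\delta=id,$$ $$(1\otimes\Psi\otimes1)(id\otimes\Delta\otimes id\otimes\Delta\otimes id)(\Psi)(\Phi\otimes1\otimes\Phi^{-1})=(id^{\otimes 2}\otimes\delta\otimes id^{\otimes 2})(\Psi)(\Delta\otimes id^{\otimes 3}\otimes\Delta)(\Psi),$$ $$(id\otimes\varepsilon\otimes id\otimes\varepsilon\otimes id)(\Psi)=(\varepsilon\otimes id^{\otimes 3}\otimes\varepsilon)(\Psi)=1.$$ Write $\delta(u)=u_{(-1)}\otimes u_{(0)}\otimes u_{(1)}$, $\Psi=\Psi^1\otimes\cdots\otimes\Psi^5$, $\Psi^{-1}=\overline\Psi^1\otimes\cdots\otimes\overline\Psi^5$ and $$\Omega_\delta=\overline\Psi^1\otimes\overline\Psi^2\otimes\overline\Psi^3\otimes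 S^{-1}(f^1\overline\Psi^4)\otimes S^{-1}(f^2\overline\Psi^5),\quad \Omega'_\delta=S^{-1}(\Psi^1g^1)\otimes S^{-1}(\Psi^2g^2)\otimes\Psi^3\otimes\Psi^4\otimes\Psi^5.$$ The left and right generalized diagonal crossed products $\mathcal A\bowtie_\delta\mathbb A$ and $\mathbb A\bowtie_\delta\mathcal A$ are the vector spaces $\mathcal A\otimes\mathbb A$ and $\mathbb A\otimes\mathcal A$ with the bilinear multiplications $$(\varphi\bowtie_\delta u)(\varphi'\bowtie_\delta u')=(\Omega_\delta^1\cdot\varphi\cdot\Omega_\delta^5)(\Omega_\delta^2u_{(-1)}\cdot\varphi'\cdot S^{-1}(u_{(1)})\Omega_\delta^4)\bowtie_\delta\Omega_\delta^3u_{(0)}u',$$ $$(u\bowtie_\delta\varphi)(u'\bowtie_\delta\varphi')=uu'_{(0)}\Omega'^3_\delta\bowtie_\delta(\Omega'^2_\delta S^{-1}(u'_{(-1)})\cdot\varphi\cdot u'_{(1)}\Omega'^4_\delta)(\Omega'^1_\delta\cdot\varphi'\cdot\Omega'^5_\delta).$$ An $H$-bicomodule algebra is a unital associative algebra $\mathbb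 A$ with algebra maps $\lambda:\mathbb A\to H\otimes\mathbb A$, $\rho:\mathbb A\to\mathbb A\otimes H$ and invertible $\Phi_\lambda\in H\otimes H\otimes\mathbb A$, $\Phi_\rho\in\mathbb A\otimes H\otimes H$, $\Phi_{\lambda,\rho}\in H\otimes\mathbb A\otimes H$ such that, for all $u\in\mathbb A$: - $(id\otimes\lambda)(\lambda(u))\Phi_\lambda=\Phi_\lambda(\Delta\otimes id)(\lambda(u))$, $(1\otimes\Phi_\lambda)(id\otimes\Delta\otimes id)(\Phi_\lambda)(\Phi\otimes1)=(id\otimes id\otimes\lambda)(\Phi_\lambda)(\Delta\otimes id\otimes id)(\Phi_\lambda)$, $(\varepsilon\otimes id)\lambda=id$, $(id\otimes\varepsilon\otimes id)(\Phi_\lambda)=(\varepsilon\otimes id\otimes id)(\Phi_\lambda)=1$; - $\Phi_\rho(\rho\otimes id)(\rho(u))=(id\otimes\Delta)(\rho(u))\Phi_\rho$, $(1\otimes\Phi)(id\otimes\Delta\otimes id)(\Phi_\rho)(\Phi_\rho\otimes1)=(id\otimes id\otimes\Delta)(\Phi_\rho)(\rho\otimes id\otimes id)(\Phi_\rho)$,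 $(id\otimes\varepsilon)\rho=id$, $(id\otimes\varepsilon\otimes id)(\Phi_\rho)=(id\otimes id\otimes\varepsilon)(\Phi_\rho)=1$; - $\Phi_{\lambda,\rho}(\lambda\otimes id)(\rho(u))=(id\otimes\rho)(\lambda(u))\Phi_{\lambda,\rho}$, $(1\otimes\Phi_{\lambda,\rho})(id\otimes\lambda\otimes id)(\Phi_{\lambda,\rho})(\Phi_\lambda\otimes1)=(id\otimes id\otimes\rho)(\Phi_\lambda)(\Delta\otimes id\otimes id)(\Phi_{\lambda,\rho})$, $(1\otimes\Phi_\rho)(id\otimes\rho\otimes id)(\Phi_{\lambda,\rho})(\Phi_{\lambda,\rho}\otimes1)=(id\otimes id\otimes\Delta)(\Phi_{\lambda,\rho})(\lambda\otimes id\otimes id)(\Phi_\rho)$. It gives rise to the two pairs $$\delta_l=(\lambda\otimes id)\rho,\quad\Psi_l=(id\otimes\lambda\otimes id^{\otimes2})\big((\Phi_{\lambda,\rho}\otimes1)(\lambda\otimes id^{\otimes2})(\Phi_\rho^{-1})\big)[\Phi_\lambda\otimes1^{\otimes2}],$$ $$\delta_r=(id\otimes\rho)\lambda,\quad\Psi_r=(id^{\otimes2}\otimes\rho\otimes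 id)\big((1\otimes\Phi_{\lambda,\rho}^{-1})(id^{\otimes2}\otimes\rho)(\Phi_\lambda)\big)[1^{\otimes2}\otimes\Phi_\rho^{-1}].$$ **Proposition.** Let $H$ be a quasi-Hopf algebra, $\mathcal A$ an $H$-bimodule algebra and $\mathbb A$ a unital associative algebra. 1. The element $f$ is invertible. For every two-sided coaction $(\delta,\Psi)$ of $H$ on $\mathbb A$, $\mathcal A\bowtie_\delta\mathbb A$ and $\mathbb A\bowtie_\delta\mathcal A$ are associative algebras with units $1_{\mathcal A}\bowtie_\delta1_{\mathbb A}$ and $1_{\mathbb A}\bowtie_\delta1_{\mathcal A}$, and $u\mapsto1_{\mathcal A}\bowtie_\delta u$, respectively $u\mapsto u\bowtie_\delta1_{\mathcal A}$, is a unital algebra map from $\mathbb A$. These two maps are injective if $\mathcal A\neq0$, so that $\mathbb A$ is then a unital subalgebra. 2. For every $H$-bicomodule algebra structure on $\mathbb A$, $(\delta_l,\Psi_l)$ and $(\delta_r,\Psi_r)$ are two-sided coactions, and the conclusions of 1 hold for the four products $\mathcal A\bowtie\mathbb A=\mathcal A\bowtie_{\delta_l}\mathbb A$, $\mathcal A\triangleright\!\!\triangleleft\mathbb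 A=\mathcal A\bowtie_{\delta_r}\mathbb A$, $\mathbb A\bowtie\mathcal A=\mathbb A\bowtie_{\delta_l}\mathcal A$ and $\mathbb A\triangleright\!\!\triangleleft\mathcal A=\mathbb A\bowtie_{\delta_r}\mathcal A$. -/

import Mathlib

open scoped TensorProduct

-- Needed to find the algebra structures on nested tensor products.
set_option maxSynthPendingDepth 12

namespace QuasiHopf

section TensorMaps

variable {k : Type*} [Field k]

/-- `f ⊗ id_D` for an algebra map `f : A → B ⊗ C`. -/
noncomputable def tensorId {A B C : Type*} [Semiring A] [Algebra k A] [Semiring B] [Algebra k B]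
    [Semiring C] [Algebra k C] (f : A →ₐ[k] B ⊗[k] C) (D : Type*) [Semiring D] [Algebra k D] :
    A ⊗[k] D →ₐ[k] B ⊗[k] (C ⊗[k] D) :=
  (Algebra.TensorProduct.assoc k k k B C D).toAlgHom.comp
    (Algebra.TensorProduct.map f (AlgHom.id k D))

/-- `f ⊗ id_D` for an algebra map `f : A → B ⊗ C ⊗ E`. -/
noncomputable def tensorId₃ {A B C E : Type*} [Semiring A] [Algebra k A] [Semiring B] [Algebra k B]
    [Semiring C] [Algebra k C] [Semiring E] [Algebra k E] (f : A →ₐ[k] B ⊗[k] (C ⊗[k] E))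
    (D : Type*) [Semiring D] [Algebra k D] :
    A ⊗[k] D →ₐ[k] B ⊗[k] (C ⊗[k] (E ⊗[k] D)) :=
  (Algebra.TensorProduct.map (AlgHom.id k B)
    (Algebra.TensorProduct.assoc k k k C E D).toAlgHom).comp (tensorId f D)

/-- `id_D ⊗ f`. -/
noncomputable def idTensor {A B : Type*} [Semiring A] [Algebra k A] [Semiring B] [Algebra k B]
    (D : Type*) [Semiring D] [Algebra k D] (f : A →ₐ[k] B) : D ⊗[k] A →ₐ[k] D ⊗[k] B :=
  Algebra.TensorProduct.map (AlgHom.id k D) f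

/-- `x ↦ 1 ⊗ x`. -/
noncomputable def oneTensor {A : Type*} [Semiring A] [Algebra k A] (D : Type*) [Semiring D] [Algebra k D] :
    A →ₐ[k] D ⊗[k] A :=
  Algebra.TensorProduct.includeRight

/-- `x ↦ x ⊗ 1_D`, on a tensor product of three algebras. -/
noncomputable def tensorOne₃ (A B C D : Type*) [Semiring A] [Algebra k A] [Semiring B] [Algebra k B]
    [Semiring C] [Algebra k C] [Semiring D] [Algebra k D] :
    A ⊗[k] (B ⊗[k] C) →ₐ[k] A ⊗[k] (B ⊗[k] (C ⊗[k] D)) :=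
  idTensor A (idTensor B Algebra.TensorProduct.includeLeft)

/-- `ε ⊗ id_D`, with `k ⊗ D` identified with `D`. -/
noncomputable def counitLeft {H : Type*} [Semiring H] [Algebra k H] (ε : H →ₐ[k] k)
    (D : Type*) [Semiring D] [Algebra k D] : H ⊗[k] D →ₐ[k] D :=
  (Algebra.TensorProduct.lid k D).toAlgHom.comp
    (Algebra.TensorProduct.map ε (AlgHom.id k D))

/-- `id_D ⊗ ε`, with `D ⊗ k` identified with `D`. -/
noncomputable def counitRight {H : Type*} [Semiring H] [Algebra k H] (ε : H →ₐ[k] k)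
    (D : Type*) [Semiring D] [Algebra k D] : D ⊗[k] H →ₐ[k] D :=
  (Algebra.TensorProduct.rid k k D).toAlgHom.comp
    (Algebra.TensorProduct.map (AlgHom.id k D) ε)

/-- `x ↦ x ⊗ 1_F`, on a tensor product of five algebras. -/
noncomputable def tensorOne₅ (A B C D E F : Type*) [Semiring A] [Algebra k A] [Semiring B]
    [Algebra k B] [Semiring C] [Algebra k C] [Semiring D] [Algebra k D] [Semiring E]
    [Algebra k E] [Semiring F] [Algebra k F] :
    A ⊗[k] (B ⊗[k] (C ⊗[k] (D ⊗[k] E))) →ₐ[k] A ⊗[k] (B ⊗[k] (C ⊗[k] (D ⊗[k] (E ⊗[k] F)))) :=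
  idTensor A (idTensor B (tensorOne₃ C D E F))

/-- The map on units induced by an algebra map. -/
noncomputable def mapUnits {A B : Type*} [Semiring A] [Algebra k A] [Semiring B] [Algebra k B]
    (f : A →ₐ[k] B) : Aˣ →* Bˣ :=
  Units.map f.toRingHom.toMonoidHom

end TensorMaps

/-- A quasi-bialgebra `(H, Δ, ε, Φ)` over a field `k`. -/
structure QuasiBialgebra (k H : Type*) [Field k] [Ring H] [Algebra k H] where
  comul : H →ₐ[k] H ⊗[k] H
  counit : H →ₐ[k] k
  reassoc : (H ⊗[k] (H ⊗[k] H))ˣ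
  quasi_coassoc : ∀ h : H, idTensor H comul (comul h) =
    reassoc.val * tensorId comul H (comul h) * (reassoc⁻¹).val
  counit_right : ∀ h : H, counitRight counit H (comul h) = h
  counit_left : ∀ h : H, counitLeft counit H (comul h) = h
  cocycle : oneTensor H reassoc.val * idTensor H (tensorId comul H) reassoc.val *
      tensorOne₃ H H H H reassoc.val =
    idTensor H (idTensor H comul) reassoc.val * tensorId comul (H ⊗[k] H) reassoc.val
  reassoc_normalized : idTensor H (counitLeft counit H) reassoc.val = 1

/-- `(x, y) ↦ S(x) α y`. -/
noncomputable def antipodeAlpha {k H : Type*} [Field k] [Ring H] [Algebra k H]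
    (S : H →ₗ[k] H) (α : H) : H →ₗ[k] H →ₗ[k] H :=
  LinearMap.mul k H ∘ₗ LinearMap.mulRight k α ∘ₗ S

/-- `(x, y) ↦ x β S(y)`. -/
noncomputable def betaAntipode {k H : Type*} [Field k] [Ring H] [Algebra k H]
    (S : H →ₗ[k] H) (β : H) : H →ₗ[k] H →ₗ[k] H :=
  (LinearMap.mul k H ∘ₗ LinearMap.mulRight k β).compl₂ S

/-- The linear map underlying an algebra isomorphism `H ≃ Hᵐᵒᵖ`, i.e. an anti-automorphism. -/
noncomputable def antiAutLin {k H : Type*} [Field k] [Ring H] [Algebra k H]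
    (S : H ≃ₐ[k] Hᵐᵒᵖ) : H →ₗ[k] H :=
  (MulOpposite.opLinearEquiv k).symm.toLinearMap ∘ₗ S.toLinearMap

/-- The linear map underlying the inverse of an anti-automorphism. -/
noncomputable def antiAutInvLin {k H : Type*} [Field k] [Ring H] [Algebra k H]
    (S : H ≃ₐ[k] Hᵐᵒᵖ) : H →ₗ[k] H :=
  S.symm.toLinearMap ∘ₗ (MulOpposite.opLinearEquiv k).toLinearMap

/-- A quasi-Hopf algebra: a quasi-bialgebra with an anti-automorphism `S` and elements `α`, `β`,
rescaled so that `ε(α) = ε(β) = 1`. -/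
structure QuasiHopfAlgebra (k H : Type*) [Field k] [Ring H] [Algebra k H] extends
    QuasiBialgebra k H where
  S : H ≃ₐ[k] Hᵐᵒᵖ
  α : H
  β : H
  antipode_left : ∀ h : H,
    TensorProduct.lift (antipodeAlpha (antiAutLin S) α) (comul h) = counit h • α
  antipode_right : ∀ h : H,
    TensorProduct.lift (betaAntipode (antiAutLin S) β) (comul h) = counit h • β
  /-- `X¹ β S(X²) α X³ = 1`. -/
  reassoc_antipode :
    LinearMap.mul' k H (TensorProduct.map (LinearMap.mulRight k β)
      (TensorProduct.lift (antipodeAlpha (antiAutLin S) α)) reassoc.val) = 1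
  /-- `S(x¹) α x² β S(x³) = 1`. -/
  reassoc_inv_antipode :
    LinearMap.mul' k H (TensorProduct.map (LinearMap.mulRight k α ∘ₗ antiAutLin S)
      (TensorProduct.lift (betaAntipode (antiAutLin S) β)) (reassoc⁻¹).val) = 1
  counit_α : counit α = 1
  counit_β : counit β = 1

namespace QuasiHopfAlgebra

variable {k H : Type*} [Field k] [Ring H] [Algebra k H] (Q : QuasiHopfAlgebra k H)

/-- The antipode, as a linear map. -/
noncomputable abbrev antipode : H →ₗ[k] H := antiAutLin Q.S

/-- The inverse of the antipode, as a linear map. -/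
noncomputable abbrev antipodeInv : H →ₗ[k] H := antiAutInvLin Q.S

/-- `γ = S(A²) α A³ ⊗ S(A¹) α A⁴`, where
`A¹ ⊗ A² ⊗ A³ ⊗ A⁴ = (Φ ⊗ 1) (Δ ⊗ id ⊗ id)(Φ⁻¹)`. -/
noncomputable def gamma : H ⊗[k] H :=
  TensorProduct.lift
    (TensorProduct.map₂ (antipodeAlpha Q.antipode Q.α) (antipodeAlpha Q.antipode Q.α))
    (TensorProduct.map (TensorProduct.comm k H H).toLinearMap LinearMap.id
      ((TensorProduct.assoc k H H (H ⊗[k] H)).symm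
        (tensorOne₃ H H H H Q.reassoc.val * tensorId Q.comul (H ⊗[k] H) (Q.reassoc⁻¹).val)))

/-- The Drinfeld twist
`f = (S ⊗ S)(Δᶜᵒᵖ(x¹)) γ Δ(x² β S(x³))`, where `Φ⁻¹ = x¹ ⊗ x² ⊗ x³`. -/
noncomputable def drinfeldTwist : H ⊗[k] H :=
  LinearMap.mul' k (H ⊗[k] H)
    (TensorProduct.map
      (LinearMap.mulRight k Q.gamma ∘ₗ TensorProduct.map Q.antipode Q.antipode ∘ₗ
        (TensorProduct.comm k H H).toLinearMap ∘ₗ Q.comul.toLinearMap)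
      (Q.comul.toLinearMap ∘ₗ TensorProduct.lift (betaAntipode Q.antipode Q.β))
      (Q.reassoc⁻¹).val)

end QuasiHopfAlgebra

section Comodules

variable {k H : Type*} [Field k] [Ring H] [Algebra k H]

/-- A right `H`-comodule algebra structure `(ρ, Φ_ρ)` on `A`. -/
structure RightComoduleAlgebra (Q : QuasiBialgebra k H) (A : Type*) [Ring A] [Algebra k A] where
  ρ : A →ₐ[k] A ⊗[k] H
  Φρ : (A ⊗[k] (H ⊗[k] H))ˣ
  ρ_coassoc : ∀ a : A, Φρ.val * tensorId ρ H (ρ a) = idTensor A Q.comul (ρ a) * Φρ.val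
  ρ_cocycle : oneTensor A Q.reassoc.val * idTensor A (tensorId Q.comul H) Φρ.val *
      tensorOne₃ A H H H Φρ.val =
    idTensor A (idTensor H Q.comul) Φρ.val * tensorId ρ (H ⊗[k] H) Φρ.val
  ρ_counit : ∀ a : A, counitRight Q.counit A (ρ a) = a
  Φρ_normalized_mid : idTensor A (counitLeft Q.counit H) Φρ.val = 1
  Φρ_normalized_right : idTensor A (counitRight Q.counit H) Φρ.val = 1

/-- A left `H`-comodule algebra structure `(λ, Φ_λ)` on `A`. -/
structure LeftComoduleAlgebra (Q : QuasiBialgebra k H) (A : Type*) [Ring A] [Algebra k A] where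
  lam : A →ₐ[k] H ⊗[k] A
  Φlam : (H ⊗[k] (H ⊗[k] A))ˣ
  lam_coassoc : ∀ a : A, idTensor H lam (lam a) * Φlam.val = Φlam.val * tensorId Q.comul A (lam a)
  lam_cocycle : oneTensor H Φlam.val * idTensor H (tensorId Q.comul A) Φlam.val *
      tensorOne₃ H H H A Q.reassoc.val =
    idTensor H (idTensor H lam) Φlam.val * tensorId Q.comul (H ⊗[k] A) Φlam.val
  lam_counit : ∀ a : A, counitLeft Q.counit A (lam a) = a
  Φlam_normalized_mid : idTensor H (counitLeft Q.counit A) Φlam.val = 1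
  Φlam_normalized_left : counitLeft Q.counit (H ⊗[k] A) Φlam.val = 1

/-- An `H`-bicomodule algebra structure `(λ, ρ, Φ_λ, Φ_ρ, Φ_{λ,ρ})` on `A`. -/
structure BicomoduleAlgebra (Q : QuasiBialgebra k H) (A : Type*) [Ring A] [Algebra k A] extends
    LeftComoduleAlgebra Q A, RightComoduleAlgebra Q A where
  Φlamρ : (H ⊗[k] (A ⊗[k] H))ˣ
  lamρ_comm : ∀ u : A, Φlamρ.val * tensorId lam H (ρ u) = idTensor H ρ (lam u) * Φlamρ.val
  lamρ_cocycle_left : oneTensor H Φlamρ.val * idTensor H (tensorId lam H) Φlamρ.val *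
      tensorOne₃ H H A H Φlam.val =
    idTensor H (idTensor H ρ) Φlam.val * tensorId Q.comul (A ⊗[k] H) Φlamρ.val
  lamρ_cocycle_right : oneTensor H Φρ.val * idTensor H (tensorId ρ H) Φlamρ.val *
      tensorOne₃ H A H H Φlamρ.val =
    idTensor H (idTensor A Q.comul) Φlamρ.val * tensorId lam (H ⊗[k] H) Φρ.val

/-- The data of a two-sided coaction: `δ : A → H ⊗ A ⊗ H` and an invertible
`Ψ ∈ H ⊗ H ⊗ A ⊗ H ⊗ H`. -/
structure TwoSidedData (k H A : Type*) [Field k] [Ring H] [Algebra k H]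
    [Ring A] [Algebra k A] where
  δ : A →ₐ[k] H ⊗[k] (A ⊗[k] H)
  Ψ : (H ⊗[k] (H ⊗[k] (A ⊗[k] (H ⊗[k] H))))ˣ

/-- The axioms of a two-sided coaction of `H` on `A`. -/
structure IsTwoSidedCoaction (Q : QuasiBialgebra k H) {A : Type*} [Ring A] [Algebra k A]
    (C : TwoSidedData k H A) : Prop where
  /-- `(id ⊗ δ ⊗ id)(δ(u)) Ψ = Ψ (Δ ⊗ id ⊗ Δ)(δ(u))`. -/
  coassoc : ∀ u : A, idTensor H (tensorId₃ C.δ H) (C.δ u) * C.Ψ.val =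
    C.Ψ.val * tensorId Q.comul (A ⊗[k] (H ⊗[k] H)) (idTensor H (idTensor A Q.comul) (C.δ u))
  /-- `(1 ⊗ Ψ ⊗ 1) (id ⊗ Δ ⊗ id ⊗ Δ ⊗ id)(Ψ) (Φ ⊗ 1 ⊗ Φ⁻¹)
  = (id ⊗ id ⊗ δ ⊗ id ⊗ id)(Ψ) (Δ ⊗ id ⊗ id ⊗ id ⊗ Δ)(Ψ)`. -/
  cocycle :
    oneTensor H (tensorOne₅ H H A H H H C.Ψ.val) *
        idTensor H ((tensorId Q.comul (A ⊗[k] (H ⊗[k] (H ⊗[k] H)))).comp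
          (idTensor H (idTensor A (tensorId Q.comul H)))) C.Ψ.val *
        (tensorOne₃ H H H (A ⊗[k] (H ⊗[k] (H ⊗[k] H))) Q.reassoc.val *
          oneTensor H (oneTensor H (oneTensor H (oneTensor A (Q.reassoc⁻¹).val)))) =
      idTensor H (idTensor H (tensorId₃ C.δ (H ⊗[k] H))) C.Ψ.val *
        tensorId Q.comul (H ⊗[k] (A ⊗[k] (H ⊗[k] (H ⊗[k] H))))
          (idTensor H (idTensor H (idTensor A (idTensor H Q.comul))) C.Ψ.val)
  /-- `(ε ⊗ id ⊗ ε) ∘ δ = id`. -/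
  counit : ∀ u : A, counitRight Q.counit A (counitLeft Q.counit (A ⊗[k] H) (C.δ u)) = u
  /-- `(id ⊗ ε ⊗ id ⊗ ε ⊗ id)(Ψ) = 1`. -/
  normalized_inner : idTensor H ((idTensor A (counitLeft Q.counit H)).comp
    (counitLeft Q.counit (A ⊗[k] (H ⊗[k] H)))) C.Ψ.val = 1
  /-- `(ε ⊗ id ⊗ id ⊗ id ⊗ ε)(Ψ) = 1`. -/
  normalized_outer : idTensor H (idTensor A (counitRight Q.counit H))
    (counitLeft Q.counit (H ⊗[k] (A ⊗[k] (H ⊗[k] H))) C.Ψ.val) = 1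

namespace BicomoduleAlgebra

variable {Q : QuasiBialgebra k H} {A : Type*} [Ring A] [Algebra k A] (B : BicomoduleAlgebra Q A)

/-- `δ_l = (λ ⊗ id) ∘ ρ` and
`Ψ_l = (id ⊗ λ ⊗ id ⊗ id)((Φ_{λ,ρ} ⊗ 1) (λ ⊗ id ⊗ id)(Φ_ρ⁻¹)) (Φ_λ ⊗ 1 ⊗ 1)`. -/
noncomputable def leftTwoSided : TwoSidedData k H A where
  δ := (tensorId B.lam H).comp B.ρ
  Ψ := mapUnits (idTensor H (tensorId B.lam (H ⊗[k] H)))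
      (mapUnits (tensorOne₃ H A H H) B.Φlamρ * mapUnits (tensorId B.lam (H ⊗[k] H)) B.Φρ⁻¹) *
    mapUnits (tensorOne₃ H H A (H ⊗[k] H)) B.Φlam

/-- `δ_r = (id ⊗ ρ) ∘ λ` and
`Ψ_r = (id ⊗ id ⊗ ρ ⊗ id)((1 ⊗ Φ_{λ,ρ}⁻¹) (id ⊗ id ⊗ ρ)(Φ_λ)) (1 ⊗ 1 ⊗ Φ_ρ⁻¹)`. -/
noncomputable def rightTwoSided : TwoSidedData k H A where
  δ := (idTensor H B.ρ).comp B.lam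
  Ψ := mapUnits (idTensor H (idTensor H (tensorId B.ρ H)))
      (mapUnits (oneTensor H) B.Φlamρ⁻¹ * mapUnits (idTensor H (idTensor H B.ρ)) B.Φlam) *
    mapUnits (oneTensor H) (mapUnits (oneTensor H) B.Φρ⁻¹)

end BicomoduleAlgebra

end Comodules

section Bimodules

variable (k : Type*) {H : Type*} [Field k] [Ring H] [Algebra k H]
  (M : Type*) [AddCommGroup M] [Module k M]

/-- The left action `h ↦ (φ ↦ h · φ)`. -/
noncomputable def leftAct [Module H M] [IsScalarTower k H M] : H →ₗ[k] M →ₗ[k] M :=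
  (Algebra.lsmul k k M).toLinearMap

/-- The right action `h ↦ (φ ↦ φ · h)`; right `H`-modules are modules over `Hᵐᵒᵖ`. -/
noncomputable def rightAct [Module Hᵐᵒᵖ M] [IsScalarTower k Hᵐᵒᵖ M] : H →ₗ[k] M →ₗ[k] M :=
  (Algebra.lsmul k k M : Hᵐᵒᵖ →ₐ[k] Module.End k M).toLinearMap ∘ₗ
    (MulOpposite.opLinearEquiv k).toLinearMap

/-- Componentwise left action of `H ⊗ H` on `M ⊗ M`. -/
noncomputable def leftAct₂ [Module H M] [IsScalarTower k H M] :
    H ⊗[k] H →ₗ[k] M ⊗[k] M →ₗ[k] M ⊗[k] M :=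
  TensorProduct.map₂ (leftAct k M) (leftAct k M)

/-- Componentwise right action of `H ⊗ H` on `M ⊗ M`. -/
noncomputable def rightAct₂ [Module Hᵐᵒᵖ M] [IsScalarTower k Hᵐᵒᵖ M] :
    H ⊗[k] H →ₗ[k] M ⊗[k] M →ₗ[k] M ⊗[k] M :=
  TensorProduct.map₂ (rightAct k M) (rightAct k M)

/-- Componentwise left action of `H ⊗ H ⊗ H` on `M ⊗ M ⊗ M`. -/
noncomputable def leftAct₃ [Module H M] [IsScalarTower k H M] :
    H ⊗[k] (H ⊗[k] H) →ₗ[k] M ⊗[k] (M ⊗[k] M) →ₗ[k] M ⊗[k] (M ⊗[k] M) :=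
  TensorProduct.map₂ (leftAct k M) (leftAct₂ k M)

/-- Componentwise right action of `H ⊗ H ⊗ H` on `M ⊗ M ⊗ M`. -/
noncomputable def rightAct₃ [Module Hᵐᵒᵖ M] [IsScalarTower k Hᵐᵒᵖ M] :
    H ⊗[k] (H ⊗[k] H) →ₗ[k] M ⊗[k] (M ⊗[k] M) →ₗ[k] M ⊗[k] (M ⊗[k] M) :=
  TensorProduct.map₂ (rightAct k M) (rightAct₂ k M)

end Bimodules

/-- The `H`-bimodule `𝒜`, with its (not necessarily associative) multiplication and its unit, is
an `H`-bimodule algebra. -/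
structure IsBimoduleAlgebra {k H : Type*} [Field k] [Ring H] [Algebra k H]
    (Q : QuasiBialgebra k H) (𝒜 : Type*) [NonAssocRing 𝒜] [Module k 𝒜]
    [SMulCommClass k 𝒜 𝒜] [IsScalarTower k 𝒜 𝒜]
    [Module H 𝒜] [IsScalarTower k H 𝒜] [Module Hᵐᵒᵖ 𝒜] [IsScalarTower k Hᵐᵒᵖ 𝒜] : Prop where
  /-- `(φ φ') φ'' = (X¹ · φ · x¹) ((X² · φ' · x²) (X³ · φ'' · x³))`. -/
  quasi_assoc : ∀ φ φ' φ'' : 𝒜, (φ * φ') * φ'' =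
    LinearMap.mul' k 𝒜 (TensorProduct.map LinearMap.id (LinearMap.mul' k 𝒜)
      (leftAct₃ k 𝒜 Q.reassoc.val (rightAct₃ k 𝒜 (Q.reassoc⁻¹).val (φ ⊗ₜ (φ' ⊗ₜ φ'')))))
  smul_mul : ∀ (h : H) (φ φ' : 𝒜),
    h • (φ * φ') = LinearMap.mul' k 𝒜 (leftAct₂ k 𝒜 (Q.comul h) (φ ⊗ₜ φ'))
  op_smul_mul : ∀ (h : H) (φ φ' : 𝒜),
    MulOpposite.op h • (φ * φ') = LinearMap.mul' k 𝒜 (rightAct₂ k 𝒜 (Q.comul h) (φ ⊗ₜ φ'))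
  smul_one : ∀ h : H, h • (1 : 𝒜) = Q.counit h • (1 : 𝒜)
  op_smul_one : ∀ h : H, MulOpposite.op h • (1 : 𝒜) = Q.counit h • (1 : 𝒜)

namespace QuasiHopfAlgebra

section Omega

variable {k H : Type*} [Field k] [Ring H] [Algebra k H] (Q : QuasiHopfAlgebra k H)
  {A : Type*} [Ring A] [Algebra k A] (C : TwoSidedData k H A)

/-- `Ω_δ = Ψ̄¹ ⊗ Ψ̄² ⊗ Ψ̄³ ⊗ S⁻¹(f¹ Ψ̄⁴) ⊗ S⁻¹(f² Ψ̄⁵)`, where `Ψ⁻¹ = Ψ̄¹ ⊗ ⋯ ⊗ Ψ̄⁵`. -/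
noncomputable def omega : H ⊗[k] (H ⊗[k] (A ⊗[k] (H ⊗[k] H))) :=
  TensorProduct.map LinearMap.id (TensorProduct.map LinearMap.id (TensorProduct.map LinearMap.id
      (TensorProduct.map Q.antipodeInv Q.antipodeInv)))
    (oneTensor H (oneTensor H (oneTensor A Q.drinfeldTwist)) * (C.Ψ⁻¹).val)

/-- `Ω'_δ = S⁻¹(Ψ¹ g¹) ⊗ S⁻¹(Ψ² g²) ⊗ Ψ³ ⊗ Ψ⁴ ⊗ Ψ⁵`, where `f⁻¹ = g¹ ⊗ g²`. -/
noncomputable def omega' : H ⊗[k] (H ⊗[k] (A ⊗[k] (H ⊗[k] H))) :=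
  TensorProduct.map Q.antipodeInv (TensorProduct.map Q.antipodeInv LinearMap.id)
    (C.Ψ.val * TensorProduct.assoc k H H (A ⊗[k] (H ⊗[k] H))
      (Ring.inverse Q.drinfeldTwist ⊗ₜ 1))

/-- `Ω¹ ⊗ Ω² u₍₋₁₎ ⊗ Ω³ u₍₀₎ ⊗ S⁻¹(u₍₁₎) Ω⁴ ⊗ Ω⁵` for `Ω ∈ H ⊗ H ⊗ A ⊗ H ⊗ H` and
`u₍₋₁₎ ⊗ u₍₀₎ ⊗ u₍₁₎ ∈ H ⊗ A ⊗ H`, bilinearly in the two tensors. -/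
noncomputable def absorb :
    H ⊗[k] (H ⊗[k] (A ⊗[k] (H ⊗[k] H))) →ₗ[k] H ⊗[k] (A ⊗[k] H) →ₗ[k]
      H ⊗[k] (H ⊗[k] (A ⊗[k] (H ⊗[k] H))) :=
  (TensorProduct.map₂ (LinearMap.mul k H) (TensorProduct.map₂ (LinearMap.mul k H)
      (TensorProduct.map₂ (LinearMap.mul k A) (TensorProduct.map₂
        ((LinearMap.mul k H).flip.compl₂ Q.antipodeInv) (LinearMap.mul k H))))).compl₂
    ((oneTensor (k := k) H).comp (tensorOne₃ H A H H)).toLinearMap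

/-- `Ω'¹ ⊗ Ω'² S⁻¹(u₍₋₁₎) ⊗ u₍₀₎ Ω'³ ⊗ u₍₁₎ Ω'⁴ ⊗ Ω'⁵` for `Ω' ∈ H ⊗ H ⊗ A ⊗ H ⊗ H` and
`u₍₋₁₎ ⊗ u₍₀₎ ⊗ u₍₁₎ ∈ H ⊗ A ⊗ H`, bilinearly in the two tensors. -/
noncomputable def absorb' :
    H ⊗[k] (H ⊗[k] (A ⊗[k] (H ⊗[k] H))) →ₗ[k] H ⊗[k] (A ⊗[k] H) →ₗ[k]
      H ⊗[k] (H ⊗[k] (A ⊗[k] (H ⊗[k] H))) :=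
  (TensorProduct.map₂ (LinearMap.mul k H) (TensorProduct.map₂
      ((LinearMap.mul k H).compl₂ Q.antipodeInv)
      (TensorProduct.map₂ (LinearMap.mul k A).flip (TensorProduct.map₂
        (LinearMap.mul k H).flip (LinearMap.mul k H))))).compl₂
    ((oneTensor (k := k) H).comp (tensorOne₃ H A H H)).toLinearMap

theorem absorb_tmul (h₁ h₂ h₄ h₅ p q : H) (a b : A) :
    Q.absorb (h₁ ⊗ₜ (h₂ ⊗ₜ (a ⊗ₜ (h₄ ⊗ₜ h₅)))) (p ⊗ₜ (b ⊗ₜ q)) =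
      h₁ ⊗ₜ[k] ((h₂ * p) ⊗ₜ[k] ((a * b) ⊗ₜ[k] ((Q.antipodeInv q * h₄) ⊗ₜ[k] h₅))) := by
  simp [absorb, oneTensor, tensorOne₃, idTensor]

theorem absorb'_tmul (h₁ h₂ h₄ h₅ p q : H) (a b : A) :
    Q.absorb' (h₁ ⊗ₜ (h₂ ⊗ₜ (a ⊗ₜ (h₄ ⊗ₜ h₅)))) (p ⊗ₜ (b ⊗ₜ q)) =
      h₁ ⊗ₜ[k] ((h₂ * Q.antipodeInv p) ⊗ₜ[k] ((b * a) ⊗ₜ[k] ((q * h₄) ⊗ₜ[k] h₅))) := by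
  simp [absorb', oneTensor, tensorOne₃, idTensor]

end Omega

end QuasiHopfAlgebra

section CrossedProducts

variable {k H : Type*} [Field k] [Ring H] [Algebra k H]
  {A : Type*} [Ring A] [Algebra k A]
  (𝒜 : Type*) [NonAssocRing 𝒜] [Module k 𝒜] [SMulCommClass k 𝒜 𝒜] [IsScalarTower k 𝒜 𝒜]
  [Module H 𝒜] [IsScalarTower k H 𝒜] [Module Hᵐᵒᵖ 𝒜] [IsScalarTower k Hᵐᵒᵖ 𝒜]

/-- For `W = W¹ ⊗ ⋯ ⊗ W⁵`, the map
`φ ⊗ φ' ↦ (W¹ · φ · W⁵) (W² · φ' · W⁴) ⊗ W³`, linearly in `W`. -/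
noncomputable def leftEval :
    H ⊗[k] (H ⊗[k] (A ⊗[k] (H ⊗[k] H))) →ₗ[k] 𝒜 ⊗[k] 𝒜 →ₗ[k] 𝒜 ⊗[k] A :=
  TensorProduct.lift
    { toFun := fun x => TensorProduct.lift (LinearMap.mk₂ k
        (fun (a : A) (y : H ⊗[k] H) => (TensorProduct.mk k 𝒜 A).flip a ∘ₗ LinearMap.mul' k 𝒜 ∘ₗ
          leftAct₂ k 𝒜 x ∘ₗ rightAct₂ k 𝒜 (TensorProduct.comm k H H y))
        (fun _ _ _ => by ext; simp) (fun _ _ _ => by ext; simp)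
        (fun _ _ _ => by ext; simp) (fun _ _ _ => by ext; simp))
      map_add' := fun _ _ => by ext; simp
      map_smul' := fun _ _ => by ext; simp } ∘ₗ
  (TensorProduct.assoc k H H (A ⊗[k] (H ⊗[k] H))).symm.toLinearMap

theorem leftEval_tmul (h₁ h₂ h₄ h₅ : H) (a : A) (φ φ' : 𝒜) :
    leftEval 𝒜 (h₁ ⊗ₜ[k] (h₂ ⊗ₜ (a ⊗ₜ (h₄ ⊗ₜ h₅)))) (φ ⊗ₜ φ') =
      ((h₁ • MulOpposite.op h₅ • φ) * (h₂ • MulOpposite.op h₄ • φ')) ⊗ₜ[k] a :=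
  rfl

/-- For `W = W¹ ⊗ ⋯ ⊗ W⁵`, the map
`φ ⊗ φ' ↦ W³ ⊗ (W² · φ · W⁴) (W¹ · φ' · W⁵)`, linearly in `W`. -/
noncomputable def rightEval :
    H ⊗[k] (H ⊗[k] (A ⊗[k] (H ⊗[k] H))) →ₗ[k] 𝒜 ⊗[k] 𝒜 →ₗ[k] A ⊗[k] 𝒜 :=
  TensorProduct.lift
    { toFun := fun x => TensorProduct.lift (LinearMap.mk₂ k
        (fun (a : A) (y : H ⊗[k] H) => TensorProduct.mk k A 𝒜 a ∘ₗ LinearMap.mul' k 𝒜 ∘ₗ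
          leftAct₂ k 𝒜 (TensorProduct.comm k H H x) ∘ₗ rightAct₂ k 𝒜 y)
        (fun _ _ _ => by ext; simp) (fun _ _ _ => by ext; simp)
        (fun _ _ _ => by ext; simp [TensorProduct.tmul_add]) (fun _ _ _ => by ext; simp))
      map_add' := fun _ _ => by ext; simp [TensorProduct.tmul_add]
      map_smul' := fun _ _ => by ext; simp } ∘ₗ
  (TensorProduct.assoc k H H (A ⊗[k] (H ⊗[k] H))).symm.toLinearMap

theorem rightEval_tmul (h₁ h₂ h₄ h₅ : H) (a : A) (φ φ' : 𝒜) :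
    rightEval 𝒜 (h₁ ⊗ₜ[k] (h₂ ⊗ₜ (a ⊗ₜ (h₄ ⊗ₜ h₅)))) (φ ⊗ₜ φ') =
      a ⊗ₜ[k] ((h₂ • MulOpposite.op h₄ • φ) * (h₁ • MulOpposite.op h₅ • φ')) :=
  rfl

/-- The multiplication of the left generalized diagonal crossed product `𝒜 ⋈_δ A`,
`(φ ⋈ u) (φ' ⋈ u') =
  (Ω¹ · φ · Ω⁵) (Ω² u₍₋₁₎ · φ' · S⁻¹(u₍₁₎) Ω⁴) ⋈ Ω³ u₍₀₎ u'`. -/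
noncomputable def leftCrossedMul (Q : QuasiHopfAlgebra k H) (C : TwoSidedData k H A) :
    𝒜 ⊗[k] A →ₗ[k] 𝒜 ⊗[k] A →ₗ[k] 𝒜 ⊗[k] A :=
  TensorProduct.lift (LinearMap.mk₂ k
    (fun φ u => TensorProduct.lift (LinearMap.mk₂ k
      (fun φ' u' => ((LinearMap.mul k A).flip u').lTensor 𝒜
        (leftEval 𝒜 (Q.absorb (Q.omega C) (C.δ u)) (φ ⊗ₜ φ')))
      (fun _ _ _ => by simp [TensorProduct.tmul_add])
      (fun _ _ _ => by simp)
      (fun _ _ _ => by rw [map_add, LinearMap.lTensor_add, LinearMap.add_apply])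
      (fun _ _ _ => by rw [map_smul, LinearMap.lTensor_smul, LinearMap.smul_apply])))
    (fun _ _ _ => by ext; simp [TensorProduct.add_tmul])
    (fun _ _ _ => by ext; simp [← TensorProduct.smul_tmul'])
    (fun _ _ _ => by ext; simp)
    (fun _ _ _ => by ext; simp))

theorem leftCrossedMul_tmul (Q : QuasiHopfAlgebra k H) (C : TwoSidedData k H A)
    (φ φ' : 𝒜) (u u' : A) :
    leftCrossedMul 𝒜 Q C (φ ⊗ₜ u) (φ' ⊗ₜ u') = ((LinearMap.mul k A).flip u').lTensor 𝒜
      (leftEval 𝒜 (Q.absorb (Q.omega C) (C.δ u)) (φ ⊗ₜ φ')) :=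
  rfl

/-- The multiplication of the right generalized diagonal crossed product `A ⋈_δ 𝒜`,
`(u ⋈ φ) (u' ⋈ φ') =
  u u'₍₀₎ Ω'³ ⋈ (Ω'² S⁻¹(u'₍₋₁₎) · φ · u'₍₁₎ Ω'⁴) (Ω'¹ · φ' · Ω'⁵)`. -/
noncomputable def rightCrossedMul (Q : QuasiHopfAlgebra k H) (C : TwoSidedData k H A) :
    A ⊗[k] 𝒜 →ₗ[k] A ⊗[k] 𝒜 →ₗ[k] A ⊗[k] 𝒜 :=
  TensorProduct.lift (LinearMap.mk₂ k
    (fun u φ => TensorProduct.lift (LinearMap.mk₂ k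
      (fun u' φ' => (LinearMap.mul k A u).rTensor 𝒜
        (rightEval 𝒜 (Q.absorb' (Q.omega' C) (C.δ u')) (φ ⊗ₜ φ')))
      (fun _ _ _ => by simp)
      (fun _ _ _ => by simp)
      (fun _ _ _ => by simp [TensorProduct.tmul_add])
      (fun _ _ _ => by simp)))
    (fun _ _ _ => by ext; simp [LinearMap.rTensor_add])
    (fun _ _ _ => by ext; simp [LinearMap.rTensor_smul])
    (fun _ _ _ => by ext; simp [TensorProduct.add_tmul])
    (fun _ _ _ => by ext; simp [← TensorProduct.smul_tmul']))

theorem rightCrossedMul_tmul (Q : QuasiHopfAlgebra k H) (C : TwoSidedData k H A)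
    (φ φ' : 𝒜) (u u' : A) :
    rightCrossedMul 𝒜 Q C (u ⊗ₜ φ) (u' ⊗ₜ φ') = (LinearMap.mul k A u).rTensor 𝒜
      (rightEval 𝒜 (Q.absorb' (Q.omega' C) (C.δ u')) (φ ⊗ₜ φ')) :=
  rfl

end CrossedProducts

/-- The bilinear multiplication `m` makes `M` an associative `k`-algebra with unit `e`. -/
structure IsUnitalAlgebra {k M : Type*} [Field k] [AddCommGroup M] [Module k M]
    (m : M →ₗ[k] M →ₗ[k] M) (e : M) : Prop where
  assoc : ∀ x y z : M, m (m x y) z = m x (m y z)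
  one_mul : ∀ x : M, m e x = x
  mul_one : ∀ x : M, m x e = x

/-- The linear map `ι` respects multiplication and units, as a map from `A` to `M` with
multiplication `m` and unit `e`. -/
structure IsUnitalAlgebraMap {k A M : Type*} [Field k] [Ring A] [Algebra k A]
    [AddCommGroup M] [Module k M] (m : M →ₗ[k] M →ₗ[k] M) (e : M) (ι : A →ₗ[k] M) : Prop where
  map_one : ι 1 = e
  map_mul : ∀ u v : A, ι (u * v) = m (ι u) (ι v)

section Conclusion

variable {k H : Type*} [Field k] [Ring H] [Algebra k H]
  {A : Type*} [Ring A] [Algebra k A]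
  (𝒜 : Type*) [NonAssocRing 𝒜] [Module k 𝒜] [SMulCommClass k 𝒜 𝒜] [IsScalarTower k 𝒜 𝒜]
  [Module H 𝒜] [IsScalarTower k H 𝒜] [Module Hᵐᵒᵖ 𝒜] [IsScalarTower k Hᵐᵒᵖ 𝒜]

/-- `𝒜 ⋈_δ A` is an associative algebra with unit `1 ⋈ 1`, and `u ↦ 1 ⋈ u` is a unital algebra
map. -/
def LeftCrossedIsAlgebra (Q : QuasiHopfAlgebra k H) (C : TwoSidedData k H A) : Prop :=
  IsUnitalAlgebra (leftCrossedMul 𝒜 Q C) (1 ⊗ₜ 1) ∧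
    IsUnitalAlgebraMap (leftCrossedMul 𝒜 Q C) (1 ⊗ₜ 1) (TensorProduct.mk k 𝒜 A 1)

/-- `A ⋈_δ 𝒜` is an associative algebra with unit `1 ⋈ 1`, and `u ↦ u ⋈ 1` is a unital algebra
map. -/
def RightCrossedIsAlgebra (Q : QuasiHopfAlgebra k H) (C : TwoSidedData k H A) : Prop :=
  IsUnitalAlgebra (rightCrossedMul 𝒜 Q C) (1 ⊗ₜ 1) ∧
    IsUnitalAlgebraMap (rightCrossedMul 𝒜 Q C) (1 ⊗ₜ 1) ((TensorProduct.mk k A 𝒜).flip 1)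

end Conclusion

end QuasiHopf

/-!
Axioms about elements of tensor powers become identities in an arbitrary algebra `R` once each
tensor leg is mapped to `R` by an algebra map, the images of different legs commuting. For such
maps, `joint` is the induced map on the tensor product, `pull` (in the cases at hand `star`) the
product of maps along a coproduct or coaction, and `phi`, `psi`, `twist`, `legs` are the values of
`Φ`, `Ψ`, `f` and of the elements of a bicomodule algebra. In this form coassociativity says that
these values intertwine products of maps (`Intertwines`), and the cocycle conditions are pentagons.

*The twist.* Relative to an algebra map `D : H → B` there is the notion of an antipode `(S, α, β)`
along `D`. Two such antipodes are conjugate by an explicit invertible element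
(`transition_mul_transition`). Both `Δ S` and `(S ⊗ S) Δᶜᵒᵖ` are antipodes along `Δ`
(`isAntipodeAlong_map`, `isAntipodeAlong_antipodeComul`; the latter rests on the snake identities
`snake` and `snake_inv`), and `f` is the element comparing them, hence invertible. The relation
`f₂₃ (id ⊗ Δ)(f) Φ = (S(X³) ⊗ S(X²) ⊗ S(X¹)) f₁₂ (Δ ⊗ id)(f)` (`twist_phi`) holds because both
sides intertwine the same maps and have the same product with the iterated coproduct of `α`
(`nested_caps`).

*Crossed products.* The product of `φ ⊗ x` and `φ' ⊗ y` arises from an element of `𝒜 ⊗ 𝒜 ⊗ 𝔸` by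
letting `Ψ⁻¹` act and then multiplying the first two factors with a twist by `f`. By `twist_phi`
and the quasi-associativity of `𝒜`, the twisted multiplications are associative up to `Φ` in the
left actions and `Φ⁻¹` in the right ones (`twistedMul_twistedMul`), and these are exactly the
factors in the cocycle condition of `Ψ`, whence associativity (`crossed_assoc`). For the right
crossed product the operators compose contravariantly, and `Ψ` and `f⁻¹` take the places of `Ψ⁻¹`
and `f` (`crossed_assoc_op`).

*Bicomodule algebras.* For `Ψ_l` and `Ψ_r` both sides of the cocycle condition are brought to a
common normal form by the pentagons and naturality (`cocycle_word_left`, `cocycle_word_right`).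
Evaluation at the inclusions of the tensor legs turns the resulting identities of values back into
identities of tensors (`coassoc_of_intertwines`, `cocycle_of_psi`). The maps from `𝔸` into the
crossed products are injective since, over a field, tensoring with a nonzero vector is.
-/

namespace QuasiHopf

/-! ### Algebra maps with commuting images -/

section Joint

variable {k : Type*} [Field k] {X X' Y Y' Z W R : Type*} [Ring X] [Algebra k X]
  [Ring Y] [Algebra k Y] [Ring X'] [Algebra k X'] [Ring Y'] [Algebra k Y']
  [Ring Z] [Algebra k Z] [Ring W] [Algebra k W] [Ring R] [Algebra k R]

/-- The images of the algebra maps `a` and `b` commute elementwise. A class, so that the joint maps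
below can be formed without carrying the proofs along. -/
class AlgCommute (a : X →ₐ[k] R) (b : Y →ₐ[k] R) : Prop where
  comm : ∀ x y, Commute (a x) (b y)

/-- The algebra map `x ⊗ y ↦ a(x) b(y)` given by two algebra maps with commuting images. -/
noncomputable def joint (a : X →ₐ[k] R) (b : Y →ₐ[k] R) [AlgCommute a b] : X ⊗[k] Y →ₐ[k] R :=
  Algebra.TensorProduct.lift a b AlgCommute.comm

@[simp]
theorem joint_tmul (a : X →ₐ[k] R) (b : Y →ₐ[k] R) [AlgCommute a b] (x : X) (y : Y) :
    joint a b (x ⊗ₜ y) = a x * b y := by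
  simp [joint]

/-- The product of `a` and `b` along the coaction `g`, that is `z ↦ a(z₁) b(z₂)` for
`g(z) = z₁ ⊗ z₂`. For `g = Δ` it is the tensor product of two representations. -/
noncomputable def pull (g : Z →ₐ[k] X ⊗[k] Y) (a : X →ₐ[k] R) (b : Y →ₐ[k] R) [AlgCommute a b] :
    Z →ₐ[k] R :=
  (joint a b).comp g

theorem pull_apply (g : Z →ₐ[k] X ⊗[k] Y) (a : X →ₐ[k] R) (b : Y →ₐ[k] R) [AlgCommute a b] (z : Z) :
    pull g a b z = joint a b (g z) := rfl

theorem commute_joint (r : R) (a : X →ₐ[k] R) (b : Y →ₐ[k] R) [AlgCommute a b]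
    (ha : ∀ x, Commute r (a x)) (hb : ∀ y, Commute r (b y)) (t : X ⊗[k] Y) :
    Commute r (joint a b t) := by
  induction t using TensorProduct.induction_on with
  | zero => simp
  | tmul x y => simpa using (ha x).mul_right (hb y)
  | add s t hs ht => simpa using hs.add_right ht

instance AlgCommute.joint_right (a : X →ₐ[k] R) (b : Y →ₐ[k] R) (c : Z →ₐ[k] R) [AlgCommute b c]
    [AlgCommute a b] [AlgCommute a c] : AlgCommute a (joint b c) :=
  ⟨fun x => commute_joint _ _ _ (comm x) (comm x)⟩

instance AlgCommute.joint_left (a : X →ₐ[k] R) (b : Y →ₐ[k] R) (c : Z →ₐ[k] R) [AlgCommute a b]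
    [AlgCommute a c] [AlgCommute b c] : AlgCommute (joint a b) c :=
  ⟨fun t z => (commute_joint _ _ _ (fun x => (comm x z).symm) (fun y => (comm y z).symm) t).symm⟩

instance AlgCommute.pull_right (g : W →ₐ[k] Y ⊗[k] Z) (a : X →ₐ[k] R) (b : Y →ₐ[k] R)
    (c : Z →ₐ[k] R) [AlgCommute b c] [AlgCommute a b] [AlgCommute a c] : AlgCommute a (pull g b c) :=
  ⟨fun x w => (inferInstance : AlgCommute a (joint b c)).comm x (g w)⟩

instance AlgCommute.pull_left (g : W →ₐ[k] X ⊗[k] Y) (a : X →ₐ[k] R) (b : Y →ₐ[k] R) (c : Z →ₐ[k] R)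
    [AlgCommute a b] [AlgCommute a c] [AlgCommute b c] : AlgCommute (pull g a b) c :=
  ⟨fun w z => (inferInstance : AlgCommute (joint a b) c).comm (g w) z⟩

/-- The counit `ε`, with values in an arbitrary algebra. -/
noncomputable def unitHom (ε : X →ₐ[k] k) (R : Type*) [Ring R] [Algebra k R] : X →ₐ[k] R :=
  (Algebra.ofId k R).comp ε

theorem unitHom_apply (ε : X →ₐ[k] k) (x : X) : unitHom ε R x = algebraMap k R (ε x) := rfl

instance AlgCommute.unitHom_left (ε : X →ₐ[k] k) (b : Y →ₐ[k] R) : AlgCommute (unitHom ε R) b :=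
  ⟨fun _ _ => Algebra.commutes _ _⟩

instance AlgCommute.unitHom_right (ε : Y →ₐ[k] k) (a : X →ₐ[k] R) : AlgCommute a (unitHom ε R) :=
  ⟨fun _ _ => (Algebra.commutes _ _).symm⟩

theorem joint_idTensor (a : X →ₐ[k] R) (b : Y →ₐ[k] R) (b' : Z →ₐ[k] R) [AlgCommute a b]
    [AlgCommute a b'] (g : Z →ₐ[k] Y) (h : ∀ z, b (g z) = b' z) (t : X ⊗[k] Z) :
    joint a b (idTensor X g t) = joint a b' t := by
  induction t using TensorProduct.induction_on with
  | zero => simp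
  | tmul x y => simp [idTensor, h]
  | add s t hs ht => simp [hs, ht]

theorem joint_assoc_tmul (a : X →ₐ[k] R) (b : Y →ₐ[k] R) (c : Z →ₐ[k] R) [AlgCommute a b]
    [AlgCommute a c] [AlgCommute b c] (t : X ⊗[k] Y) (z : Z) :
    joint a (joint b c) (Algebra.TensorProduct.assoc k k k X Y Z (t ⊗ₜ z)) = joint a b t * c z := by
  induction t using TensorProduct.induction_on with
  | zero => simp
  | tmul x y => simp [mul_assoc]
  | add s t hs ht => simp [TensorProduct.add_tmul, add_mul, hs, ht]

theorem joint_tensorId (a : X →ₐ[k] R) (b : Y →ₐ[k] R) (c : Z →ₐ[k] R) [AlgCommute a b]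
    [AlgCommute a c] [AlgCommute b c] (g : W →ₐ[k] X ⊗[k] Y) (t : W ⊗[k] Z) :
    joint a (joint b c) (tensorId g Z t) = joint (pull g a b) c t := by
  induction t using TensorProduct.induction_on with
  | zero => simp
  | tmul x y => simpa [tensorId, pull] using joint_assoc_tmul a b c (g x) y
  | add s t hs ht => simp [hs, ht]

theorem joint_oneTensor (a : X →ₐ[k] R) (b : Y →ₐ[k] R) [AlgCommute a b] (y : Y) :
    joint a b (oneTensor X y) = b y := by
  simp [oneTensor]

theorem joint_tensorOne₃ {C D : Type*} [Ring C] [Algebra k C] [Ring D] [Algebra k D]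
    (a : X →ₐ[k] R) (b : Y →ₐ[k] R) (c : C →ₐ[k] R) (d : D →ₐ[k] R)
    [AlgCommute a b] [AlgCommute a c] [AlgCommute b c] [AlgCommute a d] [AlgCommute b d]
    [AlgCommute c d] (t : X ⊗[k] (Y ⊗[k] C)) :
    joint a (joint b (joint c d)) (tensorOne₃ X Y C D t) = joint a (joint b c) t := by
  refine joint_idTensor _ _ _ _ (fun z => joint_idTensor _ _ _ _ (fun z => ?_) z) t
  simp

theorem joint_tensorOne₅ {C D E F : Type*} [Ring C] [Algebra k C] [Ring D] [Algebra k D]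
    [Ring E] [Algebra k E] [Ring F] [Algebra k F]
    (a : X →ₐ[k] R) (b : Y →ₐ[k] R) (c : C →ₐ[k] R) (d : D →ₐ[k] R) (e : E →ₐ[k] R) (f : F →ₐ[k] R)
    [AlgCommute a b] [AlgCommute a c] [AlgCommute b c] [AlgCommute a d] [AlgCommute b d]
    [AlgCommute c d] [AlgCommute a e] [AlgCommute b e] [AlgCommute c e] [AlgCommute d e]
    [AlgCommute a f] [AlgCommute b f] [AlgCommute c f] [AlgCommute d f] [AlgCommute e f]
    (t : X ⊗[k] (Y ⊗[k] (C ⊗[k] (D ⊗[k] E)))) :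
    joint a (joint b (joint c (joint d (joint e f)))) (tensorOne₅ X Y C D E F t) =
      joint a (joint b (joint c (joint d e))) t :=
  joint_idTensor _ _ _ _ (fun z => joint_idTensor _ _ _ _ (joint_tensorOne₃ c d e f) z) t

theorem apply_counitLeft (ε : X →ₐ[k] k) (c : Y →ₐ[k] R) (t : X ⊗[k] Y) :
    c (counitLeft ε Y t) = joint (unitHom ε R) c t := by
  induction t using TensorProduct.induction_on with
  | zero => simp
  | tmul x y => simp [counitLeft, unitHom_apply, Algebra.smul_def]
  | add s t hs ht => simp [hs, ht]

theorem apply_counitRight (ε : X →ₐ[k] k) (c : Y →ₐ[k] R) (t : Y ⊗[k] X) :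
    c (counitRight ε Y t) = joint c (unitHom ε R) t := by
  induction t using TensorProduct.induction_on with
  | zero => simp
  | tmul x y => simp [counitRight, unitHom_apply, Algebra.smul_def, Algebra.commutes]
  | add s t hs ht => simp [hs, ht]

theorem joint_tensorId₃ {C D : Type*} [Ring C] [Algebra k C] [Ring D] [Algebra k D]
    (a : X →ₐ[k] R) (b : Y →ₐ[k] R) (c : C →ₐ[k] R) (d : D →ₐ[k] R)
    [AlgCommute a b] [AlgCommute a c] [AlgCommute b c] [AlgCommute a d] [AlgCommute b d]
    [AlgCommute c d] (g : W →ₐ[k] X ⊗[k] (Y ⊗[k] C)) (t : W ⊗[k] D) :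
    joint a (joint b (joint c d)) (tensorId₃ g D t) = joint (pull g a (joint b c)) d t := by
  unfold tensorId₃
  rw [← joint_tensorId]
  refine joint_idTensor _ _ _ (Algebra.TensorProduct.assoc k k k Y C D).toAlgHom (fun z => ?_)
    (tensorId g D t)
  induction z using TensorProduct.induction_on with
  | zero => simp
  | tmul x y => exact joint_assoc_tmul b c d x y
  | add s t hs ht => rw [map_add, map_add, map_add, hs, ht]

/-- `w` intertwines the algebra maps `p` and `q`. -/
def Intertwines (w : R) (p q : X →ₐ[k] R) : Prop := ∀ x, w * p x = q x * w

theorem Intertwines.trans {w w' : R} {p q r : X →ₐ[k] R} (h : Intertwines w p q)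
    (h' : Intertwines w' q r) : Intertwines (w' * w) p r := by
  intro x
  rw [mul_assoc, h, ← mul_assoc, h', mul_assoc]

theorem AlgCommute.symm (a : X →ₐ[k] R) (b : Y →ₐ[k] R) [AlgCommute a b] : AlgCommute b a :=
  ⟨fun y x => (AlgCommute.comm x y).symm⟩

theorem Intertwines.joint {w : R} {p q : X →ₐ[k] R} {p' q' : Y →ₐ[k] R} [AlgCommute p p']
    [AlgCommute q q'] (h : Intertwines w p q) (h' : Intertwines w p' q') :
    Intertwines w (joint p p') (joint q q') := by
  intro t
  induction t using TensorProduct.induction_on with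
  | zero => simp
  | tmul x y => rw [joint_tmul, joint_tmul, ← mul_assoc, h, mul_assoc, h', mul_assoc]
  | add s t hs ht => simp only [map_add, mul_add, add_mul, hs, ht]

theorem Intertwines.pull {w : R} {p q : X →ₐ[k] R} {p' q' : Y →ₐ[k] R} [AlgCommute p p']
    [AlgCommute q q'] (h : Intertwines w p q) (h' : Intertwines w p' q') (g : Z →ₐ[k] X ⊗[k] Y) :
    Intertwines w (pull g p p') (pull g q q') :=
  fun z => h.joint h' (g z)

theorem intertwines_left (a : X →ₐ[k] R) (b : Y →ₐ[k] R) [AlgCommute a b] (x : X) :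
    Intertwines (a x) b b :=
  fun y => AlgCommute.comm x y

theorem intertwines_right (a : X →ₐ[k] R) (b : Y →ₐ[k] R) [AlgCommute a b] (y : Y) :
    Intertwines (b y) a a :=
  fun x => (AlgCommute.comm x y).symm

/-- Under the linear map `E`, left multiplication by values of `p` and of `q` agree. -/
def LeftCongr {N : Type*} [AddCommGroup N] [Module k N] (E : R →ₗ[k] N) (p q : X →ₐ[k] R) : Prop :=
  ∀ x c, E (p x * c) = E (q x * c)

/-- Under the linear map `E`, right multiplication by values of `p` and of `q` agree. -/
def RightCongr {N : Type*} [AddCommGroup N] [Module k N] (E : R →ₗ[k] N) (p q : X →ₐ[k] R) : Prop :=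
  ∀ x c, E (c * p x) = E (c * q x)

section Congr

variable {N : Type*} [AddCommGroup N] [Module k N] {E : R →ₗ[k] N}

theorem LeftCongr.refl (p : X →ₐ[k] R) : LeftCongr E p p := fun _ _ => rfl

theorem LeftCongr.trans {p q r : X →ₐ[k] R} (h : LeftCongr E p q) (h' : LeftCongr E q r) :
    LeftCongr E p r := fun x c => (h x c).trans (h' x c)

theorem RightCongr.refl (p : X →ₐ[k] R) : RightCongr E p p := fun _ _ => rfl

theorem RightCongr.trans {p q r : X →ₐ[k] R} (h : RightCongr E p q) (h' : RightCongr E q r) :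
    RightCongr E p r := fun x c => (h x c).trans (h' x c)

theorem LeftCongr.joint {p q : X →ₐ[k] R} {p' q' : Y →ₐ[k] R} [AlgCommute p p']
    [AlgCommute q q'] [AlgCommute q p'] (h : LeftCongr E p q) (h' : LeftCongr E p' q') :
    LeftCongr E (joint p p') (joint q q') := by
  intro t c
  induction t using TensorProduct.induction_on with
  | zero => simp
  | tmul x y =>
    rw [joint_tmul, joint_tmul, mul_assoc, h, ← mul_assoc, (AlgCommute.comm x y).eq, mul_assoc, h',
      ← mul_assoc, ← (AlgCommute.comm x y).eq]
  | add s t hs ht => simp only [map_add, add_mul, hs, ht]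

theorem RightCongr.joint {p q : X →ₐ[k] R} {p' q' : Y →ₐ[k] R} [AlgCommute p p']
    [AlgCommute q q'] [AlgCommute p q'] (h : RightCongr E p q) (h' : RightCongr E p' q') :
    RightCongr E (joint p p') (joint q q') := by
  intro t c
  induction t using TensorProduct.induction_on with
  | zero => simp
  | tmul x y =>
    rw [joint_tmul, joint_tmul, ← mul_assoc, h', mul_assoc, (AlgCommute.comm x y).eq,
      ← mul_assoc, h,
      mul_assoc, ← (AlgCommute.comm x y).eq]
  | add s t hs ht => simp only [map_add, mul_add, hs, ht]

theorem LeftCongr.pull {p q : X →ₐ[k] R} {p' q' : Y →ₐ[k] R} [AlgCommute p p']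
    [AlgCommute q q'] [AlgCommute q p'] (h : LeftCongr E p q) (h' : LeftCongr E p' q')
    (g : Z →ₐ[k] X ⊗[k] Y) : LeftCongr E (pull g p p') (pull g q q') :=
  fun z => h.joint h' (g z)

theorem RightCongr.pull {p q : X →ₐ[k] R} {p' q' : Y →ₐ[k] R} [AlgCommute p p']
    [AlgCommute q q'] [AlgCommute p q'] (h : RightCongr E p q) (h' : RightCongr E p' q')
    (g : Z →ₐ[k] X ⊗[k] Y) : RightCongr E (pull g p p') (pull g q q') :=
  fun z => h.joint h' (g z)

theorem LeftCongr.mulLeft {p q : X →ₐ[k] R} (h : LeftCongr E p q) {w : R}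
    (hp : Intertwines w p p) (hq : Intertwines w q q) :
    LeftCongr (E ∘ₗ LinearMap.mulLeft k w) p q := by
  intro x c
  simp only [LinearMap.comp_apply, LinearMap.mulLeft_apply, ← mul_assoc]
  rw [hp, hq, mul_assoc, mul_assoc, h]

theorem RightCongr.mulRight {p q : X →ₐ[k] R} (h : RightCongr E p q) {w : R}
    (hp : Intertwines w p p) (hq : Intertwines w q q) :
    RightCongr (E ∘ₗ LinearMap.mulRight k w) p q := by
  intro x c
  simp only [LinearMap.comp_apply, LinearMap.mulRight_apply, mul_assoc]
  rw [← hp, ← hq, ← mul_assoc, ← mul_assoc, h]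

theorem intertwines_unitHom (w : R) (ε : X →ₐ[k] k) :
    Intertwines w (unitHom ε R) (unitHom ε R) :=
  fun _ => (Algebra.commutes _ _).symm

end Congr

end Joint

namespace QuasiBialgebra

variable {k H R : Type*} [Field k] [Ring H] [Algebra k H] [Ring R] [Algebra k R]
  (Q : QuasiBialgebra k H)

/-- `a ⋆ b`, the tensor product of `a` and `b` along `Δ`. -/
noncomputable abbrev star (a b : H →ₐ[k] R) [AlgCommute a b] : H →ₐ[k] R := pull Q.comul a b

/-- The value of the reassociator in `R`, with legs mapped by `a`, `b`, `c`. -/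
noncomputable def phi (a b c : H →ₐ[k] R) [AlgCommute a b] [AlgCommute a c] [AlgCommute b c] : R :=
  joint a (joint b c) Q.reassoc.val

/-- The inverse of `phi a b c`. -/
noncomputable def phiInv (a b c : H →ₐ[k] R) [AlgCommute a b] [AlgCommute a c] [AlgCommute b c] :
    R :=
  joint a (joint b c) (Q.reassoc⁻¹).val

section

variable (a b c : H →ₐ[k] R) [AlgCommute a b] [AlgCommute a c] [AlgCommute b c]

@[simp]
theorem phi_mul_phiInv : Q.phi a b c * Q.phiInv a b c = 1 := by
  rw [phi, phiInv, ← map_mul, Units.mul_inv, map_one]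

@[simp]
theorem phiInv_mul_phi : Q.phiInv a b c * Q.phi a b c = 1 := by
  rw [phi, phiInv, ← map_mul, Units.inv_mul, map_one]

@[simp]
theorem phi_mul_phiInv_mul (r : R) : Q.phi a b c * (Q.phiInv a b c * r) = r := by
  rw [← mul_assoc, phi_mul_phiInv, one_mul]

@[simp]
theorem phiInv_mul_phi_mul (r : R) : Q.phiInv a b c * (Q.phi a b c * r) = r := by
  rw [← mul_assoc, phiInv_mul_phi, one_mul]

theorem phi_intertwines :
    Intertwines (Q.phi a b c) (Q.star (Q.star a b) c) (Q.star a (Q.star b c)) := by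
  intro h
  have := congrArg (joint a (joint b c)) (Q.quasi_coassoc h)
  simp only [map_mul] at this
  rw [joint_tensorId, joint_idTensor _ _ _ _ (fun z => (pull_apply Q.comul b c z).symm)] at this
  change _ = Q.phi a b c * _ * Q.phiInv a b c at this
  rw [pull_apply, pull_apply, this, mul_assoc _ (Q.phiInv a b c), phiInv_mul_phi, mul_one]

theorem phiInv_intertwines :
    Intertwines (Q.phiInv a b c) (Q.star a (Q.star b c)) (Q.star (Q.star a b) c) := by
  intro h
  rw [← mul_one (_ * _), ← Q.phi_mul_phiInv a b c, ← mul_assoc, mul_assoc (Q.phiInv a b c),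
    ← Q.phi_intertwines, phiInv_mul_phi_mul]

theorem star_unitHom (a : H →ₐ[k] R) : Q.star a (unitHom Q.counit R) = a := by
  ext h
  rw [pull_apply, ← apply_counitRight, Q.counit_right]

theorem unitHom_star (a : H →ₐ[k] R) : Q.star (unitHom Q.counit R) a = a := by
  ext h
  rw [pull_apply, ← apply_counitLeft, Q.counit_left]

theorem phi_unit_mid : Q.phi a (unitHom Q.counit R) c = 1 := by
  have := congrArg (joint a c) Q.reassoc_normalized
  rwa [joint_idTensor _ _ _ _ (apply_counitLeft Q.counit c), map_one] at this

variable (d : H →ₐ[k] R) [AlgCommute a d] [AlgCommute b d] [AlgCommute c d]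

theorem pentagon : Q.phi b c d * Q.phi a (Q.star b c) d * Q.phi a b c =
    Q.phi a b (Q.star c d) * Q.phi (Q.star a b) c d := by
  have := congrArg (joint a (joint b (joint c d))) Q.cocycle
  simp only [map_mul] at this
  rwa [joint_oneTensor, joint_tensorOne₃, joint_tensorId,
    joint_idTensor _ _ _ _ (fun z => joint_tensorId b c d Q.comul z),
    joint_idTensor _ _ _ _ (fun z => joint_idTensor _ _ _ _
      (fun z => (pull_apply Q.comul c d z).symm) z)] at this

end

end QuasiBialgebra
end QuasiHopf

namespace QuasiHopf

/-! ### Consequences of the pentagon -/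

namespace QuasiBialgebra

variable {k H R : Type*} [Field k] [Ring H] [Algebra k H] [Ring R] [Algebra k R]
  (Q : QuasiBialgebra k H)

section

variable {a b c a' b' c' : H →ₐ[k] R} [AlgCommute a b] [AlgCommute a c] [AlgCommute b c]
  [AlgCommute a' b'] [AlgCommute a' c'] [AlgCommute b' c'] {w : R}

theorem Intertwines.phi (ha : Intertwines w a a') (hb : Intertwines w b b')
    (hc : Intertwines w c c') : w * Q.phi a b c = Q.phi a' b' c' * w :=
  ha.joint (hb.joint hc) _

theorem Intertwines.phiInv (ha : Intertwines w a a') (hb : Intertwines w b b')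
    (hc : Intertwines w c c') : w * Q.phiInv a b c = Q.phiInv a' b' c' * w :=
  ha.joint (hb.joint hc) _

theorem phi_left_commute (d : H →ₐ[k] R) [AlgCommute a d] [AlgCommute b d] [AlgCommute c d] :
    Intertwines (Q.phi a b c) d d :=
  intertwines_left (joint a (joint b c)) d _

theorem phi_right_commute (d : H →ₐ[k] R) [AlgCommute d a] [AlgCommute d b] [AlgCommute d c] :
    Intertwines (Q.phi a b c) d d :=
  intertwines_right d (joint a (joint b c)) _

theorem phi_commute_third (d : H →ₐ[k] R) [AlgCommute a d] [AlgCommute b d] [AlgCommute d c] :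
    Intertwines (Q.phi a b c) d d := fun h =>
  (commute_joint (d h) a (joint b c) (fun x => (AlgCommute.comm x h).symm)
    (commute_joint (d h) b c (fun x => (AlgCommute.comm x h).symm)
      (fun x => AlgCommute.comm h x)) _).symm

theorem phi_commute_second (d : H →ₐ[k] R) [AlgCommute a d] [AlgCommute d b] [AlgCommute d c] :
    Intertwines (Q.phi a b c) d d := fun h =>
  (commute_joint (d h) a (joint b c) (fun x => (AlgCommute.comm x h).symm)
    (fun t => AlgCommute.comm h t) _).symm

theorem phiInv_commute_third (d : H →ₐ[k] R) [AlgCommute a d] [AlgCommute b d] [AlgCommute d c] :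
    Intertwines (Q.phiInv a b c) d d := fun h =>
  (commute_joint (d h) a (joint b c) (fun x => (AlgCommute.comm x h).symm)
    (commute_joint (d h) b c (fun x => (AlgCommute.comm x h).symm)
      (fun x => AlgCommute.comm h x)) _).symm

theorem phiInv_commute_second (d : H →ₐ[k] R) [AlgCommute a d] [AlgCommute d b] [AlgCommute d c] :
    Intertwines (Q.phiInv a b c) d d := fun h =>
  (commute_joint (d h) a (joint b c) (fun x => (AlgCommute.comm x h).symm)
    (fun t => AlgCommute.comm h t) _).symm

theorem phiInv_left_commute (d : H →ₐ[k] R) [AlgCommute a d] [AlgCommute b d] [AlgCommute c d] :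
    Intertwines (Q.phiInv a b c) d d :=
  intertwines_left (joint a (joint b c)) d _

end

section

variable (a b c d : H →ₐ[k] R) [AlgCommute a b] [AlgCommute a c] [AlgCommute b c]
  [AlgCommute a d] [AlgCommute b d] [AlgCommute c d]

/-- Only the normalization of the middle leg is an axiom; that of the outer legs follows from the
pentagon with two adjacent legs equal to the counit. -/
theorem phi_unit_left : Q.phi (unitHom Q.counit R) b c = 1 := by
  have := Q.pentagon (unitHom Q.counit R) (unitHom Q.counit R) b c
  simp only [unitHom_star, star_unitHom, phi_unit_mid, mul_one] at this
  simpa using congrArg (Q.phiInv (unitHom Q.counit R) b c * ·) this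

theorem phi_unit_right : Q.phi a b (unitHom Q.counit R) = 1 := by
  have := Q.pentagon a b (unitHom Q.counit R) (unitHom Q.counit R)
  simp only [star_unitHom, phi_unit_mid, one_mul, mul_one] at this
  simpa using congrArg (Q.phiInv a b (unitHom Q.counit R) * ·) this

theorem phiInv_unit_left : Q.phiInv (unitHom Q.counit R) b c = 1 := by
  simpa [phi_unit_left] using Q.phi_mul_phiInv (unitHom Q.counit R) b c

theorem phiInv_unit_right : Q.phiInv a b (unitHom Q.counit R) = 1 := by
  simpa [phi_unit_right] using Q.phi_mul_phiInv a b (unitHom Q.counit R)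

theorem phiInv_unit_mid : Q.phiInv a (unitHom Q.counit R) c = 1 := by
  simpa [phi_unit_mid] using Q.phi_mul_phiInv a (unitHom Q.counit R) c

theorem eq_phiInv_mul_iff (r s : R) : r = Q.phiInv a b c * s ↔ Q.phi a b c * r = s := by
  constructor <;> rintro rfl <;> simp

theorem eq_mul_phiInv_iff (r s : R) : r = s * Q.phiInv a b c ↔ r * Q.phi a b c = s := by
  constructor <;> rintro rfl <;> simp [mul_assoc]

end

section FourLegs

variable (a b c d : H →ₐ[k] R) [AlgCommute a b] [AlgCommute a c] [AlgCommute b c]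
  [AlgCommute a d] [AlgCommute b d] [AlgCommute c d]
  {N : Type*} [AddCommGroup N] [Module k N] {E : R →ₗ[k] N}

/-- A cap on the legs `1, 2`, a cup on `2, 3` and a cap on `3, 4`: the snake may be straightened at
either end. -/
theorem phiInv_eq_phi_of_congr (h12 : LeftCongr E (Q.star a b) (unitHom Q.counit R))
    (h34 : LeftCongr E (Q.star c d) (unitHom Q.counit R))
    (h23 : RightCongr E (Q.star b c) (unitHom Q.counit R)) :
    E (Q.phiInv a b c) = E (Q.phi b c d) := by
  have p := Q.pentagon a b c d
  rw [← eq_mul_phiInv_iff, mul_assoc] at p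
  have e1 : E (Q.phi b c d * Q.phi a (Q.star b c) d) = E (Q.phi b c d) := by
    refine (((RightCongr.refl a).joint (h23.joint (RightCongr.refl d))) _ _).trans ?_
    change E (_ * Q.phi _ _ _) = _
    rw [phi_unit_mid, mul_one]
  rw [← e1, p]
  symm
  refine (((LeftCongr.refl a).joint ((LeftCongr.refl b).joint h34)) _ _).trans ?_
  change E (Q.phi _ _ _ * _) = _
  rw [phi_unit_right, one_mul]
  refine ((h12.joint (LeftCongr.refl (joint c d))) _ _).trans ?_
  change E (Q.phi _ _ _ * _) = _
  rw [phi_unit_left, one_mul]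

end FourLegs

section SixLegs

variable (a₁ a₂ a₃ a₄ a₅ a₆ : H →ₐ[k] R)
  [AlgCommute a₁ a₂] [AlgCommute a₁ a₃] [AlgCommute a₁ a₄] [AlgCommute a₁ a₅] [AlgCommute a₁ a₆]
  [AlgCommute a₂ a₃] [AlgCommute a₂ a₄] [AlgCommute a₂ a₅] [AlgCommute a₂ a₆]
  [AlgCommute a₃ a₄] [AlgCommute a₃ a₅] [AlgCommute a₃ a₆]
  [AlgCommute a₄ a₅] [AlgCommute a₄ a₆] [AlgCommute a₅ a₆]

/-- A rearrangement of the word occurring in `snake`, by two pentagons and naturality. -/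
theorem snake_word :
    Q.phi a₃ a₄ a₅ * Q.phiInv (Q.star a₃ a₄) a₅ a₆ *
        Q.phi (Q.star a₁ a₂) (Q.star a₃ a₄) (Q.star a₅ a₆) *
        (Q.phi (Q.star a₁ a₂) a₃ a₄ * Q.phiInv a₁ a₂ a₃) =
      Q.phi (Q.star a₁ a₂) (Q.star a₃ (Q.star a₄ a₅)) a₆ *
        Q.phi (Q.star a₁ a₂) a₃ (Q.star a₄ a₅) *
        Q.phiInv a₁ a₂ a₃ * Q.phi (Q.star a₁ (Q.star a₂ a₃)) a₄ a₅ *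
        Q.phiInv (Q.star (Q.star a₁ (Q.star a₂ a₃)) a₄) a₅ a₆ := by
  rw [eq_mul_phiInv_iff]
  have p1 := Q.pentagon (Q.star a₁ a₂) (Q.star a₃ a₄) a₅ a₆
  have p2 := Q.pentagon (Q.star a₁ a₂) a₃ a₄ a₅
  have n1 := Intertwines.phi Q (Q.phi_right_commute (a := a₃) (b := a₄) (c := a₅) (Q.star a₁ a₂))
    (Q.phi_intertwines a₃ a₄ a₅) (Q.phi_left_commute a₆)
  have n2 := Intertwines.phi Q (Q.phi_intertwines (Q.star a₁ a₂) a₃ a₄)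
    (Q.phi_left_commute a₅) (Q.phi_left_commute a₆)
  have n3 := Intertwines.phi Q
    ((Q.phiInv_intertwines a₁ a₂ a₃).pull (Q.phiInv_left_commute a₄) Q.comul)
    (Q.phiInv_left_commute a₅) (Q.phiInv_left_commute a₆)
  have n4 := Intertwines.phi Q (Q.phiInv_intertwines a₁ a₂ a₃)
    (Q.phiInv_left_commute a₄) (Q.phiInv_left_commute a₅)
  calc _ = Q.phi a₃ a₄ a₅ * Q.phiInv (Q.star a₃ a₄) a₅ a₆ *
        Q.phi (Q.star a₁ a₂) (Q.star a₃ a₄) (Q.star a₅ a₆) * Q.phi (Q.star a₁ a₂) a₃ a₄ *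
        (Q.phiInv a₁ a₂ a₃ * Q.phi (Q.star (Q.star a₁ (Q.star a₂ a₃)) a₄) a₅ a₆) := by
        simp only [mul_assoc]
    _ = Q.phi a₃ a₄ a₅ * Q.phiInv (Q.star a₃ a₄) a₅ a₆ *
        Q.phi (Q.star a₁ a₂) (Q.star a₃ a₄) (Q.star a₅ a₆) *
        (Q.phi (Q.star a₁ a₂) a₃ a₄ * Q.phi (Q.star (Q.star (Q.star a₁ a₂) a₃) a₄) a₅ a₆) *
        Q.phiInv a₁ a₂ a₃ := by
        rw [n3]; simp only [mul_assoc]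
    _ = Q.phi a₃ a₄ a₅ * Q.phiInv (Q.star a₃ a₄) a₅ a₆ *
        (Q.phi (Q.star a₁ a₂) (Q.star a₃ a₄) (Q.star a₅ a₆) *
          Q.phi (Q.star (Q.star a₁ a₂) (Q.star a₃ a₄)) a₅ a₆) * Q.phi (Q.star a₁ a₂) a₃ a₄ *
        Q.phiInv a₁ a₂ a₃ := by
        rw [n2]; simp only [mul_assoc]
    _ = (Q.phi a₃ a₄ a₅ * Q.phi (Q.star a₁ a₂) (Q.star (Q.star a₃ a₄) a₅) a₆) *
        Q.phi (Q.star a₁ a₂) (Q.star a₃ a₄) a₅ * Q.phi (Q.star a₁ a₂) a₃ a₄ *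
        Q.phiInv a₁ a₂ a₃ := by
        rw [← p1]; simp only [mul_assoc, phiInv_mul_phi_mul]
    _ = Q.phi (Q.star a₁ a₂) (Q.star a₃ (Q.star a₄ a₅)) a₆ *
        (Q.phi a₃ a₄ a₅ * Q.phi (Q.star a₁ a₂) (Q.star a₃ a₄) a₅ * Q.phi (Q.star a₁ a₂) a₃ a₄) *
        Q.phiInv a₁ a₂ a₃ := by
        rw [n1]; simp only [mul_assoc]
    _ = _ := by
        rw [p2]; simp only [mul_assoc]; rw [← n4]

/-- The word occurring in `snake_inv`, rearranged: the inverse of `snake_word`. -/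
theorem snake_word_inv :
    Q.phi a₁ a₂ a₃ * Q.phiInv (Q.star a₁ a₂) a₃ a₄ *
        Q.phiInv (Q.star a₁ a₂) (Q.star a₃ a₄) (Q.star a₅ a₆) *
        (Q.phi (Q.star a₃ a₄) a₅ a₆ * Q.phiInv a₃ a₄ a₅) =
      Q.phi (Q.star (Q.star a₁ (Q.star a₂ a₃)) a₄) a₅ a₆ *
        Q.phiInv (Q.star a₁ (Q.star a₂ a₃)) a₄ a₅ * Q.phi a₁ a₂ a₃ *
        Q.phiInv (Q.star a₁ a₂) a₃ (Q.star a₄ a₅) *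
        Q.phiInv (Q.star a₁ a₂) (Q.star a₃ (Q.star a₄ a₅)) a₆ := by
  refine (left_inv_eq_right_inv (a := Q.phi (Q.star a₁ a₂) (Q.star a₃ (Q.star a₄ a₅)) a₆ *
        Q.phi (Q.star a₁ a₂) a₃ (Q.star a₄ a₅) *
        Q.phiInv a₁ a₂ a₃ * Q.phi (Q.star a₁ (Q.star a₂ a₃)) a₄ a₅ *
        Q.phiInv (Q.star (Q.star a₁ (Q.star a₂ a₃)) a₄) a₅ a₆) ?_ ?_).symm
  · simp [mul_assoc]
  · rw [← snake_word]
    simp [mul_assoc]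

variable {N : Type*} [AddCommGroup N] [Module k N] {E : R →ₗ[k] N}

/-- Two nested cups on the legs `2, 3` and `1, 4`, followed by two nested caps on `4, 5` and `3, 6`,
are two separate snakes. -/
theorem snake (h45 : LeftCongr E (Q.star a₄ a₅) (unitHom Q.counit R))
    (h36 : LeftCongr E (Q.star a₃ a₆) (unitHom Q.counit R))
    (h23 : RightCongr E (Q.star a₂ a₃) (unitHom Q.counit R))
    (h14 : RightCongr E (Q.star a₁ a₄) (unitHom Q.counit R)) :
    E (Q.phi a₃ a₄ a₅ * Q.phiInv (Q.star a₃ a₄) a₅ a₆ *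
        Q.phi (Q.star a₁ a₂) (Q.star a₃ a₄) (Q.star a₅ a₆) *
        (Q.phi (Q.star a₁ a₂) a₃ a₄ * Q.phiInv a₁ a₂ a₃)) =
      E (Q.phi a₂ a₃ a₆ * Q.phi a₁ a₄ a₅) := by
  have r123 : RightCongr E (Q.star a₁ (Q.star a₂ a₃)) a₁ := by
    simpa only [star_unitHom] using (RightCongr.refl a₁).pull h23 Q.comul
  have r1234 := (r123.pull (RightCongr.refl a₄) Q.comul).trans h14
  have l345 : LeftCongr E (Q.star a₃ (Q.star a₄ a₅)) a₃ := by
    simpa only [star_unitHom] using (LeftCongr.refl a₃).pull h45 Q.comul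
  have p := Q.pentagon a₁ a₂ a₃ a₆
  have p' : Q.phi (Q.star a₁ a₂) a₃ a₆ * Q.phiInv a₁ a₂ a₃ =
      Q.phiInv a₁ a₂ (Q.star a₃ a₆) * (Q.phi a₂ a₃ a₆ * Q.phi a₁ (Q.star a₂ a₃) a₆) := by
    rw [eq_phiInv_mul_iff, ← mul_assoc, ← p]; simp [mul_assoc]
  rw [snake_word]
  -- A cap lets the leftmost factors, a cup the rightmost ones, be evaluated with counits in the
  -- legs concerned, where `Φ` is normalized.
  calc _ = E (Q.phi (Q.star a₁ a₂) (Q.star a₃ (Q.star a₄ a₅)) a₆ *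
        Q.phi (Q.star a₁ a₂) a₃ (Q.star a₄ a₅) *
        Q.phiInv a₁ a₂ a₃ * Q.phi (Q.star a₁ (Q.star a₂ a₃)) a₄ a₅) := by
        refine ((r1234.joint (RightCongr.refl (joint a₅ a₆))) _ _).trans ?_
        change E (_ * Q.phiInv _ _ _) = _
        rw [phiInv_unit_left, mul_one]
    _ = E (Q.phi (Q.star a₁ a₂) (Q.star a₃ (Q.star a₄ a₅)) a₆ *
        (Q.phi (Q.star a₁ a₂) a₃ (Q.star a₄ a₅) *
        Q.phiInv a₁ a₂ a₃ * Q.phi a₁ a₄ a₅)) := by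
        refine ((r123.joint (RightCongr.refl (joint a₄ a₅))) _ _).trans ?_
        simp only [mul_assoc]; rfl
    _ = E (Q.phi (Q.star a₁ a₂) a₃ a₆ * (Q.phi (Q.star a₁ a₂) a₃ (Q.star a₄ a₅) *
        (Q.phiInv a₁ a₂ a₃ * Q.phi a₁ a₄ a₅))) := by
        refine (((LeftCongr.refl (Q.star a₁ a₂)).joint
          (l345.joint (LeftCongr.refl a₆))) _ _).trans ?_
        simp only [mul_assoc]; rfl
    _ = E (Q.phi (Q.star a₁ a₂) a₃ a₆ * (Q.phiInv a₁ a₂ a₃ * Q.phi a₁ a₄ a₅)) := by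
        have h : LeftCongr (E ∘ₗ LinearMap.mulLeft k (Q.phi (Q.star a₁ a₂) a₃ a₆)) _ _ :=
          h45.mulLeft ((Q.phi_commute_third a₄).pull (Q.phi_commute_third a₅) Q.comul)
            (intertwines_unitHom _ _)
        refine (((LeftCongr.refl (Q.star a₁ a₂)).joint ((LeftCongr.refl a₃).joint h)) _ _).trans ?_
        change E (_ * (Q.phi _ _ _ * _)) = _
        rw [phi_unit_right, one_mul]
    _ = E (Q.phiInv a₁ a₂ (Q.star a₃ a₆) * (Q.phi a₂ a₃ a₆ * Q.phi a₁ (Q.star a₂ a₃) a₆ *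
          Q.phi a₁ a₄ a₅)) := by
        rw [← mul_assoc, p']; simp only [mul_assoc]
    _ = E (Q.phi a₂ a₃ a₆ * Q.phi a₁ (Q.star a₂ a₃) a₆ * Q.phi a₁ a₄ a₅) := by
        refine (((LeftCongr.refl a₁).joint ((LeftCongr.refl a₂).joint h36)) _ _).trans ?_
        change E (Q.phiInv _ _ _ * _) = _
        rw [phiInv_unit_right, one_mul]
    _ = _ := by
        have h : RightCongr (E ∘ₗ LinearMap.mulRight k (Q.phi a₁ a₄ a₅)) _ _ :=
          h23.mulRight ((Q.phi_commute_second a₂).pull (Q.phi_commute_second a₃) Q.comul)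
            (intertwines_unitHom _ _)
        refine (((RightCongr.refl a₁).joint (h.joint (RightCongr.refl a₆))) _ _).trans ?_
        change E (_ * Q.phi _ _ _ * _) = _
        rw [phi_unit_mid, mul_one]

/-- The mirror image of `snake`. -/
theorem snake_inv (h23 : LeftCongr E (Q.star a₂ a₃) (unitHom Q.counit R))
    (h14 : LeftCongr E (Q.star a₁ a₄) (unitHom Q.counit R))
    (h45 : RightCongr E (Q.star a₄ a₅) (unitHom Q.counit R))
    (h36 : RightCongr E (Q.star a₃ a₆) (unitHom Q.counit R)) :
    E (Q.phi a₁ a₂ a₃ * Q.phiInv (Q.star a₁ a₂) a₃ a₄ *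
        Q.phiInv (Q.star a₁ a₂) (Q.star a₃ a₄) (Q.star a₅ a₆) *
        (Q.phi (Q.star a₃ a₄) a₅ a₆ * Q.phiInv a₃ a₄ a₅)) =
      E (Q.phiInv a₁ a₄ a₅ * Q.phiInv a₂ a₃ a₆) := by
  have l123 : LeftCongr E (Q.star a₁ (Q.star a₂ a₃)) a₁ := by
    simpa only [star_unitHom] using (LeftCongr.refl a₁).pull h23 Q.comul
  have l1234 := (l123.pull (LeftCongr.refl a₄) Q.comul).trans h14
  have r345 : RightCongr E (Q.star a₃ (Q.star a₄ a₅)) a₃ := by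
    simpa only [star_unitHom] using (RightCongr.refl a₃).pull h45 Q.comul
  have p := Q.pentagon a₁ a₂ a₃ a₆
  have p' : Q.phi a₁ a₂ a₃ * Q.phiInv (Q.star a₁ a₂) a₃ a₆ =
      Q.phiInv a₁ (Q.star a₂ a₃) a₆ * Q.phiInv a₂ a₃ a₆ * Q.phi a₁ a₂ (Q.star a₃ a₆) := by
    rw [mul_assoc, eq_phiInv_mul_iff, eq_phiInv_mul_iff, ← mul_assoc, ← mul_assoc, p]
    simp [mul_assoc]
  rw [snake_word_inv]
  -- A cap lets the leftmost factors, a cup the rightmost ones, be evaluated with counits in the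
  -- legs concerned, where `Φ` is normalized.
  calc _ = E (Q.phiInv (Q.star a₁ (Q.star a₂ a₃)) a₄ a₅ * (Q.phi a₁ a₂ a₃ *
        Q.phiInv (Q.star a₁ a₂) a₃ (Q.star a₄ a₅) *
        Q.phiInv (Q.star a₁ a₂) (Q.star a₃ (Q.star a₄ a₅)) a₆)) := by
        simp only [mul_assoc]
        refine ((l1234.joint (LeftCongr.refl (joint a₅ a₆))) _ _).trans ?_
        change E (Q.phi _ _ _ * _) = _
        rw [phi_unit_left, one_mul]
    _ = E (Q.phiInv a₁ a₄ a₅ * (Q.phi a₁ a₂ a₃ *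
        Q.phiInv (Q.star a₁ a₂) a₃ (Q.star a₄ a₅) *
        Q.phiInv (Q.star a₁ a₂) (Q.star a₃ (Q.star a₄ a₅)) a₆)) :=
        (l123.joint (LeftCongr.refl (joint a₄ a₅))) _ _
    _ = E (Q.phiInv a₁ a₄ a₅ * Q.phi a₁ a₂ a₃ *
        Q.phiInv (Q.star a₁ a₂) a₃ (Q.star a₄ a₅) *
        Q.phiInv (Q.star a₁ a₂) a₃ a₆) := by
        simp only [← mul_assoc]
        exact (((RightCongr.refl (Q.star a₁ a₂)).joint
          (r345.joint (RightCongr.refl a₆))) _ _)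
    _ = E (Q.phiInv a₁ a₄ a₅ * Q.phi a₁ a₂ a₃ * Q.phiInv (Q.star a₁ a₂) a₃ a₆) := by
        have h : RightCongr (E ∘ₗ LinearMap.mulRight k (Q.phiInv (Q.star a₁ a₂) a₃ a₆)) _ _ :=
          h45.mulRight ((Q.phiInv_commute_third a₄).pull (Q.phiInv_commute_third a₅) Q.comul)
            (intertwines_unitHom _ _)
        refine (((RightCongr.refl (Q.star a₁ a₂)).joint
          ((RightCongr.refl a₃).joint h)) _ _).trans ?_
        change E (_ * Q.phiInv _ _ _ * _) = _
        rw [phiInv_unit_right, mul_one]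
    _ = E (Q.phiInv a₁ a₄ a₅ * (Q.phiInv a₁ (Q.star a₂ a₃) a₆ * Q.phiInv a₂ a₃ a₆) *
          Q.phi a₁ a₂ (Q.star a₃ a₆)) := by
        rw [mul_assoc, p']; simp only [mul_assoc]
    _ = E (Q.phiInv a₁ a₄ a₅ * (Q.phiInv a₁ (Q.star a₂ a₃) a₆ * Q.phiInv a₂ a₃ a₆)) := by
        refine (((RightCongr.refl a₁).joint ((RightCongr.refl a₂).joint h36)) _ _).trans ?_
        change E (_ * Q.phi _ _ _) = _
        rw [phi_unit_right, mul_one]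
    _ = _ := by
        have h : LeftCongr (E ∘ₗ LinearMap.mulLeft k (Q.phiInv a₁ a₄ a₅)) _ _ :=
          h23.mulLeft ((Q.phiInv_commute_second a₂).pull (Q.phiInv_commute_second a₃) Q.comul)
            (intertwines_unitHom _ _)
        refine (((LeftCongr.refl a₁).joint (h.joint (LeftCongr.refl a₆))) _ _).trans ?_
        change E (_ * (Q.phiInv _ _ _ * _)) = _
        rw [phiInv_unit_mid, one_mul]

/-- Two ways of cancelling the innermost pair of legs `3, 4` in a nest of three caps. -/
theorem nested_caps (h34 : LeftCongr E (Q.star a₃ a₄) (unitHom Q.counit R)) :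
    E (Q.phi a₂ a₃ a₄ * Q.phiInv (Q.star a₂ a₃) a₄ a₅ *
        (Q.phi a₁ (Q.star a₂ a₃) (Q.star a₄ a₅) *
          Q.phiInv (Q.star a₁ (Q.star a₂ a₃)) (Q.star a₄ a₅) a₆) * Q.phi a₁ a₂ a₃) =
      E (Q.phi a₁ a₂ a₅ * Q.phiInv (Q.star a₁ a₂) a₅ a₆ *
        (Q.phi (Q.star a₁ a₂) a₃ a₄ *
          Q.phiInv (Q.star (Q.star a₁ a₂) a₃) a₄ (Q.star a₅ a₆)) * Q.phi a₄ a₅ a₆) := by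
  have e1 : Q.phi a₂ a₃ a₄ * Q.phiInv (Q.star a₂ a₃) a₄ a₅ *
        (Q.phi a₁ (Q.star a₂ a₃) (Q.star a₄ a₅) *
          Q.phiInv (Q.star a₁ (Q.star a₂ a₃)) (Q.star a₄ a₅) a₆) * Q.phi a₁ a₂ a₃ =
      Q.phi a₁ (Q.star a₂ (Q.star a₃ a₄)) a₅ * (Q.phi a₁ a₂ (Q.star a₃ a₄) *
        (Q.phi (Q.star a₁ a₂) a₃ a₄ * (Q.phiInv (Q.star (Q.star a₁ a₂) a₃) a₄ a₅ *
          Q.phiInv (Q.star (Q.star a₁ a₂) a₃) (Q.star a₄ a₅) a₆))) := by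
    have p1 := Q.pentagon a₁ (Q.star a₂ a₃) a₄ a₅
    have p2 := Q.pentagon a₁ a₂ a₃ a₄
    have n1 := Intertwines.phiInv Q (Q.phi_intertwines a₁ a₂ a₃)
      ((Q.phi_left_commute (a := a₁) (b := a₂) (c := a₃) a₄).pull
        (Q.phi_left_commute (a := a₁) (b := a₂) (c := a₃) a₅) Q.comul) (Q.phi_left_commute a₆)
    have n2 := Intertwines.phi Q (Q.phi_right_commute (a := a₂) (b := a₃) (c := a₄) a₁)
      (Q.phi_intertwines a₂ a₃ a₄) (Q.phi_left_commute a₅)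
    have n3 := Intertwines.phiInv Q (Q.phi_intertwines a₁ a₂ a₃)
      (Q.phi_left_commute a₄) (Q.phi_left_commute a₅)
    have p1' : Q.phiInv (Q.star a₂ a₃) a₄ a₅ * Q.phi a₁ (Q.star a₂ a₃) (Q.star a₄ a₅) =
        Q.phi a₁ (Q.star (Q.star a₂ a₃) a₄) a₅ * Q.phi a₁ (Q.star a₂ a₃) a₄ *
          Q.phiInv (Q.star a₁ (Q.star a₂ a₃)) a₄ a₅ := by
      rw [eq_mul_phiInv_iff, mul_assoc, ← p1]
      simp [mul_assoc]
    calc _ = Q.phi a₂ a₃ a₄ *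
          (Q.phiInv (Q.star a₂ a₃) a₄ a₅ * Q.phi a₁ (Q.star a₂ a₃) (Q.star a₄ a₅)) *
          (Q.phi a₁ a₂ a₃ * Q.phiInv (Q.star (Q.star a₁ a₂) a₃) (Q.star a₄ a₅) a₆) := by
          rw [n1]; simp only [mul_assoc]
      _ = (Q.phi a₂ a₃ a₄ * Q.phi a₁ (Q.star (Q.star a₂ a₃) a₄) a₅) * Q.phi a₁ (Q.star a₂ a₃) a₄ *
          (Q.phi a₁ a₂ a₃ * Q.phiInv (Q.star (Q.star a₁ a₂) a₃) a₄ a₅) *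
            Q.phiInv (Q.star (Q.star a₁ a₂) a₃) (Q.star a₄ a₅) a₆ := by
          rw [p1', n3]; simp only [mul_assoc]
      _ = Q.phi a₁ (Q.star a₂ (Q.star a₃ a₄)) a₅ *
          (Q.phi a₂ a₃ a₄ * Q.phi a₁ (Q.star a₂ a₃) a₄ * Q.phi a₁ a₂ a₃) *
          Q.phiInv (Q.star (Q.star a₁ a₂) a₃) a₄ a₅ *
            Q.phiInv (Q.star (Q.star a₁ a₂) a₃) (Q.star a₄ a₅) a₆ := by
          rw [n2]; simp only [mul_assoc]
      _ = _ := by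
          rw [p2]; simp only [mul_assoc]
  have e2 : Q.phi a₁ a₂ a₅ * Q.phiInv (Q.star a₁ a₂) a₅ a₆ *
        (Q.phi (Q.star a₁ a₂) a₃ a₄ *
          Q.phiInv (Q.star (Q.star a₁ a₂) a₃) a₄ (Q.star a₅ a₆)) * Q.phi a₄ a₅ a₆ =
      Q.phi a₁ a₂ a₅ * Q.phiInv (Q.star a₁ a₂) a₅ a₆ *
        (Q.phi (Q.star (Q.star a₁ a₂) (Q.star a₃ a₄)) a₅ a₆ *
        (Q.phi (Q.star a₁ a₂) a₃ a₄ * (Q.phiInv (Q.star (Q.star a₁ a₂) a₃) a₄ a₅ *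
          Q.phiInv (Q.star (Q.star a₁ a₂) a₃) (Q.star a₄ a₅) a₆))) := by
    have p := Q.pentagon (Q.star (Q.star a₁ a₂) a₃) a₄ a₅ a₆
    have n := Intertwines.phi Q (Q.phi_intertwines (Q.star a₁ a₂) a₃ a₄)
      (Q.phi_left_commute a₅) (Q.phi_left_commute a₆)
    have p' : Q.phiInv (Q.star (Q.star a₁ a₂) a₃) a₄ (Q.star a₅ a₆) * Q.phi a₄ a₅ a₆ =
        Q.phi (Q.star (Q.star (Q.star a₁ a₂) a₃) a₄) a₅ a₆ *
          Q.phiInv (Q.star (Q.star a₁ a₂) a₃) a₄ a₅ *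
          Q.phiInv (Q.star (Q.star a₁ a₂) a₃) (Q.star a₄ a₅) a₆ := by
      rw [eq_mul_phiInv_iff, eq_mul_phiInv_iff, mul_assoc, mul_assoc, ← mul_assoc (Q.phi a₄ a₅ a₆),
        p, phiInv_mul_phi_mul]
    calc _ = Q.phi a₁ a₂ a₅ * Q.phiInv (Q.star a₁ a₂) a₅ a₆ * (Q.phi (Q.star a₁ a₂) a₃ a₄ *
          (Q.phiInv (Q.star (Q.star a₁ a₂) a₃) a₄ (Q.star a₅ a₆) * Q.phi a₄ a₅ a₆)) := by
          simp only [mul_assoc]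
      _ = _ := by
          rw [p']
          simp only [mul_assoc]
          rw [← mul_assoc (Q.phi (Q.star a₁ a₂) a₃ a₄), n]
          simp only [mul_assoc]
  have l234 : LeftCongr E (Q.star a₂ (Q.star a₃ a₄)) a₂ := by
    simpa only [star_unitHom] using (LeftCongr.refl a₂).pull h34 Q.comul
  rw [e1, e2]
  trans E (Q.phi a₁ a₂ a₅ * (Q.phi (Q.star a₁ a₂) a₃ a₄ *
    (Q.phiInv (Q.star (Q.star a₁ a₂) a₃) a₄ a₅ *
      Q.phiInv (Q.star (Q.star a₁ a₂) a₃) (Q.star a₄ a₅) a₆)))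
  · refine (((LeftCongr.refl a₁).joint (l234.joint (LeftCongr.refl a₅))) _ _).trans ?_
    have h : LeftCongr (E ∘ₗ LinearMap.mulLeft k (Q.phi a₁ a₂ a₅)) _ _ :=
      h34.mulLeft ((Q.phi_commute_third a₃).pull (Q.phi_commute_third a₄) Q.comul)
        (intertwines_unitHom _ _)
    refine (((LeftCongr.refl a₁).joint ((LeftCongr.refl a₂).joint h)) _ _).trans ?_
    change E (_ * (Q.phi _ _ _ * _)) = _
    rw [phi_unit_right, one_mul]
  · have h : LeftCongr (E ∘ₗ LinearMap.mulLeft k (Q.phi a₁ a₂ a₅) ∘ₗ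
        LinearMap.mulLeft k (Q.phiInv (Q.star a₁ a₂) a₅ a₆)) _ _ :=
      (h34.mulLeft ((Q.phi_commute_third a₃).pull (Q.phi_commute_third a₄) Q.comul)
        (intertwines_unitHom _ _)).mulLeft
        ((Q.phiInv_commute_second a₃).pull (Q.phiInv_commute_second a₄) Q.comul)
        (intertwines_unitHom _ _)
    have h' := (LeftCongr.refl (Q.star a₁ a₂)).pull h Q.comul
    have h'' := (h'.joint (LeftCongr.refl (joint a₅ a₆))) Q.reassoc.val
      (Q.phi (Q.star a₁ a₂) a₃ a₄ * (Q.phiInv (Q.star (Q.star a₁ a₂) a₃) a₄ a₅ *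
          Q.phiInv (Q.star (Q.star a₁ a₂) a₃) (Q.star a₄ a₅) a₆))
    rw [mul_assoc]
    refine Eq.trans ?_ h''.symm
    simp only [star_unitHom]
    change _ = E (_ * (_ * (Q.phi _ _ _ * _)))
    rw [phiInv_mul_phi_mul]

end SixLegs

end QuasiBialgebra
end QuasiHopf

namespace QuasiHopf

/-! ### Antipodes along an algebra map -/

section Legs

variable {k : Type*} [Field k] {X Y Z W P P' : Type*} [Ring X] [Algebra k X] [Ring Y] [Algebra k Y]
  [Ring Z] [Algebra k Z] [Ring W] [Algebra k W] [Ring P] [Algebra k P] [Ring P'] [Algebra k P']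

/-- `x ↦ f(x) ⊗ 1`. -/
noncomputable def inl (P' : Type*) [Ring P'] [Algebra k P'] (f : X →ₐ[k] P) : X →ₐ[k] P ⊗[k] P' :=
  Algebra.TensorProduct.includeLeft.comp f

/-- `x ↦ 1 ⊗ f(x)`. -/
noncomputable def inr (P : Type*) [Ring P] [Algebra k P] (f : X →ₐ[k] P') : X →ₐ[k] P ⊗[k] P' :=
  Algebra.TensorProduct.includeRight.comp f

@[simp]
theorem inl_apply (f : X →ₐ[k] P) (x : X) : inl P' f x = f x ⊗ₜ[k] 1 := rfl

@[simp]
theorem inr_apply (f : X →ₐ[k] P') (x : X) : inr P f x = 1 ⊗ₜ[k] f x := rfl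

instance (f : X →ₐ[k] P) (g : Y →ₐ[k] P') : AlgCommute (inl P' f) (inr P g) :=
  ⟨fun x y => by simp [Commute, SemiconjBy]⟩

instance (f : X →ₐ[k] P) (g : Y →ₐ[k] P') : AlgCommute (inr P g) (inl P' f) :=
  ⟨fun x y => by simp [Commute, SemiconjBy]⟩

instance (f : X →ₐ[k] P) (g : Y →ₐ[k] P) [AlgCommute f g] : AlgCommute (inl P' f) (inl P' g) :=
  ⟨fun x y => by simp [Commute, SemiconjBy, (AlgCommute.comm (a := f) (b := g) x y).eq]⟩

instance (f : X →ₐ[k] P') (g : Y →ₐ[k] P') [AlgCommute f g] : AlgCommute (inr P f) (inr P g) :=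
  ⟨fun x y => by simp [Commute, SemiconjBy, (AlgCommute.comm (a := f) (b := g) x y).eq]⟩

@[elab_as_elim]
theorem tensor_induction₃ {X Y Z : Type*} [AddCommGroup X] [Module k X]
    [AddCommGroup Y] [Module k Y] [AddCommGroup Z] [Module k Z]
    {p : X ⊗[k] (Y ⊗[k] Z) → Prop} (t : X ⊗[k] (Y ⊗[k] Z))
    (tmul : ∀ x y z, p (x ⊗ₜ (y ⊗ₜ z))) (add : ∀ s t, p s → p t → p (s + t)) : p t := by
  induction t using TensorProduct.induction_on with
  | zero => simpa using tmul 0 0 0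
  | tmul x y =>
    induction y using TensorProduct.induction_on with
    | zero => simpa using tmul 0 0 0
    | tmul y z => exact tmul x y z
    | add s t hs ht => rw [TensorProduct.tmul_add]; exact add _ _ hs ht
  | add s t hs ht => exact add _ _ hs ht

@[elab_as_elim]
theorem tensor_induction₄ {X Y Z W : Type*} [AddCommGroup X] [Module k X]
    [AddCommGroup Y] [Module k Y] [AddCommGroup Z] [Module k Z] [AddCommGroup W] [Module k W]
    {p : X ⊗[k] (Y ⊗[k] (Z ⊗[k] W)) → Prop} (t : X ⊗[k] (Y ⊗[k] (Z ⊗[k] W)))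
    (tmul : ∀ x y z w, p (x ⊗ₜ (y ⊗ₜ (z ⊗ₜ w)))) (add : ∀ s t, p s → p t → p (s + t)) : p t := by
  induction t using tensor_induction₃ with
  | tmul x y z =>
    induction z using TensorProduct.induction_on with
    | zero => simpa using tmul 0 0 0 0
    | tmul z w => exact tmul x y z w
    | add s t hs ht => simp only [TensorProduct.tmul_add]; exact add _ _ hs ht
  | add s t hs ht => exact add _ _ hs ht

variable {B : Type*} [Ring B] [Algebra k B]

/-- `x ⊗ y ↦ p(x) q(y)`, for linear maps `p` and `q`. -/
noncomputable def mulMap (p : X →ₗ[k] B) (q : Y →ₗ[k] B) : X ⊗[k] Y →ₗ[k] B :=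
  LinearMap.mul' k B ∘ₗ TensorProduct.map p q

@[simp]
theorem mulMap_tmul (p : X →ₗ[k] B) (q : Y →ₗ[k] B) (x : X) (y : Y) :
    mulMap p q (x ⊗ₜ y) = p x * q y := by
  simp [mulMap]

/-- The anti-multiplicative linear map underlying an algebra map to the opposite algebra. -/
noncomputable def unopLin (S : X →ₐ[k] Bᵐᵒᵖ) : X →ₗ[k] B :=
  (MulOpposite.opLinearEquiv k).symm.toLinearMap ∘ₗ S.toLinearMap

theorem unopLin_apply (S : X →ₐ[k] Bᵐᵒᵖ) (x : X) : unopLin S x = (S x).unop := rfl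

theorem unopLin_mul (S : X →ₐ[k] Bᵐᵒᵖ) (x y : X) :
    unopLin S (x * y) = unopLin S y * unopLin S x := by
  simp [unopLin_apply]

@[simp]
theorem unopLin_one (S : X →ₐ[k] Bᵐᵒᵖ) : unopLin S 1 = 1 := by
  simp [unopLin_apply]

/-- `x ⊗ y ↦ S(x) α D(y)`. -/
noncomputable def capMap (D : X →ₐ[k] B) (S : X →ₐ[k] Bᵐᵒᵖ) (α : B) : X ⊗[k] X →ₗ[k] B :=
  mulMap (LinearMap.mulRight k α ∘ₗ unopLin S) D.toLinearMap

/-- `x ⊗ y ↦ D(x) β S(y)`. -/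
noncomputable def cupMap (D : X →ₐ[k] B) (S : X →ₐ[k] Bᵐᵒᵖ) (β : B) : X ⊗[k] X →ₗ[k] B :=
  mulMap (LinearMap.mulRight k β ∘ₗ D.toLinearMap) (unopLin S)

@[simp]
theorem capMap_tmul (D : X →ₐ[k] B) (S : X →ₐ[k] Bᵐᵒᵖ) (α : B) (x y : X) :
    capMap D S α (x ⊗ₜ y) = unopLin S x * α * D y := by
  simp [capMap]

@[simp]
theorem cupMap_tmul (D : X →ₐ[k] B) (S : X →ₐ[k] Bᵐᵒᵖ) (β : B) (x y : X) :
    cupMap D S β (x ⊗ₜ y) = D x * β * unopLin S y := by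
  simp [cupMap]

/-- `x ⊗ y ⊗ z ↦ S'(x) α D(y) β S(z)`. -/
noncomputable def capCupMap (D : X →ₐ[k] B) (S' : X →ₐ[k] Bᵐᵒᵖ) (α : B) (S : X →ₐ[k] Bᵐᵒᵖ) (β : B) :
    X ⊗[k] (X ⊗[k] X) →ₗ[k] B :=
  mulMap (LinearMap.mulRight k α ∘ₗ unopLin S') (cupMap D S β)

/-- `x ⊗ y ⊗ z ↦ D(x) β S(y) α D(z)`. -/
noncomputable def cupCapMap (D : X →ₐ[k] B) (S : X →ₐ[k] Bᵐᵒᵖ) (α β : B) :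
    X ⊗[k] (X ⊗[k] X) →ₗ[k] B :=
  mulMap (LinearMap.mulRight k β ∘ₗ D.toLinearMap) (capMap D S α)

@[simp]
theorem capCupMap_tmul (D : X →ₐ[k] B) (S' : X →ₐ[k] Bᵐᵒᵖ) (α : B) (S : X →ₐ[k] Bᵐᵒᵖ) (β : B)
    (x y z : X) : capCupMap D S' α S β (x ⊗ₜ (y ⊗ₜ z)) =
      unopLin S' x * α * (D y * β * unopLin S z) := by
  simp [capCupMap]

@[simp]
theorem cupCapMap_tmul (D : X →ₐ[k] B) (S : X →ₐ[k] Bᵐᵒᵖ) (α β : B) (x y z : X) :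
    cupCapMap D S α β (x ⊗ₜ (y ⊗ₜ z)) = D x * β * (unopLin S y * α * D z) := by
  simp [cupCapMap]

section Map

variable {N N' : Type*} [AddCommGroup N] [Module k N] [AddCommGroup N'] [Module k N']
  {e : P →ₗ[k] N} {e' : P' →ₗ[k] N'}

theorem joint_inl (a : X →ₐ[k] P) (b : Y →ₐ[k] P) [AlgCommute a b] (t : X ⊗[k] Y) :
    joint (inl P' a) (inl P' b) t = joint a b t ⊗ₜ 1 := by
  induction t using TensorProduct.induction_on with
  | zero => simp
  | tmul x y => simp
  | add s t hs ht => simp only [map_add, hs, ht, TensorProduct.add_tmul]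

theorem joint_inr (a : X →ₐ[k] P') (b : Y →ₐ[k] P') [AlgCommute a b] (t : X ⊗[k] Y) :
    joint (inr P a) (inr P b) t = 1 ⊗ₜ joint a b t := by
  induction t using TensorProduct.induction_on with
  | zero => simp
  | tmul x y => simp
  | add s t hs ht => simp only [map_add, hs, ht, TensorProduct.tmul_add]

theorem pull_inl (g : Z →ₐ[k] X ⊗[k] Y) (a : X →ₐ[k] P) (b : Y →ₐ[k] P) [AlgCommute a b] :
    pull g (inl P' a) (inl P' b) = inl P' (pull g a b) :=
  AlgHom.ext fun z => joint_inl a b (g z)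

theorem pull_inr (g : Z →ₐ[k] X ⊗[k] Y) (a : X →ₐ[k] P') (b : Y →ₐ[k] P') [AlgCommute a b] :
    pull g (inr P a) (inr P b) = inr P (pull g a b) :=
  AlgHom.ext fun z => joint_inr a b (g z)

theorem inl_unitHom (ε : X →ₐ[k] k) : inl P' (unitHom ε P) = unitHom ε (P ⊗[k] P') :=
  AlgHom.ext fun x => by simp [unitHom_apply, Algebra.TensorProduct.algebraMap_apply]

theorem inr_unitHom (ε : X →ₐ[k] k) : inr P (unitHom ε P') = unitHom ε (P ⊗[k] P') :=
  AlgHom.ext fun x => by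
    simp [unitHom_apply, Algebra.algebraMap_eq_smul_one, Algebra.TensorProduct.one_def]

theorem LeftCongr.inl {p q : X →ₐ[k] P} (h : LeftCongr e p q) :
    LeftCongr (TensorProduct.map e e') (inl P' p) (inl P' q) := by
  intro x c
  induction c using TensorProduct.induction_on with
  | zero => simp
  | tmul u v => simp [h x u]
  | add s t hs ht => simp only [map_add, mul_add, hs, ht]

theorem LeftCongr.inr {p q : X →ₐ[k] P'} (h : LeftCongr e' p q) :
    LeftCongr (TensorProduct.map e e') (inr P p) (inr P q) := by
  intro x c
  induction c using TensorProduct.induction_on with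
  | zero => simp
  | tmul u v => simp [h x v]
  | add s t hs ht => simp only [map_add, mul_add, hs, ht]

theorem RightCongr.inl {p q : X →ₐ[k] P} (h : RightCongr e p q) :
    RightCongr (TensorProduct.map e e') (inl P' p) (inl P' q) := by
  intro x c
  induction c using TensorProduct.induction_on with
  | zero => simp
  | tmul u v => simp [h x u]
  | add s t hs ht => simp only [map_add, add_mul, hs, ht]

theorem RightCongr.inr {p q : X →ₐ[k] P'} (h : RightCongr e' p q) :
    RightCongr (TensorProduct.map e e') (inr P p) (inr P q) := by
  intro x c
  induction c using TensorProduct.induction_on with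
  | zero => simp
  | tmul u v => simp [h x v]
  | add s t hs ht => simp only [map_add, add_mul, hs, ht]

end Map

end Legs

section Antipodes

variable {k H B : Type*} [Field k] [Ring H] [Algebra k H] [Ring B] [Algebra k B]

/-- `(S, α, β)` satisfies the antipode axioms relative to the algebra map `D : H → B`. For `D = id`
these are the axioms of a quasi-Hopf algebra. -/
structure IsAntipodeAlong (Q : QuasiBialgebra k H) (D : H →ₐ[k] B) (S : H →ₐ[k] Bᵐᵒᵖ) (α β : B) :
    Prop where
  cap : ∀ h, capMap D S α (Q.comul h) = Q.counit h • α
  cup : ∀ h, cupMap D S β (Q.comul h) = Q.counit h • β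
  cup_cap : cupCapMap D S α β Q.reassoc.val = 1
  cap_cup : capCupMap D S α S β (Q.reassoc⁻¹).val = 1

variable {Q : QuasiBialgebra k H} {D : H →ₐ[k] B} {S S' : H →ₐ[k] Bᵐᵒᵖ} {α β α' β' : B}

/-- The comparison element `S'(x¹) α' D(x²) β S(x³)` between two antipodes along `D`. -/
noncomputable def transition (Q : QuasiBialgebra k H) (D : H →ₐ[k] B) (S' : H →ₐ[k] Bᵐᵒᵖ) (α' : B)
    (S : H →ₐ[k] Bᵐᵒᵖ) (β : B) : B :=
  capCupMap D S' α' S β (Q.reassoc⁻¹).val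

theorem leftCongr_unitHom {R N : Type*} [Ring R] [Algebra k R] [AddCommGroup N] [Module k N]
    {E : R →ₗ[k] N} {a b : H →ₐ[k] R} [AlgCommute a b]
    (h : ∀ x c, E (joint a b (Q.comul x) * c) = Q.counit x • E c) :
    LeftCongr E (Q.star a b) (unitHom Q.counit R) := by
  intro x c
  rw [pull_apply, h, unitHom_apply, ← Algebra.smul_def, map_smul]

theorem rightCongr_unitHom {R N : Type*} [Ring R] [Algebra k R] [AddCommGroup N] [Module k N]
    {E : R →ₗ[k] N} {a b : H →ₐ[k] R} [AlgCommute a b]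
    (h : ∀ x c, E (c * joint a b (Q.comul x)) = Q.counit x • E c) :
    RightCongr E (Q.star a b) (unitHom Q.counit R) := by
  intro x c
  rw [pull_apply, h, unitHom_apply, ← Algebra.commutes, ← Algebra.smul_def, map_smul]

variable (k H) in
/-- The first leg of `H ⊗ (H ⊗ H)`, that is `h ↦ h ⊗ 1 ⊗ 1`. -/
noncomputable abbrev leg₁ : H →ₐ[k] H ⊗[k] (H ⊗[k] H) := inl _ (AlgHom.id k H)

variable (k H) in
/-- The second leg of `H ⊗ (H ⊗ H)`. -/
noncomputable abbrev leg₂ : H →ₐ[k] H ⊗[k] (H ⊗[k] H) := inr _ (inl _ (AlgHom.id k H))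

variable (k H) in
/-- The third leg of `H ⊗ (H ⊗ H)`. -/
noncomputable abbrev leg₃ : H →ₐ[k] H ⊗[k] (H ⊗[k] H) := inr _ (inr _ (AlgHom.id k H))

theorem capMap_leftCongr (hα : ∀ h, capMap D S α (Q.comul h) = Q.counit h • α) :
    LeftCongr (capMap D S α) (Q.star (inl H (AlgHom.id k H)) (inr H (AlgHom.id k H)))
      (unitHom Q.counit _) := by
  refine leftCongr_unitHom fun x c => ?_
  induction c using TensorProduct.induction_on with
  | zero => simp
  | tmul u v =>
    have key : ∀ t : H ⊗[k] H,
        capMap D S α (joint (inl H (AlgHom.id k H)) (inr H (AlgHom.id k H)) t *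
        (u ⊗ₜ v)) = unopLin S u * capMap D S α t * D v := by
      intro t
      induction t using TensorProduct.induction_on with
      | zero => simp
      | tmul x y => simp [mul_assoc, unopLin_mul]
      | add s t hs ht => simp only [map_add, add_mul, mul_add, hs, ht]
    rw [key, hα]
    simp
  | add s t hs ht => simp only [map_add, mul_add, hs, ht, smul_add]

theorem cupMap_rightCongr (hβ : ∀ h, cupMap D S β (Q.comul h) = Q.counit h • β) :
    RightCongr (cupMap D S β) (Q.star (inl H (AlgHom.id k H)) (inr H (AlgHom.id k H)))
      (unitHom Q.counit _) := by
  refine rightCongr_unitHom fun x c => ?_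
  induction c using TensorProduct.induction_on with
  | zero => simp
  | tmul u v =>
    have key : ∀ t : H ⊗[k] H, cupMap D S β ((u ⊗ₜ v) *
        joint (inl H (AlgHom.id k H)) (inr H (AlgHom.id k H)) t) =
          D u * cupMap D S β t * unopLin S v := by
      intro t
      induction t using TensorProduct.induction_on with
      | zero => simp
      | tmul x y => simp [mul_assoc, unopLin_mul]
      | add s t hs ht => simp only [map_add, add_mul, mul_add, hs, ht]
    rw [key, hβ]
    simp
  | add s t hs ht => simp only [map_add, add_mul, hs, ht, smul_add]

theorem capCupMap_leftCongr (hα : ∀ h, capMap D S' α' (Q.comul h) = Q.counit h • α') :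
    LeftCongr (capCupMap D S' α' S β) (Q.star (leg₁ k H) (leg₂ k H)) (unitHom Q.counit _) := by
  refine leftCongr_unitHom fun x c => ?_
  induction c using tensor_induction₃ with
  | tmul u v w =>
    have key : ∀ t : H ⊗[k] H, capCupMap D S' α' S β (joint (leg₁ k H) (leg₂ k H) t *
        (u ⊗ₜ (v ⊗ₜ w))) = unopLin S' u * capMap D S' α' t * (D v * β * unopLin S w) := by
      intro t
      induction t using TensorProduct.induction_on with
      | zero => simp
      | tmul x y => simp [mul_assoc, unopLin_mul]
      | add s t hs ht => simp only [map_add, add_mul, mul_add, hs, ht]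
    rw [key, hα]
    simp
  | add s t hs ht => simp only [map_add, mul_add, hs, ht, smul_add]

theorem capCupMap_rightCongr (hβ : ∀ h, cupMap D S β (Q.comul h) = Q.counit h • β) :
    RightCongr (capCupMap D S' α' S β) (Q.star (leg₂ k H) (leg₃ k H)) (unitHom Q.counit _) := by
  refine rightCongr_unitHom fun x c => ?_
  induction c using tensor_induction₃ with
  | tmul u v w =>
    have key : ∀ t : H ⊗[k] H, capCupMap D S' α' S β ((u ⊗ₜ (v ⊗ₜ w)) *
        joint (leg₂ k H) (leg₃ k H) t) =
          unopLin S' u * α' * D v * cupMap D S β t * unopLin S w := by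
      intro t
      induction t using TensorProduct.induction_on with
      | zero => simp
      | tmul x y => simp [mul_assoc, unopLin_mul]
      | add s t hs ht => simp only [map_add, add_mul, mul_add, hs, ht]
    rw [key, hβ]
    simp [mul_assoc]
  | add s t hs ht => simp only [map_add, add_mul, hs, ht, smul_add]

theorem cupCapMap_leftCongr (hα : ∀ h, capMap D S α (Q.comul h) = Q.counit h • α) :
    LeftCongr (cupCapMap D S α β) (Q.star (leg₂ k H) (leg₃ k H)) (unitHom Q.counit _) := by
  refine leftCongr_unitHom fun x c => ?_
  induction c using tensor_induction₃ with
  | tmul u v w =>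
    have key : ∀ t : H ⊗[k] H, cupCapMap D S α β (joint (leg₂ k H) (leg₃ k H) t *
        (u ⊗ₜ (v ⊗ₜ w))) = D u * β * (unopLin S v * capMap D S α t * D w) := by
      intro t
      induction t using TensorProduct.induction_on with
      | zero => simp
      | tmul x y => simp [mul_assoc, unopLin_mul]
      | add s t hs ht => simp only [map_add, add_mul, mul_add, hs, ht]
    rw [key, hα]
    simp
  | add s t hs ht => simp only [map_add, mul_add, hs, ht, smul_add]

theorem cupCapMap_rightCongr (hβ : ∀ h, cupMap D S β (Q.comul h) = Q.counit h • β) :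
    RightCongr (cupCapMap D S α β) (Q.star (leg₁ k H) (leg₂ k H)) (unitHom Q.counit _) := by
  refine rightCongr_unitHom fun x c => ?_
  induction c using tensor_induction₃ with
  | tmul u v w =>
    have key : ∀ t : H ⊗[k] H, cupCapMap D S α β ((u ⊗ₜ (v ⊗ₜ w)) *
        joint (leg₁ k H) (leg₂ k H) t) = D u * cupMap D S β t * (unopLin S v * α * D w) := by
      intro t
      induction t using TensorProduct.induction_on with
      | zero => simp
      | tmul x y => simp [mul_assoc, unopLin_mul]
      | add s t hs ht => simp only [map_add, add_mul, mul_add, hs, ht]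
    rw [key, hβ]
    simp [mul_assoc]
  | add s t hs ht => simp only [map_add, add_mul, hs, ht, smul_add]

theorem joint_legs (t : H ⊗[k] (H ⊗[k] H)) :
    joint (leg₁ k H) (joint (leg₂ k H) (leg₃ k H)) t = t := by
  induction t using tensor_induction₃ with
  | tmul x y z => simp
  | add s t hs ht => rw [map_add, hs, ht]

/-- The comparison element intertwines the two antipodes, by quasi-coassociativity. -/
theorem transition_mul (hα : ∀ h, capMap D S' α' (Q.comul h) = Q.counit h • α')
    (hβ : ∀ h, cupMap D S β (Q.comul h) = Q.counit h • β) (h : H) :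
    transition Q D S' α' S β * unopLin S h = unopLin S' h * transition Q D S' α' S β := by
  let l₁ := leg₁ k H
  let l₂ := leg₂ k H
  let l₃ := leg₃ k H
  let E := capCupMap D S' α' S β
  have h12 : LeftCongr E (Q.star l₁ l₂) (unitHom Q.counit _) := capCupMap_leftCongr hα
  have h23 : RightCongr E (Q.star l₂ l₃) (unitHom Q.counit _) := capCupMap_rightCongr hβ
  have r1 : RightCongr E (Q.star l₁ (Q.star l₂ l₃)) l₁ := by
    simpa only [QuasiBialgebra.star_unitHom] using (RightCongr.refl l₁).pull h23 Q.comul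
  have r3 : LeftCongr E (Q.star (Q.star l₁ l₂) l₃) l₃ := by
    simpa only [QuasiBialgebra.unitHom_star] using h12.pull (LeftCongr.refl l₃) Q.comul
  have hS : ∀ c, E (l₃ h * c) = E c * unopLin S h := by
    intro c
    induction c using tensor_induction₃ with
    | tmul x y z => simp [E, l₃, unopLin_mul, mul_assoc]
    | add s t hs ht => simp only [map_add, mul_add, add_mul, hs, ht]
  have hS' : ∀ c, E (c * l₁ h) = unopLin S' h * E c := by
    intro c
    induction c using tensor_induction₃ with
    | tmul x y z => simp [E, l₁, unopLin_mul, mul_assoc]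
    | add s t hs ht => simp only [map_add, mul_add, add_mul, hs, ht]
  have := Q.phiInv_intertwines l₁ l₂ l₃ h
  rw [QuasiBialgebra.phiInv, joint_legs] at this
  rw [transition, ← hS, ← hS', ← r1, ← r3, this]

/-- The comparison element carries `α` to `α'`, by the pentagon for `Φ⁻¹`. -/
theorem transition_mul_alpha (hα : ∀ h, capMap D S' α' (Q.comul h) = Q.counit h • α')
    (hS : IsAntipodeAlong Q D S α β) : transition Q D S' α' S β * α = α' := by
  let l₁ : H →ₐ[k] H ⊗[k] (H ⊗[k] (H ⊗[k] H)) := inl _ (AlgHom.id k H)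
  let l₂ : H →ₐ[k] H ⊗[k] (H ⊗[k] (H ⊗[k] H)) := inr _ (inl _ (AlgHom.id k H))
  let l₃ : H →ₐ[k] H ⊗[k] (H ⊗[k] (H ⊗[k] H)) := inr _ (inr _ (inl _ (AlgHom.id k H)))
  let l₄ : H →ₐ[k] H ⊗[k] (H ⊗[k] (H ⊗[k] H)) := inr _ (inr _ (inr _ (AlgHom.id k H)))
  let E : H ⊗[k] (H ⊗[k] (H ⊗[k] H)) →ₗ[k] B :=
    mulMap (LinearMap.mulRight k α' ∘ₗ unopLin S') (cupCapMap D S α β)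
  have h12 : LeftCongr E (Q.star l₁ l₂) (unitHom Q.counit _) := by
    refine leftCongr_unitHom fun x c => ?_
    induction c using tensor_induction₄ with
    | tmul u v w z =>
      have key : ∀ t : H ⊗[k] H, E (joint l₁ l₂ t * (u ⊗ₜ (v ⊗ₜ (w ⊗ₜ z)))) =
          unopLin S' u * capMap D S' α' t * (D v * β * (unopLin S w * α * D z)) := by
        intro t
        induction t using TensorProduct.induction_on with
        | zero => simp
        | tmul x y => simp [E, l₁, l₂, mul_assoc, unopLin_mul]
        | add s t hs ht => simp only [map_add, add_mul, mul_add, hs, ht]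
      rw [key, hα]
      simp [E]
    | add s t hs ht => simp only [map_add, mul_add, hs, ht, smul_add]
  have h34 : LeftCongr E (Q.star l₃ l₄) (unitHom Q.counit _) := by
    refine leftCongr_unitHom fun x c => ?_
    induction c using tensor_induction₄ with
    | tmul u v w z =>
      have key : ∀ t : H ⊗[k] H, E (joint l₃ l₄ t * (u ⊗ₜ (v ⊗ₜ (w ⊗ₜ z)))) =
          unopLin S' u * α' * (D v * β * (unopLin S w * capMap D S α t * D z)) := by
        intro t
        induction t using TensorProduct.induction_on with
        | zero => simp
        | tmul x y => simp [E, l₃, l₄, mul_assoc, unopLin_mul]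
        | add s t hs ht => simp only [map_add, add_mul, mul_add, hs, ht]
      rw [key, hS.cap]
      simp [E]
    | add s t hs ht => simp only [map_add, mul_add, hs, ht, smul_add]
  have h23 : RightCongr E (Q.star l₂ l₃) (unitHom Q.counit _) := by
    refine rightCongr_unitHom fun x c => ?_
    induction c using tensor_induction₄ with
    | tmul u v w z =>
      have key : ∀ t : H ⊗[k] H, E ((u ⊗ₜ (v ⊗ₜ (w ⊗ₜ z))) * joint l₂ l₃ t) =
          unopLin S' u * α' * D v * cupMap D S β t * (unopLin S w * α * D z) := by
        intro t
        induction t using TensorProduct.induction_on with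
        | zero => simp
        | tmul x y => simp [E, l₃, l₂, mul_assoc, unopLin_mul]
        | add s t hs ht => simp only [map_add, add_mul, mul_add, hs, ht]
      rw [key, hS.cup]
      simp [E, mul_assoc]
    | add s t hs ht => simp only [map_add, add_mul, hs, ht, smul_add]
  have e1 : ∀ t, E (joint l₁ (joint l₂ l₃) t) = capCupMap D S' α' S β t * α := by
    intro t
    induction t using tensor_induction₃ with
    | tmul x y z => simp [E, l₁, l₂, l₃, mul_assoc]
    | add s t hs ht => simp only [map_add, add_mul, hs, ht]
  have e2 : ∀ t, E (joint l₂ (joint l₃ l₄) t) = α' * cupCapMap D S α β t := by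
    intro t
    induction t using tensor_induction₃ with
    | tmul x y z => simp [E, l₄, l₂, l₃, mul_assoc]
    | add s t hs ht => simp only [map_add, mul_add, hs, ht]
  have := Q.phiInv_eq_phi_of_congr l₁ l₂ l₃ l₄ h12 h34 h23
  rwa [QuasiBialgebra.phi, QuasiBialgebra.phiInv, e1, e2, hS.cup_cap, mul_one] at this

/-- An element intertwining an antipode along `D` with another anti-multiplicative map is determined
by its product with `α`. -/
theorem IsAntipodeAlong.eq_of_mul_alpha_eq (hS : IsAntipodeAlong Q D S α β) {F G : B}
    (hF : ∀ h, F * unopLin S h = unopLin S' h * F) (hG : ∀ h, G * unopLin S h = unopLin S' h * G)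
    (h : F * α = G * α) : F = G := by
  have key : ∀ F : B, (∀ h, F * unopLin S h = unopLin S' h * F) →
      ∀ t, F * capCupMap D S α S β t = capCupMap D S' (F * α) S β t := by
    intro F hF t
    induction t using tensor_induction₃ with
    | tmul x y z =>
      rw [capCupMap_tmul, capCupMap_tmul, mul_assoc _ α, ← mul_assoc, hF]; noncomm_ring
    | add s t hs ht => simp only [map_add, mul_add, hs, ht]
  have hF' := key F hF (Q.reassoc⁻¹).val
  have hG' := key G hG (Q.reassoc⁻¹).val
  rw [hS.cap_cup, mul_one] at hF' hG'
  rw [hF', hG', h]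

/-- Any two antipodes along `D` are conjugate: the comparison elements in the two directions are
inverse to each other. -/
theorem transition_mul_transition (hS : IsAntipodeAlong Q D S α β)
    (hS' : IsAntipodeAlong Q D S' α' β') :
    transition Q D S' α' S β * transition Q D S α S' β' = 1 := by
  refine hS'.eq_of_mul_alpha_eq (S' := S') (fun h => ?_) (fun h => by simp) ?_
  · rw [mul_assoc, transition_mul hS.cap hS'.cup, ← mul_assoc, transition_mul hS'.cap hS.cup,
      mul_assoc]
  · rw [mul_assoc, transition_mul_alpha hS.cap hS', transition_mul_alpha hS'.cap hS, one_mul]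

end Antipodes
end QuasiHopf

namespace QuasiHopf

/-! ### Invertibility of the Drinfeld twist -/

namespace QuasiHopfAlgebra

variable {k H : Type*} [Field k] [Ring H] [Algebra k H] (Q : QuasiHopfAlgebra k H)

/-- The antipode as an algebra map to the opposite algebra. -/
noncomputable abbrev SHom : H →ₐ[k] Hᵐᵒᵖ := Q.S.toAlgHom

theorem antipode_mul (x y : H) : Q.antipode (x * y) = Q.antipode y * Q.antipode x :=
  unopLin_mul Q.SHom x y

@[simp]
theorem unopLin_SHom : unopLin Q.SHom = Q.antipode := rfl

theorem capMap_SHom : capMap (AlgHom.id k H) Q.SHom Q.α =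
    TensorProduct.lift (antipodeAlpha Q.antipode Q.α) := by
  ext x y
  simp [antipodeAlpha]

theorem cupMap_SHom : cupMap (AlgHom.id k H) Q.SHom Q.β =
    TensorProduct.lift (betaAntipode Q.antipode Q.β) := by
  ext x y
  simp [betaAntipode]

theorem isAntipodeAlong_id :
    IsAntipodeAlong Q.toQuasiBialgebra (AlgHom.id k H) Q.SHom Q.α Q.β where
  cap h := by rw [capMap_SHom, Q.antipode_left]
  cup h := by rw [cupMap_SHom, Q.antipode_right]
  cup_cap := by
    rw [cupCapMap, capMap_SHom]
    exact Q.reassoc_antipode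
  cap_cup := by
    rw [capCupMap, cupMap_SHom]
    exact Q.reassoc_inv_antipode

variable {B : Type*} [Ring B] [Algebra k B]

/-- The antipode followed by `D`, as an algebra map to the opposite algebra. -/
noncomputable def antipodeAlong (D : H →ₐ[k] B) : H →ₐ[k] Bᵐᵒᵖ := (AlgHom.op D).comp Q.SHom

theorem antipodeAlong_apply (D : H →ₐ[k] B) (h : H) :
    Q.antipodeAlong D h = MulOpposite.op (D (Q.antipode h)) := rfl

@[simp]
theorem unopLin_antipodeAlong (D : H →ₐ[k] B) (h : H) :
    unopLin (Q.antipodeAlong D) h = D (Q.antipode h) := rfl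

instance (a b : H →ₐ[k] B) [AlgCommute a b] :
    AlgCommute (Q.antipodeAlong a) (Q.antipodeAlong b) :=
  ⟨fun x y => (AlgCommute.comm (a := a) (b := b) (Q.antipode x) (Q.antipode y)).op⟩

/-- Every algebra map `D` carries the antipode of `H` to an antipode along `D`. -/
theorem isAntipodeAlong_map (D : H →ₐ[k] B) :
    IsAntipodeAlong Q.toQuasiBialgebra D (Q.antipodeAlong D) (D Q.α) (D Q.β) := by
  have h0 := Q.isAntipodeAlong_id
  have e1 : capMap D (Q.antipodeAlong D) (D Q.α) =
      D.toLinearMap ∘ₗ capMap (AlgHom.id k H) Q.SHom Q.α := by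
    ext x y
    simp
  have e2 : cupMap D (Q.antipodeAlong D) (D Q.β) =
      D.toLinearMap ∘ₗ cupMap (AlgHom.id k H) Q.SHom Q.β := by
    ext x y
    simp
  have e3 : cupCapMap D (Q.antipodeAlong D) (D Q.α) (D Q.β) =
      D.toLinearMap ∘ₗ cupCapMap (AlgHom.id k H) Q.SHom Q.α Q.β := by
    ext x y
    simp
  have e4 : capCupMap D (Q.antipodeAlong D) (D Q.α) (Q.antipodeAlong D) (D Q.β) =
      D.toLinearMap ∘ₗ capCupMap (AlgHom.id k H) Q.SHom Q.α Q.SHom Q.β := by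
    ext x y
    simp
  constructor
  · intro h
    simp [e1, h0.cap]
  · intro h
    simp [e2, h0.cup]
  · simp [e3, h0.cup_cap]
  · simp [e4, h0.cap_cup]

/-- `h ↦ (S ⊗ S)(Δᶜᵒᵖ(h))`, as an algebra map to the opposite algebra. -/
noncomputable def antipodeComul : H →ₐ[k] (H ⊗[k] H)ᵐᵒᵖ :=
  pull Q.comul (Q.antipodeAlong (inr H (AlgHom.id k H))) (Q.antipodeAlong (inl H (AlgHom.id k H)))

/-- The map `x ⊗ y ↦ S(y) ⊗ S(x)`. -/
noncomputable def antipodeFlip : H ⊗[k] H →ₗ[k] H ⊗[k] H :=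
  TensorProduct.map Q.antipode Q.antipode ∘ₗ (TensorProduct.comm k H H).toLinearMap

@[simp]
theorem antipodeFlip_tmul (x y : H) :
    Q.antipodeFlip (x ⊗ₜ y) = Q.antipode y ⊗ₜ Q.antipode x := rfl

theorem unopLin_antipodeComul (h : H) : unopLin Q.antipodeComul h = Q.antipodeFlip (Q.comul h) := by
  have key : ∀ t : H ⊗[k] H, (joint (Q.antipodeAlong (inr H (AlgHom.id k H)))
      (Q.antipodeAlong (inl H (AlgHom.id k H))) t).unop = Q.antipodeFlip t := by
    intro t
    induction t using TensorProduct.induction_on with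
    | zero => simp
    | tmul x y => simp [antipodeAlong_apply]
    | add s t hs ht => simp [hs, ht]
  exact key _

section Caps

/-- Nested caps: the contraction `S(t₂) α t₃ ⊗ S(t₁) α t₄` on `H ⊗ H ⊗ H ⊗ H`, with the legs grouped
as `(t₂ ⊗ t₃) ⊗ (t₁ ⊗ t₄)`. -/
noncomputable def caps : (H ⊗[k] H) ⊗[k] (H ⊗[k] H) →ₗ[k] H ⊗[k] H :=
  TensorProduct.map (capMap (AlgHom.id k H) Q.SHom Q.α) (capMap (AlgHom.id k H) Q.SHom Q.α)

/-- Nested cups: the contraction `t₁ β S(t₄) ⊗ t₂ β S(t₃)` on `H ⊗ H ⊗ H ⊗ H`, with the legs grouped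
as `(t₁ ⊗ t₄) ⊗ (t₂ ⊗ t₃)`. -/
noncomputable def cups : (H ⊗[k] H) ⊗[k] (H ⊗[k] H) →ₗ[k] H ⊗[k] H :=
  TensorProduct.map (cupMap (AlgHom.id k H) Q.SHom Q.β) (cupMap (AlgHom.id k H) Q.SHom Q.β)

@[simp]
theorem caps_tmul (x y z w : H) : Q.caps ((x ⊗ₜ y) ⊗ₜ (z ⊗ₜ w)) =
    (Q.antipode x * Q.α * y) ⊗ₜ (Q.antipode z * Q.α * w) := by
  simp [caps]

@[simp]
theorem cups_tmul (x y z w : H) : Q.cups ((x ⊗ₜ y) ⊗ₜ (z ⊗ₜ w)) =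
    (x * Q.β * Q.antipode y) ⊗ₜ (z * Q.β * Q.antipode w) := by
  simp [cups]

variable (k H)

/-- The first leg of `(H ⊗ H) ⊗ (H ⊗ H)`. -/
noncomputable abbrev legLL : H →ₐ[k] (H ⊗[k] H) ⊗[k] (H ⊗[k] H) := inl _ (inl _ (AlgHom.id k H))

/-- The second leg of `(H ⊗ H) ⊗ (H ⊗ H)`. -/
noncomputable abbrev legLR : H →ₐ[k] (H ⊗[k] H) ⊗[k] (H ⊗[k] H) := inl _ (inr _ (AlgHom.id k H))

/-- The third leg of `(H ⊗ H) ⊗ (H ⊗ H)`. -/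
noncomputable abbrev legRL : H →ₐ[k] (H ⊗[k] H) ⊗[k] (H ⊗[k] H) := inr _ (inl _ (AlgHom.id k H))

/-- The fourth leg of `(H ⊗ H) ⊗ (H ⊗ H)`. -/
noncomputable abbrev legRR : H →ₐ[k] (H ⊗[k] H) ⊗[k] (H ⊗[k] H) := inr _ (inr _ (AlgHom.id k H))

variable {k H}

theorem gamma_eq : Q.gamma = Q.caps (
    joint (legRL k H) (joint (legLL k H) (joint (legLR k H) (legRR k H)))
    (tensorOne₃ H H H H Q.reassoc.val * tensorId Q.comul (H ⊗[k] H) (Q.reassoc⁻¹).val)) := by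
  rw [gamma]
  generalize (tensorOne₃ H H H H Q.reassoc.val * tensorId Q.comul (H ⊗[k] H) (Q.reassoc⁻¹).val) = t
  induction t using tensor_induction₄ with
  | tmul x y z w => simp [antipodeAlpha]
  | add s t hs ht => simp only [map_add, hs, ht]

theorem gamma_eq_phi : Q.gamma = Q.caps (Q.phi (legRL k H) (legLL k H) (legLR k H) *
    Q.phiInv (Q.star (legRL k H) (legLL k H)) (legLR k H) (legRR k H)) := by
  rw [gamma_eq, map_mul, joint_tensorOne₃, joint_tensorId]
  rfl

/-- `δ = B¹ β S(B⁴) ⊗ B² β S(B³)`, where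
`B¹ ⊗ B² ⊗ B³ ⊗ B⁴ = (Δ ⊗ id ⊗ id)(Φ) (Φ⁻¹ ⊗ 1)`: the counterpart of `γ` for `β`. -/
noncomputable def delta : H ⊗[k] H :=
  Q.cups (joint (legLL k H) (joint (legRL k H) (joint (legRR k H) (legLR k H)))
    (tensorId Q.comul (H ⊗[k] H) Q.reassoc.val * tensorOne₃ H H H H (Q.reassoc⁻¹).val))

theorem delta_eq_phi : Q.delta = Q.cups (Q.phi (Q.star (legLL k H) (legRL k H)) (legRR k H)
    (legLR k H) * Q.phiInv (legLL k H) (legRL k H) (legRR k H)) := by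
  rw [delta, map_mul, joint_tensorOne₃, joint_tensorId]
  rfl

theorem antipodeFlip_mul_caps_mul (p q : H ⊗[k] H) (c : (H ⊗[k] H) ⊗[k] (H ⊗[k] H)) :
    Q.antipodeFlip p * Q.caps c * q =
      Q.caps (c * (joint (legRL k H) (legLL k H) p * joint (legLR k H) (legRR k H) q)) := by
  induction p using TensorProduct.induction_on with
  | zero => simp
  | add s t hs ht => simp only [map_add, add_mul, mul_add, hs, ht]
  | tmul p₁ p₂ =>
  induction q using TensorProduct.induction_on with
  | zero => simp
  | add s t hs ht => simp only [map_add, mul_add, hs, ht]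
  | tmul q₁ q₂ =>
  induction c using TensorProduct.induction_on with
  | zero => simp
  | add s t hs ht => simp only [map_add, add_mul, mul_add, hs, ht]
  | tmul c₁ c₂ =>
  induction c₁ using TensorProduct.induction_on with
  | zero => simp
  | add s t hs ht => simp only [map_add, TensorProduct.add_tmul, add_mul, mul_add, hs, ht]
  | tmul x y =>
  induction c₂ using TensorProduct.induction_on with
  | zero => simp
  | add s t hs ht => simp only [map_add, TensorProduct.tmul_add, add_mul, mul_add, hs, ht]
  | tmul z w => simp [antipode_mul, mul_assoc]

theorem mul_cups_mul_antipodeFlip (p q : H ⊗[k] H) (c : (H ⊗[k] H) ⊗[k] (H ⊗[k] H)) :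
    p * Q.cups c * Q.antipodeFlip q =
      Q.cups ((joint (legLL k H) (legRL k H) p * joint (legRR k H) (legLR k H) q) * c) := by
  induction p using TensorProduct.induction_on with
  | zero => simp
  | add s t hs ht => simp only [map_add, add_mul, hs, ht]
  | tmul p₁ p₂ =>
  induction q using TensorProduct.induction_on with
  | zero => simp
  | add s t hs ht => simp only [map_add, add_mul, mul_add, hs, ht]
  | tmul q₁ q₂ =>
  induction c using TensorProduct.induction_on with
  | zero => simp
  | add s t hs ht => simp only [map_add, add_mul, mul_add, hs, ht]
  | tmul c₁ c₂ =>
  induction c₁ using TensorProduct.induction_on with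
  | zero => simp
  | add s t hs ht => simp only [map_add, TensorProduct.add_tmul, add_mul, mul_add, hs, ht]
  | tmul x y =>
  induction c₂ using TensorProduct.induction_on with
  | zero => simp
  | add s t hs ht => simp only [map_add, TensorProduct.tmul_add, add_mul, mul_add, hs, ht]
  | tmul z w => simp [antipode_mul, mul_assoc]

theorem caps_leftCongr_inner :
    LeftCongr Q.caps (Q.star (legLL k H) (legLR k H)) (unitHom Q.counit _) := by
  have h : LeftCongr Q.caps _ _ := (capMap_leftCongr Q.isAntipodeAlong_id.cap).inl
  rwa [← pull_inl, inl_unitHom] at h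

theorem caps_leftCongr_outer :
    LeftCongr Q.caps (Q.star (legRL k H) (legRR k H)) (unitHom Q.counit _) := by
  have h : LeftCongr Q.caps _ _ := (capMap_leftCongr Q.isAntipodeAlong_id.cap).inr
  rwa [← pull_inr, inr_unitHom] at h

theorem cups_rightCongr_outer :
    RightCongr Q.cups (Q.star (legLL k H) (legLR k H)) (unitHom Q.counit _) := by
  have h : RightCongr Q.cups _ _ := (cupMap_rightCongr Q.isAntipodeAlong_id.cup).inl
  rwa [← pull_inl, inl_unitHom] at h

theorem cups_rightCongr_inner :
    RightCongr Q.cups (Q.star (legRL k H) (legRR k H)) (unitHom Q.counit _) := by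
  have h : RightCongr Q.cups _ _ := (cupMap_rightCongr Q.isAntipodeAlong_id.cup).inr
  rwa [← pull_inr, inr_unitHom] at h

/-- The first antipode axiom for `((S ⊗ S) Δᶜᵒᵖ, γ, δ)`: naturality of `Φ` nests the two caps. -/
theorem cap_antipodeComul (h : H) :
    capMap Q.comul Q.antipodeComul Q.gamma (Q.comul h) = Q.counit h • Q.gamma := by
  have key : ∀ t : H ⊗[k] H, capMap Q.comul Q.antipodeComul Q.gamma t =
      Q.caps (Q.phi (legRL k H) (legLL k H) (legLR k H) *
        Q.phiInv (Q.star (legRL k H) (legLL k H)) (legLR k H) (legRR k H) *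
        joint (Q.star (legRL k H) (legLL k H)) (Q.star (legLR k H) (legRR k H)) t) := by
    intro t
    induction t using TensorProduct.induction_on with
    | zero => simp
    | add s t hs ht => simp only [map_add, mul_add, hs, ht]
    | tmul x y =>
      rw [capMap_tmul, unopLin_antipodeComul, gamma_eq_phi, antipodeFlip_mul_caps_mul, joint_tmul]
      rfl
  have n1 := Q.phiInv_intertwines (Q.star (legRL k H) (legLL k H)) (legLR k H) (legRR k H) h
  have n2 := ((Q.phi_intertwines (legRL k H) (legLL k H) (legLR k H)).pull
    (Q.phi_left_commute (legRR k H)) Q.comul) h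
  have c1 : LeftCongr Q.caps (Q.star (legRL k H) (Q.star (legLL k H) (legLR k H))) (legRL k H) := by
    simpa only [QuasiBialgebra.star_unitHom] using
      (LeftCongr.refl _).pull Q.caps_leftCongr_inner Q.comul
  have c2 := (c1.pull (LeftCongr.refl (legRR k H)) Q.comul).trans Q.caps_leftCongr_outer
  rw [key, mul_assoc, ← pull_apply, n1, ← mul_assoc, n2, mul_assoc, c2, unitHom_apply,
    ← Algebra.smul_def, map_smul, ← gamma_eq_phi]

theorem cup_antipodeComul (h : H) :
    cupMap Q.comul Q.antipodeComul Q.delta (Q.comul h) = Q.counit h • Q.delta := by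
  have key : ∀ t : H ⊗[k] H, cupMap Q.comul Q.antipodeComul Q.delta t =
      Q.cups (joint (Q.star (legLL k H) (legRL k H)) (Q.star (legRR k H) (legLR k H)) t *
        (Q.phi (Q.star (legLL k H) (legRL k H)) (legRR k H) (legLR k H) *
          Q.phiInv (legLL k H) (legRL k H) (legRR k H))) := by
    intro t
    induction t using TensorProduct.induction_on with
    | zero => simp
    | add s t hs ht => simp only [map_add, add_mul, hs, ht]
    | tmul x y =>
      rw [cupMap_tmul, unopLin_antipodeComul, delta_eq_phi, mul_cups_mul_antipodeFlip, joint_tmul]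
      rfl
  have n1 := Q.phi_intertwines (Q.star (legLL k H) (legRL k H)) (legRR k H) (legLR k H) h
  have n2 := ((Q.phiInv_intertwines (legLL k H) (legRL k H) (legRR k H)).pull
    (Q.phiInv_left_commute (legLR k H)) Q.comul) h
  have c1 : RightCongr Q.cups (Q.star (legLL k H) (Q.star (legRL k H) (legRR k H)))
      (legLL k H) := by
    simpa only [QuasiBialgebra.star_unitHom] using
      (RightCongr.refl _).pull Q.cups_rightCongr_inner Q.comul
  have c2 := (c1.pull (RightCongr.refl (legLR k H)) Q.comul).trans Q.cups_rightCongr_outer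
  rw [key, ← mul_assoc, ← pull_apply, ← n1, mul_assoc, ← n2, ← mul_assoc, c2, unitHom_apply,
    ← Algebra.commutes, ← Algebra.smul_def, map_smul, ← delta_eq_phi]

end Caps

section Snakes

variable (k H)

/-- The first leg of `(H ⊗ H ⊗ H) ⊗ (H ⊗ H ⊗ H)`. -/
noncomputable abbrev legL₁ : H →ₐ[k] (H ⊗[k] (H ⊗[k] H)) ⊗[k] (H ⊗[k] (H ⊗[k] H)) :=
  inl _ (leg₁ k H)

/-- The second leg of `(H ⊗ H ⊗ H) ⊗ (H ⊗ H ⊗ H)`. -/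
noncomputable abbrev legL₂ : H →ₐ[k] (H ⊗[k] (H ⊗[k] H)) ⊗[k] (H ⊗[k] (H ⊗[k] H)) :=
  inl _ (leg₂ k H)

/-- The third leg of `(H ⊗ H ⊗ H) ⊗ (H ⊗ H ⊗ H)`. -/
noncomputable abbrev legL₃ : H →ₐ[k] (H ⊗[k] (H ⊗[k] H)) ⊗[k] (H ⊗[k] (H ⊗[k] H)) :=
  inl _ (leg₃ k H)

/-- The fourth leg of `(H ⊗ H ⊗ H) ⊗ (H ⊗ H ⊗ H)`. -/
noncomputable abbrev legR₁ : H →ₐ[k] (H ⊗[k] (H ⊗[k] H)) ⊗[k] (H ⊗[k] (H ⊗[k] H)) :=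
  inr _ (leg₁ k H)

/-- The fifth leg of `(H ⊗ H ⊗ H) ⊗ (H ⊗ H ⊗ H)`. -/
noncomputable abbrev legR₂ : H →ₐ[k] (H ⊗[k] (H ⊗[k] H)) ⊗[k] (H ⊗[k] (H ⊗[k] H)) :=
  inr _ (leg₂ k H)

/-- The sixth leg of `(H ⊗ H ⊗ H) ⊗ (H ⊗ H ⊗ H)`. -/
noncomputable abbrev legR₃ : H →ₐ[k] (H ⊗[k] (H ⊗[k] H)) ⊗[k] (H ⊗[k] (H ⊗[k] H)) :=
  inr _ (leg₃ k H)

variable {k H}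

/-- Two snakes side by side. -/
noncomputable def cupCaps :
    (H ⊗[k] (H ⊗[k] H)) ⊗[k] (H ⊗[k] (H ⊗[k] H)) →ₗ[k] H ⊗[k] H :=
  TensorProduct.map (cupCapMap (AlgHom.id k H) Q.SHom Q.α Q.β)
    (cupCapMap (AlgHom.id k H) Q.SHom Q.α Q.β)

/-- Two mirrored snakes side by side. -/
noncomputable def capCups :
    (H ⊗[k] (H ⊗[k] H)) ⊗[k] (H ⊗[k] (H ⊗[k] H)) →ₗ[k] H ⊗[k] H :=
  TensorProduct.map (capCupMap (AlgHom.id k H) Q.SHom Q.α Q.SHom Q.β)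
    (capCupMap (AlgHom.id k H) Q.SHom Q.α Q.SHom Q.β)

theorem cupCaps_eval (p q r : H ⊗[k] H) (A B : H ⊗[k] (H ⊗[k] (H ⊗[k] H))) :
    p * Q.cups (joint (legLL k H) (joint (legRL k H) (joint (legRR k H) (legLR k H))) B) *
        (Q.antipodeFlip q *
          Q.caps (joint (legRL k H) (joint (legLL k H) (joint (legLR k H) (legRR k H))) A) * r) =
      Q.cupCaps (joint (legR₂ k H) (joint (legL₂ k H) (joint (legL₃ k H) (legR₃ k H))) A *
        (joint (legL₁ k H) (legR₁ k H) p *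
          (joint (legR₂ k H) (legL₂ k H) q * joint (legL₃ k H) (legR₃ k H) r)) *
        joint (legL₁ k H) (joint (legR₁ k H) (joint (legR₂ k H) (legL₂ k H))) B) := by
  induction p using TensorProduct.induction_on with
  | zero => simp
  | add s t hs ht => simp only [map_add, add_mul, mul_add, hs, ht]
  | tmul p₁ p₂ =>
  induction q using TensorProduct.induction_on with
  | zero => simp
  | add s t hs ht => simp only [map_add, add_mul, mul_add, hs, ht]
  | tmul q₁ q₂ =>
  induction r using TensorProduct.induction_on with
  | zero => simp
  | add s t hs ht => simp only [map_add, add_mul, mul_add, hs, ht]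
  | tmul r₁ r₂ =>
  induction A using tensor_induction₄ with
  | add s t hs ht => simp only [map_add, add_mul, mul_add, hs, ht]
  | tmul A₁ A₂ A₃ A₄ =>
  induction B using tensor_induction₄ with
  | add s t hs ht => simp only [map_add, add_mul, mul_add, hs, ht]
  | tmul B₁ B₂ B₃ B₄ => simp [cupCaps, antipode_mul, mul_assoc]

theorem capCups_eval (p q r : H ⊗[k] H) (A B : H ⊗[k] (H ⊗[k] (H ⊗[k] H))) :
    Q.antipodeFlip p *
        Q.caps (joint (legRL k H) (joint (legLL k H) (joint (legLR k H) (legRR k H))) A) *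
        (q * Q.cups (joint (legLL k H) (joint (legRL k H) (joint (legRR k H) (legLR k H))) B) *
          Q.antipodeFlip r) =
      Q.capCups (joint (legR₁ k H) (joint (legL₁ k H) (joint (legL₂ k H) (legR₂ k H))) A *
        (joint (legR₁ k H) (legL₁ k H) p *
          (joint (legL₂ k H) (legR₂ k H) q * joint (legR₃ k H) (legL₃ k H) r)) *
        joint (legL₂ k H) (joint (legR₂ k H) (joint (legR₃ k H) (legL₃ k H))) B) := by
  induction p using TensorProduct.induction_on with
  | zero => simp
  | add s t hs ht => simp only [map_add, add_mul, mul_add, hs, ht]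
  | tmul p₁ p₂ =>
  induction q using TensorProduct.induction_on with
  | zero => simp
  | add s t hs ht => simp only [map_add, add_mul, mul_add, hs, ht]
  | tmul q₁ q₂ =>
  induction r using TensorProduct.induction_on with
  | zero => simp
  | add s t hs ht => simp only [map_add, add_mul, mul_add, hs, ht]
  | tmul r₁ r₂ =>
  induction A using tensor_induction₄ with
  | add s t hs ht => simp only [map_add, add_mul, mul_add, hs, ht]
  | tmul A₁ A₂ A₃ A₄ =>
  induction B using tensor_induction₄ with
  | add s t hs ht => simp only [map_add, add_mul, mul_add, hs, ht]
  | tmul B₁ B₂ B₃ B₄ => simp [capCups, antipode_mul, mul_assoc]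

theorem joint_legL (t : H ⊗[k] (H ⊗[k] H)) :
    joint (legL₁ k H) (joint (legL₂ k H) (legL₃ k H)) t = t ⊗ₜ 1 := by
  induction t using tensor_induction₃ with
  | tmul x y z => simp
  | add s t hs ht => rw [map_add, hs, ht, TensorProduct.add_tmul]

theorem joint_legR (t : H ⊗[k] (H ⊗[k] H)) :
    joint (legR₁ k H) (joint (legR₂ k H) (legR₃ k H)) t = 1 ⊗ₜ t := by
  induction t using tensor_induction₃ with
  | tmul x y z => simp
  | add s t hs ht => rw [map_add, hs, ht, TensorProduct.tmul_add]

/-- The third antipode axiom for `((S ⊗ S) Δᶜᵒᵖ, γ, δ)`: the contraction splits into two separate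
snakes, each of which is the axiom for `(S, α, β)`. -/
theorem cup_cap_antipodeComul :
    cupCapMap Q.comul Q.antipodeComul Q.gamma Q.delta Q.reassoc.val = 1 := by
  have h0 := Q.isAntipodeAlong_id
  have key : ∀ t : H ⊗[k] (H ⊗[k] H), cupCapMap Q.comul Q.antipodeComul Q.gamma Q.delta t =
      Q.cupCaps (joint (legR₂ k H) (joint (legL₂ k H) (joint (legL₃ k H) (legR₃ k H)))
          (tensorOne₃ H H H H Q.reassoc.val * tensorId Q.comul (H ⊗[k] H) (Q.reassoc⁻¹).val) *
        joint (Q.star (legL₁ k H) (legR₁ k H)) (joint (Q.star (legR₂ k H) (legL₂ k H))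
          (Q.star (legL₃ k H) (legR₃ k H))) t *
        joint (legL₁ k H) (joint (legR₁ k H) (joint (legR₂ k H) (legL₂ k H)))
          (tensorId Q.comul (H ⊗[k] H) Q.reassoc.val * tensorOne₃ H H H H (Q.reassoc⁻¹).val)) := by
    intro t
    induction t using tensor_induction₃ with
    | tmul x y z =>
      rw [cupCapMap_tmul, unopLin_antipodeComul, gamma_eq, delta, cupCaps_eval]
      rfl
    | add s t hs ht => simp only [map_add, mul_add, add_mul, hs, ht]
  have h45 : LeftCongr Q.cupCaps (Q.star (legL₂ k H) (legL₃ k H)) (unitHom Q.counit _) := by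
    have h : LeftCongr Q.cupCaps _ _ := (cupCapMap_leftCongr h0.cap).inl
    rwa [← pull_inl, inl_unitHom] at h
  have h36 : LeftCongr Q.cupCaps (Q.star (legR₂ k H) (legR₃ k H)) (unitHom Q.counit _) := by
    have h : LeftCongr Q.cupCaps _ _ := (cupCapMap_leftCongr h0.cap).inr
    rwa [← pull_inr, inr_unitHom] at h
  have h23 : RightCongr Q.cupCaps (Q.star (legR₁ k H) (legR₂ k H)) (unitHom Q.counit _) := by
    have h : RightCongr Q.cupCaps _ _ := (cupCapMap_rightCongr h0.cup).inr
    rwa [← pull_inr, inr_unitHom] at h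
  have h14 : RightCongr Q.cupCaps (Q.star (legL₁ k H) (legL₂ k H)) (unitHom Q.counit _) := by
    have h : RightCongr Q.cupCaps _ _ := (cupCapMap_rightCongr h0.cup).inl
    rwa [← pull_inl, inl_unitHom] at h
  have := Q.snake (legL₁ k H) (legR₁ k H) (legR₂ k H) (legL₂ k H) (legL₃ k H) (legR₃ k H)
    h45 h36 h23 h14
  rw [key, map_mul (joint _ _), map_mul (joint _ _), joint_tensorOne₃, joint_tensorOne₃,
    joint_tensorId, joint_tensorId]
  refine this.trans ?_
  rw [QuasiBialgebra.phi, QuasiBialgebra.phi, joint_legL, joint_legR]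
  rw [Algebra.TensorProduct.tmul_mul_tmul, one_mul, mul_one, cupCaps, TensorProduct.map_tmul,
    h0.cup_cap, Algebra.TensorProduct.one_def]

theorem cap_cup_antipodeComul :
    capCupMap Q.comul Q.antipodeComul Q.gamma Q.antipodeComul Q.delta (Q.reassoc⁻¹).val = 1 := by
  have h0 := Q.isAntipodeAlong_id
  have key : ∀ t : H ⊗[k] (H ⊗[k] H),
      capCupMap Q.comul Q.antipodeComul Q.gamma Q.antipodeComul Q.delta t =
      Q.capCups (joint (legR₁ k H) (joint (legL₁ k H) (joint (legL₂ k H) (legR₂ k H)))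
          (tensorOne₃ H H H H Q.reassoc.val * tensorId Q.comul (H ⊗[k] H) (Q.reassoc⁻¹).val) *
        joint (Q.star (legR₁ k H) (legL₁ k H)) (joint (Q.star (legL₂ k H) (legR₂ k H))
          (Q.star (legR₃ k H) (legL₃ k H))) t *
        joint (legL₂ k H) (joint (legR₂ k H) (joint (legR₃ k H) (legL₃ k H)))
          (tensorId Q.comul (H ⊗[k] H) Q.reassoc.val * tensorOne₃ H H H H (Q.reassoc⁻¹).val)) := by
    intro t
    induction t using tensor_induction₃ with
    | tmul x y z =>
      rw [capCupMap_tmul, unopLin_antipodeComul, unopLin_antipodeComul, gamma_eq, delta,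
        capCups_eval]
      rfl
    | add s t hs ht => simp only [map_add, mul_add, add_mul, hs, ht]
  have h23 : LeftCongr Q.capCups (Q.star (legL₁ k H) (legL₂ k H)) (unitHom Q.counit _) := by
    have h : LeftCongr Q.capCups _ _ := (capCupMap_leftCongr h0.cap).inl
    rwa [← pull_inl, inl_unitHom] at h
  have h14 : LeftCongr Q.capCups (Q.star (legR₁ k H) (legR₂ k H)) (unitHom Q.counit _) := by
    have h : LeftCongr Q.capCups _ _ := (capCupMap_leftCongr h0.cap).inr
    rwa [← pull_inr, inr_unitHom] at h
  have h45 : RightCongr Q.capCups (Q.star (legR₂ k H) (legR₃ k H)) (unitHom Q.counit _) := by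
    have h : RightCongr Q.capCups _ _ := (capCupMap_rightCongr h0.cup).inr
    rwa [← pull_inr, inr_unitHom] at h
  have h36 : RightCongr Q.capCups (Q.star (legL₂ k H) (legL₃ k H)) (unitHom Q.counit _) := by
    have h : RightCongr Q.capCups _ _ := (capCupMap_rightCongr h0.cup).inl
    rwa [← pull_inl, inl_unitHom] at h
  have := Q.snake_inv (legR₁ k H) (legL₁ k H) (legL₂ k H) (legR₂ k H) (legR₃ k H) (legL₃ k H)
    h23 h14 h45 h36
  rw [key, map_mul (joint _ _), map_mul (joint _ _), joint_tensorOne₃, joint_tensorOne₃,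
    joint_tensorId, joint_tensorId]
  refine this.trans ?_
  rw [QuasiBialgebra.phiInv, QuasiBialgebra.phiInv, joint_legL, joint_legR]
  rw [Algebra.TensorProduct.tmul_mul_tmul, one_mul, mul_one, capCups, TensorProduct.map_tmul,
    h0.cap_cup, Algebra.TensorProduct.one_def]

/-- `(S ⊗ S) Δᶜᵒᵖ` is an antipode along `Δ`, and so is `Δ S` by `isAntipodeAlong_map`. -/
theorem isAntipodeAlong_antipodeComul :
    IsAntipodeAlong Q.toQuasiBialgebra Q.comul Q.antipodeComul Q.gamma Q.delta where
  cap := Q.cap_antipodeComul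
  cup := Q.cup_antipodeComul
  cup_cap := Q.cup_cap_antipodeComul
  cap_cup := Q.cap_cup_antipodeComul

end Snakes

section DrinfeldTwist

/-- The Drinfeld twist compares the antipodes `(S ⊗ S) Δᶜᵒᵖ` and `Δ S` along `Δ`. -/
theorem drinfeldTwist_eq_transition : Q.drinfeldTwist =
    transition Q.toQuasiBialgebra Q.comul Q.antipodeComul Q.gamma (Q.antipodeAlong Q.comul)
      (Q.comul Q.β) := by
  rw [drinfeldTwist, transition]
  generalize (Q.reassoc⁻¹).val = t
  induction t using tensor_induction₃ with
  | tmul x y z =>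
    rw [capCupMap_tmul, unopLin_antipodeComul]
    simp [betaAntipode, antipodeFlip]
  | add s t hs ht => simp only [map_add, hs, ht]

theorem isUnit_drinfeldTwist : IsUnit Q.drinfeldTwist := by
  have h1 := Q.isAntipodeAlong_map Q.comul
  have h2 := Q.isAntipodeAlong_antipodeComul
  rw [drinfeldTwist_eq_transition]
  exact ⟨⟨_, _, transition_mul_transition h1 h2, transition_mul_transition h2 h1⟩, rfl⟩

theorem drinfeldTwist_mul_comul_antipode (h : H) :
    Q.drinfeldTwist * Q.comul (Q.antipode h) = Q.antipodeFlip (Q.comul h) * Q.drinfeldTwist := by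
  rw [drinfeldTwist_eq_transition, ← unopLin_antipodeComul]
  exact transition_mul Q.cap_antipodeComul (Q.isAntipodeAlong_map Q.comul).cup h

theorem drinfeldTwist_mul_comul_alpha : Q.drinfeldTwist * Q.comul Q.α = Q.gamma := by
  rw [drinfeldTwist_eq_transition]
  exact transition_mul_alpha Q.cap_antipodeComul (Q.isAntipodeAlong_map Q.comul)

end DrinfeldTwist

end QuasiHopfAlgebra
end QuasiHopf

namespace QuasiHopf

/-! ### Coherence of the Drinfeld twist -/

namespace QuasiHopfAlgebra

open MulOpposite

variable {k H R : Type*} [Field k] [Ring H] [Algebra k H] [Ring R] [Algebra k R]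
  (Q : QuasiHopfAlgebra k H)

section TwistIn

variable (a b c : H →ₐ[k] R) [AlgCommute a b] [AlgCommute a c] [AlgCommute b c]

/-- The value of the Drinfeld twist in `R`, with legs mapped by `a` and `b`. -/
noncomputable def twist : R := joint a b Q.drinfeldTwist

/-- In the opposite algebra, the twist intertwines `b S ⋆ a S` with `(a ⋆ b) S`. -/
theorem op_twist_intertwines [AlgCommute b a] :
    Intertwines (op (Q.twist a b)) (Q.star (Q.antipodeAlong b) (Q.antipodeAlong a))
      (Q.antipodeAlong (Q.star a b)) := by
  intro h
  have key : ∀ t : H ⊗[k] H, joint (Q.antipodeAlong b) (Q.antipodeAlong a) t =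
      op (joint a b (Q.antipodeFlip t)) := by
    intro t
    induction t using TensorProduct.induction_on with
    | zero => simp
    | add s t hs ht => simp only [map_add, hs, ht, op_add]
    | tmul x y => simp [antipodeAlong_apply]
  rw [pull_apply, key, antipodeAlong_apply, ← op_mul, ← op_mul, pull_apply, twist, ← map_mul,
    ← map_mul, drinfeldTwist_mul_comul_antipode]

theorem op_phi_intertwines :
    Intertwines (op (Q.phi a b c)) (Q.antipodeAlong (Q.star a (Q.star b c)))
      (Q.antipodeAlong (Q.star (Q.star a b) c)) := by
  intro h
  rw [antipodeAlong_apply, antipodeAlong_apply, ← op_mul, ← op_mul, Q.phi_intertwines]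

/-- The map `x ⊗ y ⊗ z ↦ S(z) ⊗ S(y) ⊗ S(x)`. -/
noncomputable def antipodeFlip₃ : H ⊗[k] (H ⊗[k] H) →ₗ[k] H ⊗[k] (H ⊗[k] H) :=
  (TensorProduct.assoc k H H H).toLinearMap ∘ₗ
    (TensorProduct.comm k H (H ⊗[k] H)).toLinearMap ∘ₗ TensorProduct.map Q.antipode Q.antipodeFlip

@[simp]
theorem antipodeFlip₃_tmul (x y z : H) : Q.antipodeFlip₃ (x ⊗ₜ (y ⊗ₜ z)) =
    Q.antipode z ⊗ₜ (Q.antipode y ⊗ₜ Q.antipode x) := by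
  simp [antipodeFlip₃]

theorem joint_antipodeAlong₃ [AlgCommute b a] [AlgCommute c a] [AlgCommute c b]
    (t : H ⊗[k] (H ⊗[k] H)) :
    joint (Q.antipodeAlong c) (joint (Q.antipodeAlong b) (Q.antipodeAlong a)) t =
      op (joint a (joint b c) (Q.antipodeFlip₃ t)) := by
  induction t using tensor_induction₃ with
  | tmul x y z => simp [antipodeAlong_apply, ← op_mul, mul_assoc]
  | add s t hs ht => simp only [map_add, hs, ht, op_add]

/-- Three nested caps, with values in `R`: the contraction
`a(S(t₃) α t₄) b(S(t₂) α t₅) c(S(t₁) α t₆)`, with the legs grouped as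
`(t₃ ⊗ t₄) ⊗ (t₂ ⊗ t₅) ⊗ (t₁ ⊗ t₆)`. -/
noncomputable def caps₃ : (H ⊗[k] H) ⊗[k] ((H ⊗[k] H) ⊗[k] (H ⊗[k] H)) →ₗ[k] R :=
  (joint a (joint b c)).toLinearMap ∘ₗ
    TensorProduct.map (capMap (AlgHom.id k H) Q.SHom Q.α) Q.caps

variable (k H) in
/-- The leg `t₁` in the grouping `(t₃ ⊗ t₄) ⊗ (t₂ ⊗ t₅) ⊗ (t₁ ⊗ t₆)` of `caps₃`, where the
innermost of the nested caps comes first. -/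
noncomputable abbrev nest₁ : H →ₐ[k] (H ⊗[k] H) ⊗[k] ((H ⊗[k] H) ⊗[k] (H ⊗[k] H)) :=
  inr _ (legRL k H)

variable (k H) in
/-- The leg `t₂` in the grouping of `caps₃`. -/
noncomputable abbrev nest₂ : H →ₐ[k] (H ⊗[k] H) ⊗[k] ((H ⊗[k] H) ⊗[k] (H ⊗[k] H)) :=
  inr _ (legLL k H)

variable (k H) in
/-- The leg `t₃` in the grouping of `caps₃`. -/
noncomputable abbrev nest₃ : H →ₐ[k] (H ⊗[k] H) ⊗[k] ((H ⊗[k] H) ⊗[k] (H ⊗[k] H)) :=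
  inl _ (inl _ (AlgHom.id k H))

variable (k H) in
/-- The leg `t₄` in the grouping of `caps₃`. -/
noncomputable abbrev nest₄ : H →ₐ[k] (H ⊗[k] H) ⊗[k] ((H ⊗[k] H) ⊗[k] (H ⊗[k] H)) :=
  inl _ (inr _ (AlgHom.id k H))

variable (k H) in
/-- The leg `t₅` in the grouping of `caps₃`. -/
noncomputable abbrev nest₅ : H →ₐ[k] (H ⊗[k] H) ⊗[k] ((H ⊗[k] H) ⊗[k] (H ⊗[k] H)) :=
  inr _ (legLR k H)

variable (k H) in
/-- The leg `t₆` in the grouping of `caps₃`. -/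
noncomputable abbrev nest₆ : H →ₐ[k] (H ⊗[k] H) ⊗[k] ((H ⊗[k] H) ⊗[k] (H ⊗[k] H)) :=
  inr _ (legRR k H)

theorem caps₃_leftCongr :
    LeftCongr (Q.caps₃ a b c) (Q.star (nest₃ k H) (nest₄ k H)) (unitHom Q.counit _) := by
  have h : LeftCongr (TensorProduct.map (capMap (AlgHom.id k H) Q.SHom Q.α) Q.caps) _ _ :=
    (capMap_leftCongr Q.isAntipodeAlong_id.cap).inl
  rw [← pull_inl, inl_unitHom] at h
  exact fun x t => congrArg (joint a (joint b c)) (h x t)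

theorem caps₃_eval_inner (p q : H ⊗[k] H) (w z : H) (A : H ⊗[k] (H ⊗[k] (H ⊗[k] H))) :
    joint a b (Q.caps (joint (legRL k H) (joint (legLL k H) (joint (legLR k H) (legRR k H))) A *
        (joint (legRL k H) (legLL k H) p * joint (legLR k H) (legRR k H) q))) *
        c (Q.antipode w * Q.α * z) =
      Q.caps₃ a b c (joint (nest₂ k H) (joint (nest₃ k H) (joint (nest₄ k H) (nest₅ k H))) A *
        (nest₁ k H w * (joint (nest₂ k H) (nest₃ k H) p *
          (joint (nest₄ k H) (nest₅ k H) q * nest₆ k H z)))) := by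
  induction p using TensorProduct.induction_on with
  | zero => simp
  | add s t hs ht => simp only [map_add, add_mul, mul_add, hs, ht]
  | tmul p₁ p₂ =>
  induction q using TensorProduct.induction_on with
  | zero => simp
  | add s t hs ht => simp only [map_add, add_mul, mul_add, hs, ht]
  | tmul q₁ q₂ =>
  induction A using tensor_induction₄ with
  | add s t hs ht => simp only [map_add, add_mul, hs, ht]
  | tmul A₁ A₂ A₃ A₄ => simp [caps₃, antipode_mul, mul_assoc]

theorem caps₃_eval_outer (p q : H ⊗[k] H) (x y : H) (A : H ⊗[k] (H ⊗[k] (H ⊗[k] H))) :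
    a (Q.antipode x * Q.α * y) * joint b c (Q.caps (joint (legRL k H) (joint (legLL k H)
      (joint (legLR k H) (legRR k H))) A *
        (joint (legRL k H) (legLL k H) p * joint (legLR k H) (legRR k H) q))) =
      Q.caps₃ a b c (joint (nest₁ k H) (joint (nest₂ k H) (joint (nest₅ k H) (nest₆ k H))) A *
        (joint (nest₁ k H) (nest₂ k H) p * (nest₃ k H x * (nest₄ k H y *
          joint (nest₅ k H) (nest₆ k H) q)))) := by
  induction p using TensorProduct.induction_on with
  | zero => simp
  | add s t hs ht => simp only [map_add, add_mul, mul_add, hs, ht]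
  | tmul p₁ p₂ =>
  induction q using TensorProduct.induction_on with
  | zero => simp
  | add s t hs ht => simp only [map_add, mul_add, hs, ht]
  | tmul q₁ q₂ =>
  induction A using tensor_induction₄ with
  | add s t hs ht => simp only [map_add, add_mul, mul_add, hs, ht]
  | tmul A₁ A₂ A₃ A₄ => simp [caps₃, antipode_mul, mul_assoc]

theorem antipodeFlip₃_mul_caps₃ (t : H ⊗[k] (H ⊗[k] H))
    (u : (H ⊗[k] H) ⊗[k] ((H ⊗[k] H) ⊗[k] (H ⊗[k] H))) :
    joint a (joint b c) (Q.antipodeFlip₃ t) * Q.caps₃ a b c u =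
      Q.caps₃ a b c (u * joint (nest₁ k H) (joint (nest₂ k H) (nest₃ k H)) t) := by
  simp only [caps₃, LinearMap.comp_apply, AlgHom.toLinearMap_apply, ← map_mul]
  congr 1
  induction t using tensor_induction₃ with
  | add s t hs ht => simp only [map_add, add_mul, mul_add, hs, ht]
  | tmul x y z =>
  induction u using tensor_induction₃ with
  | add s t hs ht => simp only [map_add, add_mul, mul_add, hs, ht]
  | tmul u₁ u₂ u₃ =>
  induction u₁ using TensorProduct.induction_on with
  | zero => simp
  | add s t hs ht => simp only [TensorProduct.add_tmul, map_add, add_mul, mul_add, hs, ht]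
  | tmul =>
  induction u₂ using TensorProduct.induction_on with
  | zero => simp
  | add s t hs ht =>
    simp only [TensorProduct.add_tmul, TensorProduct.tmul_add, map_add, add_mul, mul_add, hs, ht]
  | tmul =>
  induction u₃ using TensorProduct.induction_on with
  | zero => simp
  | add s t hs ht => simp only [TensorProduct.tmul_add, map_add, add_mul, mul_add, hs, ht]
  | tmul => simp [antipode_mul, mul_assoc]

theorem caps₃_mul (t : H ⊗[k] (H ⊗[k] H))
    (u : (H ⊗[k] H) ⊗[k] ((H ⊗[k] H) ⊗[k] (H ⊗[k] H))) :
    Q.caps₃ a b c u * joint a (joint b c) t =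
      Q.caps₃ a b c (u * joint (nest₄ k H) (joint (nest₅ k H) (nest₆ k H)) t) := by
  simp only [caps₃, LinearMap.comp_apply, AlgHom.toLinearMap_apply, ← map_mul]
  congr 1
  induction t using tensor_induction₃ with
  | add s t hs ht => simp only [map_add, mul_add, hs, ht]
  | tmul x y z =>
  induction u using tensor_induction₃ with
  | add s t hs ht => simp only [map_add, add_mul, hs, ht]
  | tmul u₁ u₂ u₃ =>
  induction u₁ using TensorProduct.induction_on with
  | zero => simp
  | add s t hs ht => simp only [TensorProduct.add_tmul, map_add, add_mul, hs, ht]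
  | tmul =>
  induction u₂ using TensorProduct.induction_on with
  | zero => simp
  | add s t hs ht =>
    simp only [TensorProduct.add_tmul, TensorProduct.tmul_add, map_add, add_mul, hs, ht]
  | tmul =>
  induction u₃ using TensorProduct.induction_on with
  | zero => simp
  | add s t hs ht => simp only [TensorProduct.tmul_add, map_add, add_mul, hs, ht]
  | tmul => simp [mul_assoc]

theorem twist_mul_star (x y : H) :
    Q.twist a b * Q.star a b (Q.antipode x * Q.α * y) = joint a b (Q.caps
      (joint (legRL k H) (joint (legLL k H) (joint (legLR k H) (legRR k H)))
        (tensorOne₃ H H H H Q.reassoc.val * tensorId Q.comul (H ⊗[k] H) (Q.reassoc⁻¹).val) *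
      (joint (legRL k H) (legLL k H) (Q.comul x) *
        joint (legLR k H) (legRR k H) (Q.comul y)))) := by
  rw [← antipodeFlip_mul_caps_mul, ← gamma_eq, ← drinfeldTwist_mul_comul_alpha, ← mul_assoc,
    ← drinfeldTwist_mul_comul_antipode, twist, pull_apply, ← map_mul]
  simp only [map_mul, mul_assoc]

theorem twist_mul_joint_star_gamma :
    Q.twist a b * joint (Q.star a b) c Q.gamma = Q.caps₃ a b c
      (Q.phi (nest₂ k H) (nest₃ k H) (nest₄ k H) *
        Q.phiInv (Q.star (nest₂ k H) (nest₃ k H)) (nest₄ k H) (nest₅ k H) *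
        (Q.phi (nest₁ k H) (Q.star (nest₂ k H) (nest₃ k H)) (Q.star (nest₄ k H) (nest₅ k H)) *
          Q.phiInv (Q.star (nest₁ k H) (Q.star (nest₂ k H) (nest₃ k H)))
            (Q.star (nest₄ k H) (nest₅ k H)) (nest₆ k H))) := by
  have key : ∀ A : H ⊗[k] (H ⊗[k] (H ⊗[k] H)), Q.twist a b * joint (Q.star a b) c
      (Q.caps (joint (legRL k H) (joint (legLL k H) (joint (legLR k H) (legRR k H))) A)) =
      Q.caps₃ a b c (joint (nest₂ k H) (joint (nest₃ k H) (joint (nest₄ k H) (nest₅ k H)))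
        (tensorOne₃ H H H H Q.reassoc.val * tensorId Q.comul (H ⊗[k] H) (Q.reassoc⁻¹).val) *
        joint (nest₁ k H) (joint (Q.star (nest₂ k H) (nest₃ k H))
          (joint (Q.star (nest₄ k H) (nest₅ k H)) (nest₆ k H))) A) := by
    intro A
    induction A using tensor_induction₄ with
    | add s t hs ht => simp only [map_add, mul_add, hs, ht]
    | tmul w x y z =>
      have e : Q.caps (joint (legRL k H) (joint (legLL k H) (joint (legLR k H) (legRR k H)))
          (w ⊗ₜ (x ⊗ₜ (y ⊗ₜ z)))) =
          (Q.antipode x * Q.α * y) ⊗ₜ (Q.antipode w * Q.α * z) := by simp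
      rw [e, joint_tmul, ← mul_assoc, twist_mul_star, caps₃_eval_inner]
      rfl
  rw [gamma_eq, key, map_mul (joint _ _), map_mul (joint _ _), joint_tensorOne₃, joint_tensorOne₃,
    joint_tensorId, joint_tensorId]
  rfl

theorem twist_mul_joint_gamma_star :
    Q.twist b c * joint a (Q.star b c) Q.gamma = Q.caps₃ a b c
      (Q.phi (nest₁ k H) (nest₂ k H) (nest₅ k H) *
        Q.phiInv (Q.star (nest₁ k H) (nest₂ k H)) (nest₅ k H) (nest₆ k H) *
        (Q.phi (Q.star (nest₁ k H) (nest₂ k H)) (nest₃ k H) (nest₄ k H) *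
          Q.phiInv (Q.star (Q.star (nest₁ k H) (nest₂ k H)) (nest₃ k H)) (nest₄ k H)
            (Q.star (nest₅ k H) (nest₆ k H)))) := by
  have key : ∀ A : H ⊗[k] (H ⊗[k] (H ⊗[k] H)), Q.twist b c * joint a (Q.star b c)
      (Q.caps (joint (legRL k H) (joint (legLL k H) (joint (legLR k H) (legRR k H))) A)) =
      Q.caps₃ a b c (joint (nest₁ k H) (joint (nest₂ k H) (joint (nest₅ k H) (nest₆ k H)))
        (tensorOne₃ H H H H Q.reassoc.val * tensorId Q.comul (H ⊗[k] H) (Q.reassoc⁻¹).val) *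
        joint (Q.star (nest₁ k H) (nest₂ k H)) (joint (nest₃ k H)
          (joint (nest₄ k H) (Q.star (nest₅ k H) (nest₆ k H)))) A) := by
    intro A
    induction A using tensor_induction₄ with
    | add s t hs ht => simp only [map_add, mul_add, hs, ht]
    | tmul w x y z =>
      have e : Q.caps (joint (legRL k H) (joint (legLL k H) (joint (legLR k H) (legRR k H)))
          (w ⊗ₜ (x ⊗ₜ (y ⊗ₜ z)))) =
          (Q.antipode x * Q.α * y) ⊗ₜ (Q.antipode w * Q.α * z) := by simp
      have h := intertwines_right a (joint b c) Q.drinfeldTwist (Q.antipode x * Q.α * y)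
      rw [e, joint_tmul, ← mul_assoc, twist, h, mul_assoc, ← twist, twist_mul_star,
        caps₃_eval_outer]
      rfl
  rw [gamma_eq, key, map_mul (joint _ _), map_mul (joint _ _), joint_tensorOne₃, joint_tensorOne₃,
    joint_tensorId, joint_tensorId]
  rfl

/-- The Drinfeld twist carries `Φ` to `S(X³) ⊗ S(X²) ⊗ S(X¹)`. -/
theorem twist_phi : Q.twist b c * Q.twist a (Q.star b c) * Q.phi a b c =
    joint a (joint b c) (Q.antipodeFlip₃ Q.reassoc.val) * Q.twist a b * Q.twist (Q.star a b) c := by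
  have := AlgCommute.symm a b
  have := AlgCommute.symm a c
  have := AlgCommute.symm b c
  have hD := Q.isAntipodeAlong_map (Q.star (Q.star a b) c)
  have i1 := ((Q.op_twist_intertwines b c).pull
    (show Intertwines _ (Q.antipodeAlong a) (Q.antipodeAlong a) from fun h => by
      rw [antipodeAlong_apply, ← op_mul, ← op_mul]
      exact congrArg op (intertwines_right a (joint b c) Q.drinfeldTwist (Q.antipode h)).symm)
    Q.comul).trans ((Q.op_twist_intertwines a (Q.star b c)).trans (Q.op_phi_intertwines a b c))
  have i2 := (Q.phi_intertwines (Q.antipodeAlong c) (Q.antipodeAlong b) (Q.antipodeAlong a)).trans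
    ((Intertwines.pull (show Intertwines (op (Q.twist a b)) (Q.antipodeAlong c) (Q.antipodeAlong c)
      from fun h => by
      rw [antipodeAlong_apply, ← op_mul, ← op_mul]
      exact congrArg op (intertwines_left (joint a b) c Q.drinfeldTwist (Q.antipode h)).symm)
      (Q.op_twist_intertwines a b) Q.comul).trans (Q.op_twist_intertwines (Q.star a b) c))
  rw [QuasiBialgebra.phi, joint_antipodeAlong₃] at i2
  -- Both sides intertwine the same two maps, so that it suffices to compare their products with
  -- the value of `α`, which are two evaluations of `γ`.
  refine hD.eq_of_mul_alpha_eq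
    (S' := Q.star (Q.star (Q.antipodeAlong c) (Q.antipodeAlong b)) (Q.antipodeAlong a))
    (fun h => ?_) (fun h => ?_) ?_
  · simpa [unopLin_apply, mul_assoc] using (congrArg unop (i1 h)).symm
  · simpa [unopLin_apply, mul_assoc] using (congrArg unop (i2 h)).symm
  · have e1 : Q.twist (Q.star a b) c * Q.star (Q.star a b) c Q.α =
        joint (Q.star a b) c Q.gamma := by
      rw [twist, pull_apply _ (Q.star a b) c, ← map_mul, drinfeldTwist_mul_comul_alpha]
    have e2 : Q.twist a (Q.star b c) * Q.star a (Q.star b c) Q.α =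
        joint a (Q.star b c) Q.gamma := by
      rw [twist, pull_apply _ a (Q.star b c), ← map_mul, drinfeldTwist_mul_comul_alpha]
    simp only [mul_assoc]
    rw [e1, Q.phi_intertwines, ← mul_assoc (Q.twist a (Q.star b c)), e2,
      ← mul_assoc (Q.twist b c), twist_mul_joint_star_gamma,
      twist_mul_joint_gamma_star, antipodeFlip₃_mul_caps₃,
      show Q.phi a b c = joint a (joint b c) Q.reassoc.val from rfl, caps₃_mul]
    exact (Q.nested_caps (nest₁ k H) (nest₂ k H) (nest₃ k H) (nest₄ k H) (nest₅ k H) (nest₆ k H)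
      (Q.caps₃_leftCongr a b c)).symm

end TwistIn

section Counit

theorem counit_antipode (h : H) : Q.counit (Q.antipode h) = Q.counit h := by
  have key : ∀ t : H ⊗[k] H, Q.counit (TensorProduct.lift (antipodeAlpha Q.antipode Q.α) t) =
      Q.counit (Q.antipode (counitRight Q.counit H t)) := by
    intro t
    induction t using TensorProduct.induction_on with
    | zero => simp
    | add s t hs ht => simp only [map_add, hs, ht]
    | tmul x y => simp [antipodeAlpha, counitRight, Q.counit_α, mul_comm]
  have := key (Q.comul h)
  rw [Q.antipode_left, Q.counit_right] at this
  simpa [Q.counit_α] using this.symm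

theorem counitLeft_antipodeFlip (t : H ⊗[k] H) :
    counitLeft Q.counit H (Q.antipodeFlip t) = Q.antipode (counitRight Q.counit H t) := by
  induction t using TensorProduct.induction_on with
  | zero => simp
  | add s t hs ht => simp only [map_add, hs, ht]
  | tmul x y => simp [counitLeft, counitRight, counit_antipode]

theorem counitRight_antipodeFlip (t : H ⊗[k] H) :
    counitRight Q.counit H (Q.antipodeFlip t) = Q.antipode (counitLeft Q.counit H t) := by
  induction t using TensorProduct.induction_on with
  | zero => simp
  | add s t hs ht => simp only [map_add, hs, ht]
  | tmul x y => simp [counitLeft, counitRight, counit_antipode]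

theorem counitLeft_gamma : counitLeft Q.counit H Q.gamma = Q.α := by
  let E : (H ⊗[k] H) ⊗[k] (H ⊗[k] H) →ₗ[k] H := (counitLeft Q.counit H).toLinearMap ∘ₗ Q.caps
  have hE : ∀ x y z w, E ((x ⊗ₜ y) ⊗ₜ (z ⊗ₜ w)) =
      (Q.counit x * Q.counit y) • (Q.antipode z * Q.α * w) := by
    intro x y z w
    simp [E, counitLeft, counit_antipode, Q.counit_α]
  have h2 : LeftCongr E (legLL k H) (unitHom Q.counit _) := by
    intro x c
    rw [unitHom_apply, ← Algebra.smul_def, map_smul]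
    induction c using TensorProduct.induction_on with
    | zero => simp
    | add s t hs ht => simp only [map_add, mul_add, hs, ht, smul_add]
    | tmul u v =>
    induction u using TensorProduct.induction_on with
    | zero => simp
    | add s t hs ht => simp only [map_add, TensorProduct.add_tmul, mul_add, hs, ht, smul_add]
    | tmul =>
    induction v using TensorProduct.induction_on with
    | zero => simp
    | add s t hs ht => simp only [map_add, TensorProduct.tmul_add, mul_add, hs, ht, smul_add]
    | tmul => simp [hE, smul_smul, mul_assoc]
  have h3 : LeftCongr E (legLR k H) (unitHom Q.counit _) := by
    intro x c
    rw [unitHom_apply, ← Algebra.smul_def, map_smul]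
    induction c using TensorProduct.induction_on with
    | zero => simp
    | add s t hs ht => simp only [map_add, mul_add, hs, ht, smul_add]
    | tmul u v =>
    induction u using TensorProduct.induction_on with
    | zero => simp
    | add s t hs ht => simp only [map_add, TensorProduct.add_tmul, mul_add, hs, ht, smul_add]
    | tmul =>
    induction v using TensorProduct.induction_on with
    | zero => simp
    | add s t hs ht => simp only [map_add, TensorProduct.tmul_add, mul_add, hs, ht, smul_add]
    | tmul => simp [hE, smul_smul, mul_left_comm]
  have e : counitLeft Q.counit H Q.gamma = E 1 := by
    rw [gamma_eq_phi]
    change E _ = _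
    refine (((LeftCongr.refl _).joint (h2.joint h3)) _ _).trans ?_
    change E (Q.phi _ _ _ * _) = _
    rw [Q.phi_unit_mid, one_mul, ← mul_one (Q.phiInv _ _ _)]
    refine (((LeftCongr.refl _).joint (h3.joint (LeftCongr.refl _))) _ _).trans ?_
    change E (Q.phiInv _ _ _ * _) = _
    rw [Q.phiInv_unit_mid, one_mul]
  rw [e, Algebra.TensorProduct.one_def, Algebra.TensorProduct.one_def, hE]
  simp [antiAutLin]

theorem counitRight_gamma : counitRight Q.counit H Q.gamma = Q.α := by
  let E : (H ⊗[k] H) ⊗[k] (H ⊗[k] H) →ₗ[k] H := (counitRight Q.counit H).toLinearMap ∘ₗ Q.caps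
  have hE : ∀ x y z w, E ((x ⊗ₜ y) ⊗ₜ (z ⊗ₜ w)) =
      (Q.counit z * Q.counit w) • (Q.antipode x * Q.α * y) := by
    intro x y z w
    simp [E, counitRight, counit_antipode, Q.counit_α]
  have h1 : LeftCongr E (legRL k H) (unitHom Q.counit _) := by
    intro x c
    rw [unitHom_apply, ← Algebra.smul_def, map_smul]
    induction c using TensorProduct.induction_on with
    | zero => simp
    | add s t hs ht => simp only [map_add, mul_add, hs, ht, smul_add]
    | tmul u v =>
    induction u using TensorProduct.induction_on with
    | zero => simp
    | add s t hs ht => simp only [map_add, TensorProduct.add_tmul, mul_add, hs, ht, smul_add]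
    | tmul =>
    induction v using TensorProduct.induction_on with
    | zero => simp
    | add s t hs ht => simp only [map_add, TensorProduct.tmul_add, mul_add, hs, ht, smul_add]
    | tmul => simp [hE, smul_smul, mul_assoc]
  have h4 : LeftCongr E (legRR k H) (unitHom Q.counit _) := by
    intro x c
    rw [unitHom_apply, ← Algebra.smul_def, map_smul]
    induction c using TensorProduct.induction_on with
    | zero => simp
    | add s t hs ht => simp only [map_add, mul_add, hs, ht, smul_add]
    | tmul u v =>
    induction u using TensorProduct.induction_on with
    | zero => simp
    | add s t hs ht => simp only [map_add, TensorProduct.add_tmul, mul_add, hs, ht, smul_add]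
    | tmul =>
    induction v using TensorProduct.induction_on with
    | zero => simp
    | add s t hs ht => simp only [map_add, TensorProduct.tmul_add, mul_add, hs, ht, smul_add]
    | tmul => simp [hE, smul_smul, mul_left_comm]
  have e : counitRight Q.counit H Q.gamma = E 1 := by
    rw [gamma_eq_phi]
    change E _ = _
    refine ((h1.joint (LeftCongr.refl (joint (legLL k H) (legLR k H)))) _ _).trans ?_
    change E (Q.phi _ _ _ * _) = _
    rw [Q.phi_unit_left, one_mul, ← mul_one (Q.phiInv _ _ _)]
    refine (((LeftCongr.refl _).joint ((LeftCongr.refl _).joint h4)) _ _).trans ?_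
    change E (Q.phiInv _ _ _ * _) = _
    rw [Q.phiInv_unit_right, one_mul]
  rw [e, Algebra.TensorProduct.one_def, Algebra.TensorProduct.one_def, hE]
  simp [antiAutLin]

theorem counitLeft_drinfeldTwist : counitLeft Q.counit H Q.drinfeldTwist = 1 := by
  rw [← Q.isAntipodeAlong_id.cap_cup, drinfeldTwist_eq_transition, transition]
  generalize (Q.reassoc⁻¹).val = t
  induction t using tensor_induction₃ with
  | tmul x y z =>
    simp only [capCupMap_tmul, unopLin_antipodeComul, map_mul, counitLeft_antipodeFlip,
      counitLeft_gamma, Q.counit_left, Q.counit_right, unopLin_antipodeAlong]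
    rfl
  | add s t hs ht => simp only [map_add, hs, ht]

theorem counitRight_drinfeldTwist : counitRight Q.counit H Q.drinfeldTwist = 1 := by
  rw [← Q.isAntipodeAlong_id.cap_cup, drinfeldTwist_eq_transition, transition]
  generalize (Q.reassoc⁻¹).val = t
  induction t using tensor_induction₃ with
  | tmul x y z =>
    simp only [capCupMap_tmul, unopLin_antipodeComul, map_mul, counitRight_antipodeFlip,
      counitRight_gamma, Q.counit_left, Q.counit_right, unopLin_antipodeAlong]
    rfl
  | add s t hs ht => simp only [map_add, hs, ht]

theorem twist_unit_left (b : H →ₐ[k] R) : Q.twist (unitHom Q.counit R) b = 1 := by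
  rw [twist, ← apply_counitLeft, counitLeft_drinfeldTwist, map_one]

theorem twist_unit_right (a : H →ₐ[k] R) : Q.twist a (unitHom Q.counit R) = 1 := by
  rw [twist, ← apply_counitRight, counitRight_drinfeldTwist, map_one]

end Counit

end QuasiHopfAlgebra
end QuasiHopf

namespace QuasiHopf

/-! ### Two-sided coactions -/

namespace TwoSidedData

variable {k H A R : Type*} [Field k] [Ring H] [Algebra k H] [Ring A] [Algebra k A] [Ring R]
  [Algebra k R] (C : TwoSidedData k H A)

/-- The map `x ↦ a(x₍₋₁₎) u(x₍₀₎) d(x₍₁₎)`. -/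
noncomputable abbrev star (a : H →ₐ[k] R) (u : A →ₐ[k] R) (d : H →ₐ[k] R) [AlgCommute a u]
    [AlgCommute a d] [AlgCommute u d] : A →ₐ[k] R :=
  pull C.δ a (joint u d)

section

variable (a b : H →ₐ[k] R) (u : A →ₐ[k] R) (d e : H →ₐ[k] R) [AlgCommute a b] [AlgCommute a u]
  [AlgCommute a d] [AlgCommute a e] [AlgCommute b u] [AlgCommute b d] [AlgCommute b e]
  [AlgCommute u d] [AlgCommute u e] [AlgCommute d e]

/-- The value of `Ψ` in `R`. -/
noncomputable def psi : R := joint a (joint b (joint u (joint d e))) C.Ψ.val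

/-- The value of `Ψ⁻¹` in `R`. -/
noncomputable def psiInv : R := joint a (joint b (joint u (joint d e))) (C.Ψ⁻¹).val

@[simp]
theorem psi_mul_psiInv : C.psi a b u d e * C.psiInv a b u d e = 1 := by
  rw [psi, psiInv, ← map_mul, Units.mul_inv, map_one]

@[simp]
theorem psiInv_mul_psi : C.psiInv a b u d e * C.psi a b u d e = 1 := by
  rw [psi, psiInv, ← map_mul, Units.inv_mul, map_one]

@[simp]
theorem psi_mul_psiInv_mul (r : R) : C.psi a b u d e * (C.psiInv a b u d e * r) = r := by
  rw [← mul_assoc, psi_mul_psiInv, one_mul]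

@[simp]
theorem psiInv_mul_psi_mul (r : R) : C.psiInv a b u d e * (C.psi a b u d e * r) = r := by
  rw [← mul_assoc, psiInv_mul_psi, one_mul]

variable {C} {Q : QuasiBialgebra k H}

variable (C Q) in
theorem joint_coassoc_left (x : A) :
    joint a (joint b (joint u (joint d e))) (idTensor H (tensorId₃ C.δ H) (C.δ x)) =
      C.star a (C.star b u d) e x :=
  joint_idTensor _ _ _ _ (joint_tensorId₃ b u d e C.δ) _

variable (C Q) in
theorem joint_coassoc_right (x : A) :
    joint a (joint b (joint u (joint d e)))
        (tensorId Q.comul (A ⊗[k] (H ⊗[k] H)) (idTensor H (idTensor A Q.comul) (C.δ x))) =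
      C.star (Q.star a b) u (Q.star d e) x := by
  rw [joint_tensorId, joint_idTensor _ _ _ _ (fun z => joint_idTensor _ _ _ _
    (fun z => (pull_apply Q.comul d e z).symm) z)]
  rfl

theorem psi_intertwines (hC : IsTwoSidedCoaction Q C) :
    Intertwines (C.psi a b u d e) (C.star (Q.star a b) u (Q.star d e))
      (C.star a (C.star b u d) e) := by
  intro x
  have := congrArg (joint a (joint b (joint u (joint d e)))) (hC.coassoc x)
  simp only [map_mul] at this
  rw [joint_coassoc_left, joint_coassoc_right] at this
  exact this.symm

theorem psiInv_intertwines (hC : IsTwoSidedCoaction Q C) :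
    Intertwines (C.psiInv a b u d e) (C.star a (C.star b u d) e)
      (C.star (Q.star a b) u (Q.star d e)) := by
  intro x
  rw [← mul_one (_ * _), ← C.psi_mul_psiInv a b u d e, ← mul_assoc, mul_assoc (C.psiInv a b u d e),
    ← psi_intertwines _ _ _ _ _ hC, psiInv_mul_psi_mul]

theorem star_unit (hC : IsTwoSidedCoaction Q C) :
    C.star (unitHom Q.counit R) u (unitHom Q.counit R) = u := by
  ext x
  have := congrArg u (hC.counit x)
  rw [apply_counitRight, apply_counitLeft] at this
  exact this

variable (C Q) in
theorem psi_inner : C.psi a (unitHom Q.counit R) u (unitHom Q.counit R) e =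
    joint a (joint u e) (idTensor H ((idTensor A (counitLeft Q.counit H)).comp
      (counitLeft Q.counit (A ⊗[k] (H ⊗[k] H)))) C.Ψ.val) := by
  refine (joint_idTensor _ _ (joint (unitHom Q.counit R) (joint u (joint (unitHom Q.counit R) e)))
    _ (fun z => ?_) _).symm
  rw [AlgHom.comp_apply, joint_idTensor _ _ _ _ (apply_counitLeft Q.counit e), apply_counitLeft]

theorem psi_unit_inner (hC : IsTwoSidedCoaction Q C) :
    C.psi a (unitHom Q.counit R) u (unitHom Q.counit R) e = 1 := by
  rw [psi_inner, hC.normalized_inner, map_one]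

variable (C Q) in
theorem psi_outer : C.psi (unitHom Q.counit R) b u d (unitHom Q.counit R) =
    joint b (joint u d) (idTensor H (idTensor A (counitRight Q.counit H))
      (counitLeft Q.counit (H ⊗[k] (A ⊗[k] (H ⊗[k] H))) C.Ψ.val)) := by
  rw [joint_idTensor _ _ _ _ (joint_idTensor _ _ _ _ (apply_counitRight Q.counit d)),
    apply_counitLeft]
  rfl

theorem psi_unit_outer (hC : IsTwoSidedCoaction Q C) :
    C.psi (unitHom Q.counit R) b u d (unitHom Q.counit R) = 1 := by
  rw [psi_outer, hC.normalized_outer, map_one]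

theorem psiInv_unit_inner (hC : IsTwoSidedCoaction Q C) :
    C.psiInv a (unitHom Q.counit R) u (unitHom Q.counit R) e = 1 := by
  simpa [psi_unit_inner _ _ _ hC] using
    C.psi_mul_psiInv a (unitHom Q.counit R) u (unitHom Q.counit R) e

theorem psiInv_unit_outer (hC : IsTwoSidedCoaction Q C) :
    C.psiInv (unitHom Q.counit R) b u d (unitHom Q.counit R) = 1 := by
  simpa [psi_unit_outer _ _ _ hC] using
    C.psi_mul_psiInv (unitHom Q.counit R) b u d (unitHom Q.counit R)

end

section

variable (a b c : H →ₐ[k] R) (u : A →ₐ[k] R) (d e f : H →ₐ[k] R) [AlgCommute a b] [AlgCommute a c]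
  [AlgCommute a u] [AlgCommute a d] [AlgCommute a e] [AlgCommute a f]
  [AlgCommute b c] [AlgCommute b u] [AlgCommute b d] [AlgCommute b e] [AlgCommute b f]
  [AlgCommute c u] [AlgCommute c d] [AlgCommute c e] [AlgCommute c f]
  [AlgCommute u d] [AlgCommute u e] [AlgCommute u f] [AlgCommute d e] [AlgCommute d f]
  [AlgCommute e f]
  {C} {Q : QuasiBialgebra k H}

theorem joint_tensorId_comp {X Y Z V W : Type*} [Ring X] [Algebra k X] [Ring Y] [Algebra k Y]
    [Ring Z] [Algebra k Z] [Ring V] [Algebra k V] [Ring W] [Algebra k W]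
    (a : X →ₐ[k] R) (b : Y →ₐ[k] R) (c : Z →ₐ[k] R) [AlgCommute a b]
    [AlgCommute a c] [AlgCommute b c] (g : W →ₐ[k] X ⊗[k] Y) (i : V →ₐ[k] W ⊗[k] Z)
    (p : V →ₐ[k] R) (h : ∀ z, joint (pull g a b) c (i z) = p z) (z : V) :
    joint a (joint b c) ((tensorId g Z).comp i z) = p z := by
  rw [AlgHom.comp_apply, joint_tensorId, h]

/-- The image of an identity of the shape of a cocycle condition under a multiplicative map. -/
theorem map_cocycle {X Y : Type*} [Mul X] [Mul Y] (J : X → Y) (hJ : ∀ x y, J (x * y) = J x * J y)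
    {x₁ x₂ x₃ x₄ y₁ y₂ : X} (h : x₁ * x₂ * (x₃ * x₄) = y₁ * y₂) :
    J x₁ * J x₂ * (J x₃ * J x₄) = J y₁ * J y₂ := by
  rw [← hJ, ← hJ, ← hJ, ← hJ, h]

theorem map_psi_cocycle (hC : IsTwoSidedCoaction Q C)
    (J : H ⊗[k] (H ⊗[k] (H ⊗[k] (A ⊗[k] (H ⊗[k] (H ⊗[k] H))))) →ₐ[k] R) :
    J (oneTensor H (tensorOne₅ H H A H H H C.Ψ.val)) *
        J (idTensor H ((tensorId Q.comul (A ⊗[k] (H ⊗[k] (H ⊗[k] H)))).comp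
          (idTensor H (idTensor A (tensorId Q.comul H)))) C.Ψ.val) *
        (J (tensorOne₃ H H H (A ⊗[k] (H ⊗[k] (H ⊗[k] H))) Q.reassoc.val) *
          J (oneTensor H (oneTensor H (oneTensor H (oneTensor A (Q.reassoc⁻¹).val))))) =
      J (idTensor H (idTensor H (tensorId₃ C.δ (H ⊗[k] H))) C.Ψ.val) *
        J (tensorId Q.comul (H ⊗[k] (A ⊗[k] (H ⊗[k] (H ⊗[k] H))))
          (idTensor H (idTensor H (idTensor A (idTensor H Q.comul))) C.Ψ.val)) := by
  have h := hC.cocycle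
  exact map_cocycle (fun x => J x) (fun x y => map_mul J x y) h

variable (C Q) in
set_option maxHeartbeats 400000 in
theorem joint_cocycle_left : C.psi b c u d e * C.psi a (Q.star b c) u (Q.star d e) f *
      (Q.phi a b c * Q.phiInv d e f) =
    joint a (joint b (joint c (joint u (joint d (joint e f)))))
        (oneTensor H (tensorOne₅ H H A H H H C.Ψ.val)) *
      joint a (joint b (joint c (joint u (joint d (joint e f)))))
        (idTensor H ((tensorId Q.comul (A ⊗[k] (H ⊗[k] (H ⊗[k] H)))).comp
          (idTensor H (idTensor A (tensorId Q.comul H)))) C.Ψ.val) *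
      (joint a (joint b (joint c (joint u (joint d (joint e f)))))
          (tensorOne₃ H H H (A ⊗[k] (H ⊗[k] (H ⊗[k] H))) Q.reassoc.val) *
        joint a (joint b (joint c (joint u (joint d (joint e f)))))
          (oneTensor H (oneTensor H (oneTensor H (oneTensor A (Q.reassoc⁻¹).val))))) := by
  let J := joint a (joint b (joint c (joint u (joint d (joint e f)))))
  have h₁ : C.psi b c u d e = J (oneTensor H (tensorOne₅ H H A H H H C.Ψ.val)) :=
    ((joint_oneTensor _ _ _).trans (joint_tensorOne₅ _ _ _ _ _ _ _)).symm
  have h₂ : C.psi a (Q.star b c) u (Q.star d e) f =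
      J (idTensor H ((tensorId Q.comul (A ⊗[k] (H ⊗[k] (H ⊗[k] H)))).comp
          (idTensor H (idTensor A (tensorId Q.comul H)))) C.Ψ.val) :=
    (joint_idTensor a _ (joint (Q.star b c) (joint u (joint (Q.star d e) f))) _
      (joint_tensorId_comp b c _ Q.comul _ _
        (joint_idTensor _ _ _ _ (joint_idTensor _ _ _ _ (joint_tensorId d e f Q.comul)))) _).symm
  have h₃ : Q.phi a b c = J (tensorOne₃ H H H (A ⊗[k] (H ⊗[k] (H ⊗[k] H))) Q.reassoc.val) :=
    (joint_tensorOne₃ _ _ _ _ _).symm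
  have h₄ : Q.phiInv d e f =
      J (oneTensor H (oneTensor H (oneTensor H (oneTensor A (Q.reassoc⁻¹).val)))) :=
    ((joint_oneTensor _ _ _).trans ((joint_oneTensor _ _ _).trans
      ((joint_oneTensor _ _ _).trans (joint_oneTensor _ _ _)))).symm
  exact congrArg₂ (· * ·) (congrArg₂ (· * ·) h₁ h₂) (congrArg₂ (· * ·) h₃ h₄)

variable (C Q) in
set_option maxHeartbeats 400000 in
theorem joint_cocycle_right :
    C.psi a b (C.star c u d) e f * C.psi (Q.star a b) c u d (Q.star e f) =
    joint a (joint b (joint c (joint u (joint d (joint e f)))))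
        (idTensor H (idTensor H (tensorId₃ C.δ (H ⊗[k] H))) C.Ψ.val) *
      joint a (joint b (joint c (joint u (joint d (joint e f)))))
        (tensorId Q.comul (H ⊗[k] (A ⊗[k] (H ⊗[k] (H ⊗[k] H))))
          (idTensor H (idTensor H (idTensor A (idTensor H Q.comul))) C.Ψ.val)) := by
  let J := joint a (joint b (joint c (joint u (joint d (joint e f)))))
  have h₅ : C.psi a b (C.star c u d) e f =
      J (idTensor H (idTensor H (tensorId₃ C.δ (H ⊗[k] H))) C.Ψ.val) :=
    (joint_idTensor a _ (joint b (joint (C.star c u d) (joint e f))) _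
      (joint_idTensor _ _ _ _ (joint_tensorId₃ c u d _ C.δ)) _).symm
  have h₆ : C.psi (Q.star a b) c u d (Q.star e f) =
      J (tensorId Q.comul (H ⊗[k] (A ⊗[k] (H ⊗[k] (H ⊗[k] H))))
          (idTensor H (idTensor H (idTensor A (idTensor H Q.comul))) C.Ψ.val)) :=
    ((joint_tensorId _ _ _ _ _).trans
      (joint_idTensor (Q.star a b) _ (joint c (joint u (joint d (Q.star e f)))) _
        (joint_idTensor _ _ _ _ (joint_idTensor _ _ _ _ (joint_idTensor _ _ _ _
          (fun z => (pull_apply Q.comul e f z).symm)))) _)).symm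
  exact congrArg₂ (· * ·) h₅ h₆

theorem psi_cocycle (hC : IsTwoSidedCoaction Q C) :
    C.psi b c u d e * C.psi a (Q.star b c) u (Q.star d e) f *
      (Q.phi a b c * Q.phiInv d e f) =
    C.psi a b (C.star c u d) e f * C.psi (Q.star a b) c u d (Q.star e f) :=
  (joint_cocycle_left C a b c u d e f Q).trans ((map_psi_cocycle hC
    (joint a (joint b (joint c (joint u (joint d (joint e f))))))).trans
      (joint_cocycle_right C a b c u d e f Q).symm)

theorem psiInv_cocycle (hC : IsTwoSidedCoaction Q C) :
    C.psiInv (Q.star a b) c u d (Q.star e f) * C.psiInv a b (C.star c u d) e f =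
    (Q.phi d e f * Q.phiInv a b c) *
      (C.psiInv a (Q.star b c) u (Q.star d e) f * C.psiInv b c u d e) := by
  have h := psi_cocycle a b c u d e f hC
  refine (left_inv_eq_right_inv
    (a := C.psi a b (C.star c u d) e f * C.psi (Q.star a b) c u d (Q.star e f)) ?_ ?_)
  · simp [mul_assoc]
  · rw [← h]
    simp [mul_assoc]

end

end TwoSidedData
end QuasiHopf

namespace QuasiHopf

open MulOpposite

/-! ### Operators on tensor products of modules -/

section Operators

variable {k : Type*} [Field k] {X Y Z : Type*} [Ring X] [Algebra k X] [Ring Y] [Algebra k Y]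
  [Ring Z] [Algebra k Z]
  {M M' W N : Type*} [AddCommGroup M] [Module k M] [AddCommGroup M'] [Module k M']
  [AddCommGroup W] [Module k W] [AddCommGroup N] [Module k N]

/-- Operators on `M`, acting on the first factor of `M ⊗ W`. -/
noncomputable def first (W : Type*) [AddCommGroup W] [Module k W] (f : X →ₐ[k] Module.End k M) :
    X →ₐ[k] Module.End k (M ⊗[k] W) :=
  (Module.End.rTensorAlgHom k M W).comp f

/-- Operators on `W`, acting on the second factor of `M ⊗ W`. -/
noncomputable def shift (M : Type*) [AddCommGroup M] [Module k M] (g : X →ₐ[k] Module.End k W) :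
    X →ₐ[k] Module.End k (M ⊗[k] W) :=
  (Module.End.lTensorAlgHom k W M).comp g

theorem shift_apply (g : X →ₐ[k] Module.End k W) (x : X) : shift M g x = (g x).lTensor M := rfl

@[simp]
theorem first_tmul (f : X →ₐ[k] Module.End k M) (x : X) (m : M) (w : W) :
    first W f x (m ⊗ₜ w) = f x m ⊗ₜ w := by
  rfl

@[simp]
theorem shift_tmul (g : X →ₐ[k] Module.End k W) (x : X) (m : M) (w : W) :
    shift M g x (m ⊗ₜ w) = m ⊗ₜ g x w := by
  rfl

instance (f : X →ₐ[k] Module.End k M) (g : Y →ₐ[k] Module.End k W) :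
    AlgCommute (first W f) (shift M g) :=
  ⟨fun x y => TensorProduct.ext' fun m w => by simp⟩

instance (f : X →ₐ[k] Module.End k M) (g : Y →ₐ[k] Module.End k W) :
    AlgCommute (shift M g) (first W f) :=
  ⟨fun y x => TensorProduct.ext' fun m w => by simp⟩

instance (f : X →ₐ[k] Module.End k M) (g : Y →ₐ[k] Module.End k M) [AlgCommute f g] :
    AlgCommute (first W f) (first W g) :=
  ⟨fun x y => (AlgCommute.comm (a := f) (b := g) x y).map (Module.End.rTensorAlgHom k M W)⟩

instance (f : X →ₐ[k] Module.End k W) (g : Y →ₐ[k] Module.End k W) [AlgCommute f g] :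
    AlgCommute (shift M f) (shift M g) :=
  ⟨fun x y => (AlgCommute.comm (a := f) (b := g) x y).map (Module.End.lTensorAlgHom k W M)⟩

theorem shift_joint (a : X →ₐ[k] Module.End k W) (b : Y →ₐ[k] Module.End k W) [AlgCommute a b] :
    shift M (joint a b) = joint (shift M a) (shift M b) := by
  refine AlgHom.ext fun t => ?_
  induction t using TensorProduct.induction_on with
  | zero => simp
  | tmul x y =>
    rw [shift_apply, joint_tmul, joint_tmul]
    exact LinearMap.lTensor_mul M (a x) (b y)
  | add s t hs ht => simp only [map_add, hs, ht]

theorem shift_pull (g : Z →ₐ[k] X ⊗[k] Y) (a : X →ₐ[k] Module.End k W)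
    (b : Y →ₐ[k] Module.End k W) [AlgCommute a b] :
    shift M (pull g a b) = pull g (shift M a) (shift M b) := by
  ext1 z
  exact DFunLike.congr_fun (shift_joint a b) (g z)

/-- The linear map `m` carries the operators `p` to the operators `q`. -/
def Carries (m : M →ₗ[k] M') (p : X →ₐ[k] Module.End k M) (q : X →ₐ[k] Module.End k M') : Prop :=
  ∀ x n, q x (m n) = m (p x n)

theorem Carries.joint {m : M →ₗ[k] M'} {p : X →ₐ[k] Module.End k M} {q : X →ₐ[k] Module.End k M'}
    {p' : Y →ₐ[k] Module.End k M} {q' : Y →ₐ[k] Module.End k M'} [AlgCommute p p']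
    [AlgCommute q q'] (h : Carries m p q) (h' : Carries m p' q') :
    Carries m (joint p p') (joint q q') := by
  intro t n
  induction t using TensorProduct.induction_on with
  | zero => simp
  | tmul x y => simp only [joint_tmul, Module.End.mul_apply, h' y, h x]
  | add s t hs ht => simp only [map_add, LinearMap.add_apply, hs, ht]

theorem Carries.pull {m : M →ₗ[k] M'} {p : X →ₐ[k] Module.End k M} {q : X →ₐ[k] Module.End k M'}
    {p' : Y →ₐ[k] Module.End k M} {q' : Y →ₐ[k] Module.End k M'} [AlgCommute p p']
    [AlgCommute q q'] (h : Carries m p q) (h' : Carries m p' q') (g : Z →ₐ[k] X ⊗[k] Y) :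
    Carries m (pull g p p') (pull g q q') :=
  fun z => h.joint h' (g z)

theorem Carries.shift {m : W →ₗ[k] N} {p : X →ₐ[k] Module.End k W} {q : X →ₐ[k] Module.End k N}
    (h : Carries m p q) : Carries (m.lTensor M) (shift M p) (shift M q) := by
  intro x n
  induction n using TensorProduct.induction_on with
  | zero => simp
  | tmul x y => simp [h _ _]
  | add s t hs ht => simp only [map_add, hs, ht]

theorem carries_first (m : W →ₗ[k] N) (f : X →ₐ[k] Module.End k M) :
    Carries (m.lTensor M) (first W f) (first N f) := by
  intro x n
  induction n using TensorProduct.induction_on with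
  | zero => simp
  | tmul x y => simp
  | add s t hs ht => simp only [map_add, hs, ht]

/-- Merging the first two factors of `M ⊗ (M ⊗ W)` along a bilinear operation on `M`. -/
noncomputable def merge (μ : M ⊗[k] M →ₗ[k] M) (W : Type*) [AddCommGroup W] [Module k W] :
    M ⊗[k] (M ⊗[k] W) →ₗ[k] M ⊗[k] W :=
  μ.rTensor W ∘ₗ (TensorProduct.assoc k M M W).symm.toLinearMap

@[simp]
theorem merge_tmul (μ : M ⊗[k] M →ₗ[k] M) (m m' : M) (w : W) :
    merge μ W (m ⊗ₜ (m' ⊗ₜ w)) = μ (m ⊗ₜ m') ⊗ₜ w := by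
  simp [merge]

theorem carries_merge_shift (μ : M ⊗[k] M →ₗ[k] M) (g : X →ₐ[k] Module.End k W) :
    Carries (merge μ W) (shift M (shift M g)) (shift M g) := by
  intro x n
  induction n using tensor_induction₃ with
  | tmul m m' w => simp
  | add s t hs ht => simp only [map_add, hs, ht]

end Operators

section Core

variable {k H A : Type*} [Field k] [Ring H] [Algebra k H] [Ring A] [Algebra k A]
  {Q : QuasiBialgebra k H} {C : TwoSidedData k H A}
  {N₁ N₂ N₃ : Type*} [AddCommGroup N₁] [Module k N₁] [AddCommGroup N₂] [Module k N₂]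
  [AddCommGroup N₃] [Module k N₃]

/-- Associativity of a left crossed product, on the level of operators: `m₁₂` and `m₂₃` multiply two
neighbouring factors, `m` multiplies the resulting two, and the legs `aᵢ`, `cᵢ` are the two
`H`-actions on the `i`-th factor. The defect `Φ · Φ⁻¹` of the associativity of these
multiplications is the one by which the cocycle condition for `Ψ⁻¹` fails. -/
theorem crossed_assoc (hC : IsTwoSidedCoaction Q C)
    (a₁ a₂ a₃ : H →ₐ[k] Module.End k N₃) (u : A →ₐ[k] Module.End k N₃)
    (c₃ c₂ c₁ : H →ₐ[k] Module.End k N₃)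
    [AlgCommute a₁ a₂] [AlgCommute a₁ a₃] [AlgCommute a₁ u] [AlgCommute a₁ c₃] [AlgCommute a₁ c₂]
    [AlgCommute a₁ c₁] [AlgCommute a₂ a₃] [AlgCommute a₂ u] [AlgCommute a₂ c₃] [AlgCommute a₂ c₂]
    [AlgCommute a₂ c₁] [AlgCommute a₃ u] [AlgCommute a₃ c₃] [AlgCommute a₃ c₂] [AlgCommute a₃ c₁]
    [AlgCommute u c₃] [AlgCommute u c₂] [AlgCommute u c₁] [AlgCommute c₃ c₂] [AlgCommute c₃ c₁]
    [AlgCommute c₂ c₁]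
    (a₁' a₂' : H →ₐ[k] Module.End k N₂) (u' : A →ₐ[k] Module.End k N₂)
    (c₂' c₁' : H →ₐ[k] Module.End k N₂)
    [AlgCommute a₁' a₂'] [AlgCommute a₁' u'] [AlgCommute a₁' c₂'] [AlgCommute a₁' c₁']
    [AlgCommute a₂' u'] [AlgCommute a₂' c₂'] [AlgCommute a₂' c₁'] [AlgCommute u' c₂']
    [AlgCommute u' c₁'] [AlgCommute c₂' c₁']
    {m₁₂ m₂₃ : N₃ →ₗ[k] N₂} {m : N₂ →ₗ[k] N₁}
    (ha₁ : Carries m₁₂ (Q.star a₁ a₂) a₁') (ha₂ : Carries m₁₂ a₃ a₂') (hu : Carries m₁₂ u u')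
    (hc₂ : Carries m₁₂ c₃ c₂') (hc₁ : Carries m₁₂ (Q.star c₂ c₁) c₁')
    (ha₁' : Carries m₂₃ a₁ a₁') (ha₂' : Carries m₂₃ (Q.star a₂ a₃) a₂') (hu' : Carries m₂₃ u u')
    (hc₂' : Carries m₂₃ (Q.star c₃ c₂) c₂') (hc₁' : Carries m₂₃ c₁ c₁')
    (hm : ∀ n, m (m₁₂ ((Q.phi c₃ c₂ c₁ * Q.phiInv a₁ a₂ a₃) n)) = m (m₂₃ n)) (x y : A) (n : N₃) :
    m (C.psiInv a₁' a₂' u' c₂' c₁' (m₁₂ ((C.psiInv a₁ a₂ (C.star a₃ u c₃) c₂ c₁ *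
        C.star a₂ (C.star a₃ u c₃) c₂ x * C.star a₃ u c₃ y) n))) =
      m (C.psiInv a₁' a₂' u' c₂' c₁' (C.star a₂' u' c₂' x
        (m₂₃ ((C.psiInv a₂ a₃ u c₃ c₂ * C.star a₃ u c₃ y) n)))) := by
  have h₁₂ : ∀ n, C.psiInv a₁' a₂' u' c₂' c₁' (m₁₂ n) =
      m₁₂ (C.psiInv (Q.star a₁ a₂) a₃ u c₃ (Q.star c₂ c₁) n) :=
    (ha₁.joint (ha₂.joint (hu.joint (hc₂.joint hc₁)))) _
  have h₂₃ : ∀ n, C.psiInv a₁' a₂' u' c₂' c₁' (m₂₃ n) =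
      m₂₃ (C.psiInv a₁ (Q.star a₂ a₃) u (Q.star c₃ c₂) c₁ n) :=
    (ha₁'.joint (ha₂'.joint (hu'.joint (hc₂'.joint hc₁')))) _
  have hs : ∀ n, C.star a₂' u' c₂' x (m₂₃ n) =
      m₂₃ (C.star (Q.star a₂ a₃) u (Q.star c₃ c₂) x n) :=
    (ha₂'.pull (hu'.joint hc₂') C.δ) x
  rw [h₁₂, hs, h₂₃, ← hm]
  simp only [← Module.End.mul_apply]
  congr 3
  have hi := TwoSidedData.psiInv_intertwines a₂ a₃ u c₃ c₂ hC x
  have hc := TwoSidedData.psiInv_cocycle a₁ a₂ a₃ u c₃ c₂ c₁ hC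
  simp only [← mul_assoc] at hc ⊢
  rw [hc]
  simp only [mul_assoc]
  rw [← mul_assoc (C.psiInv a₂ a₃ u c₃ c₂), hi, mul_assoc]

end Core

end QuasiHopf

namespace QuasiHopf

open MulOpposite

/-! ### The left crossed product -/

namespace QuasiHopfAlgebra

section Actions

variable {k H : Type*} [Field k] [Ring H] [Algebra k H] (Q : QuasiHopfAlgebra k H)

/-- The inverse of the antipode, as an algebra map `H → Hᵐᵒᵖ`. -/
noncomputable def antipodeInvHom : H →ₐ[k] Hᵐᵒᵖ := (AlgEquiv.opComm Q.S).symm.toAlgHom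

theorem antipode_antipodeInv (h : H) : Q.antipode (Q.antipodeInv h) = h := by
  simp [antiAutLin, antiAutInvLin]

variable (𝒜 : Type*) [NonAssocRing 𝒜] [Module k 𝒜]

/-- The left action `φ ↦ h · φ`. -/
noncomputable def leftOp (k H : Type*) [Field k] [Ring H] [Algebra k H]
    (𝒜 : Type*) [NonAssocRing 𝒜] [Module k 𝒜] [Module H 𝒜] [IsScalarTower k H 𝒜] :
    H →ₐ[k] Module.End k 𝒜 := Algebra.lsmul k k 𝒜

@[simp]
theorem leftOp_apply [Module H 𝒜] [IsScalarTower k H 𝒜] (h : H) (φ : 𝒜) :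
    leftOp k H 𝒜 h φ = h • φ := rfl

/-- The left action `φ ↦ φ · S⁻¹(h)` obtained from the right action. -/
noncomputable def rightInvOp [Module Hᵐᵒᵖ 𝒜] [IsScalarTower k Hᵐᵒᵖ 𝒜] : H →ₐ[k] Module.End k 𝒜 :=
  (Algebra.lsmul k k 𝒜).comp Q.antipodeInvHom

@[simp]
theorem rightInvOp_apply [Module Hᵐᵒᵖ 𝒜] [IsScalarTower k Hᵐᵒᵖ 𝒜] (h : H) (φ : 𝒜) :
    Q.rightInvOp 𝒜 h φ = op (Q.antipodeInv h) • φ := rfl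

instance [Module H 𝒜] [IsScalarTower k H 𝒜] [Module Hᵐᵒᵖ 𝒜] [IsScalarTower k Hᵐᵒᵖ 𝒜]
    [SMulCommClass H Hᵐᵒᵖ 𝒜] : AlgCommute (leftOp k H 𝒜) (Q.rightInvOp 𝒜) :=
  ⟨fun x y => LinearMap.ext fun φ => smul_comm x (op (Q.antipodeInv y)) φ⟩

end Actions

section Legs

variable {k X M : Type*} [Field k] [Ring X] [Algebra k X] [AddCommGroup M] [Module k M]

/-- Operators on `M`, acting on the first factor of `M ⊗ (M ⊗ W)`. -/
noncomputable abbrev fstLeg (f : X →ₐ[k] Module.End k M) (W : Type*) [AddCommGroup W] [Module k W] :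
    X →ₐ[k] Module.End k (M ⊗[k] (M ⊗[k] W)) := first (M ⊗[k] W) f

/-- Operators on `M`, acting on the second factor of `M ⊗ (M ⊗ W)`. -/
noncomputable abbrev sndLeg (f : X →ₐ[k] Module.End k M) (W : Type*) [AddCommGroup W] [Module k W] :
    X →ₐ[k] Module.End k (M ⊗[k] (M ⊗[k] W)) := shift M (first W f)

end Legs

section Twist

variable {k H R : Type*} [Field k] [Ring H] [Algebra k H] [Ring R] [Algebra k R]
  (Q : QuasiHopfAlgebra k H)

/-- The coherence `twist_phi` of the twist with the reassociator, in the form in which it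
corrects the defect of associativity of a bimodule algebra. -/
theorem twist_defect (a₁ a₂ a₃ c₃ c₂ c₁ : H →ₐ[k] R) [AlgCommute a₁ a₂] [AlgCommute a₁ a₃]
    [AlgCommute a₂ a₃] [AlgCommute c₃ c₂] [AlgCommute c₃ c₁] [AlgCommute c₂ c₁]
    [AlgCommute a₁ c₃] [AlgCommute a₁ c₂] [AlgCommute a₁ c₁]
    [AlgCommute a₂ c₃] [AlgCommute a₂ c₂] [AlgCommute a₂ c₁]
    [AlgCommute a₃ c₃] [AlgCommute a₃ c₂] [AlgCommute a₃ c₁] :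
    Q.phi a₁ a₂ a₃ * joint c₃ (joint c₂ c₁) (Q.antipodeFlip₃ (Q.reassoc⁻¹).val) *
        (Q.twist c₂ c₁ * Q.twist c₃ (Q.star c₂ c₁) *
          (Q.phi c₃ c₂ c₁ * Q.phiInv a₁ a₂ a₃)) =
      Q.twist c₃ c₂ * Q.twist (Q.star c₃ c₂) c₁ := by
  have hJ : joint c₃ (joint c₂ c₁) (Q.antipodeFlip₃ (Q.reassoc⁻¹).val) *
      joint c₃ (joint c₂ c₁) (Q.antipodeFlip₃ Q.reassoc.val) = 1 := by
    have := AlgCommute.symm c₃ c₂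
    have := AlgCommute.symm c₃ c₁
    have := AlgCommute.symm c₂ c₁
    apply op_injective
    rw [op_mul, ← joint_antipodeAlong₃, ← joint_antipodeAlong₃, ← map_mul, Units.mul_inv, map_one,
      op_one]
  have hc : ∀ t, Q.phi a₁ a₂ a₃ * joint (Q.star c₃ c₂) c₁ t = joint (Q.star c₃ c₂) c₁ t *
      Q.phi a₁ a₂ a₃ := intertwines_left (joint a₁ (joint a₂ a₃)) (joint (Q.star c₃ c₂) c₁) _
  have hc' : ∀ t, Q.phi a₁ a₂ a₃ * joint c₃ c₂ t = joint c₃ c₂ t * Q.phi a₁ a₂ a₃ :=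
    intertwines_left (joint a₁ (joint a₂ a₃)) (joint c₃ c₂) _
  rw [← mul_assoc (Q.twist c₂ c₁ * _), Q.twist_phi, mul_assoc (Q.phi a₁ a₂ a₃),
    mul_assoc (joint _ _ _),
    mul_assoc (joint _ _ _), ← mul_assoc (joint _ _ _) (joint _ _ _), hJ, one_mul, mul_assoc,
    ← mul_assoc (Q.phi a₁ a₂ a₃)]
  unfold twist
  rw [hc', mul_assoc, ← mul_assoc (Q.phi a₁ a₂ a₃), hc, mul_assoc (joint (Q.star c₃ c₂) c₁ _),
    Q.phi_mul_phiInv, mul_one]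

end Twist

section TwistedMul

variable {k H : Type*} [Field k] [Ring H] [Algebra k H] (Q : QuasiHopfAlgebra k H)
  (𝒜 : Type*) [NonAssocRing 𝒜] [Module k 𝒜] [SMulCommClass k 𝒜 𝒜] [IsScalarTower k 𝒜 𝒜]
  (W : Type*) [AddCommGroup W] [Module k W]

theorem merge_leftOp [Module H 𝒜] [IsScalarTower k H 𝒜] (t : H ⊗[k] H) (φ φ' : 𝒜) (w : W) :
    merge (LinearMap.mul' k 𝒜) W
        (joint (fstLeg (leftOp k H 𝒜) W) (sndLeg (leftOp k H 𝒜) W) t (φ ⊗ₜ (φ' ⊗ₜ w))) =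
      LinearMap.mul' k 𝒜 (leftAct₂ k 𝒜 t (φ ⊗ₜ φ')) ⊗ₜ w := by
  induction t using TensorProduct.induction_on with
  | zero => simp
  | tmul x y => simp [leftAct₂, leftAct]
  | add s t hs ht => simp only [map_add, LinearMap.add_apply, hs, ht, TensorProduct.add_tmul]

variable [Module Hᵐᵒᵖ 𝒜] [IsScalarTower k Hᵐᵒᵖ 𝒜]

theorem antipodeInv_antipode (h : H) : Q.antipodeInv (Q.antipode h) = h := by
  simp [antiAutLin, antiAutInvLin]

theorem merge_rightInvOp (t : H ⊗[k] H) (φ φ' : 𝒜) (w : W) :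
    merge (LinearMap.mul' k 𝒜) W (joint (sndLeg (Q.rightInvOp 𝒜) W) (fstLeg (Q.rightInvOp 𝒜) W)
        (Q.antipodeFlip t) (φ ⊗ₜ (φ' ⊗ₜ w))) =
      LinearMap.mul' k 𝒜 (rightAct₂ k 𝒜 t (φ ⊗ₜ φ')) ⊗ₜ w := by
  induction t using TensorProduct.induction_on with
  | zero => simp
  | tmul x y => simp [rightAct₂, rightAct, antipodeInv_antipode]
  | add s t hs ht => simp only [map_add, LinearMap.add_apply, hs, ht, TensorProduct.add_tmul]

/-- The product `φ φ'` of the first two factors of `𝒜 ⊗ (𝒜 ⊗ W)`, twisted by the action of `f`. -/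
noncomputable def twistedMul : 𝒜 ⊗[k] (𝒜 ⊗[k] W) →ₗ[k] 𝒜 ⊗[k] W :=
  merge (LinearMap.mul' k 𝒜) W ∘ₗ Q.twist (sndLeg (Q.rightInvOp 𝒜) W) (fstLeg (Q.rightInvOp 𝒜) W)

theorem twistedMul_apply (n : 𝒜 ⊗[k] (𝒜 ⊗[k] W)) : Q.twistedMul 𝒜 W n =
    merge (LinearMap.mul' k 𝒜) W
      (Q.twist (sndLeg (Q.rightInvOp 𝒜) W) (fstLeg (Q.rightInvOp 𝒜) W) n) :=
  rfl

theorem carries_twistedMul_shift {X : Type*} [Ring X] [Algebra k X] (g : X →ₐ[k] Module.End k W) :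
    Carries (Q.twistedMul 𝒜 W) (shift 𝒜 (shift 𝒜 g)) (shift 𝒜 g) := by
  intro h n
  rw [twistedMul_apply, twistedMul_apply, carries_merge_shift, ← Module.End.mul_apply,
    ← Module.End.mul_apply]
  congr 2
  exact (AlgCommute.comm (a := joint (sndLeg (Q.rightInvOp 𝒜) W) (fstLeg (Q.rightInvOp 𝒜) W))
    (b := shift 𝒜 (shift 𝒜 g)) _ _).symm

variable [Module H 𝒜] [IsScalarTower k H 𝒜] {Q} {𝒜}

theorem carries_merge_leftOp (h𝒜 : IsBimoduleAlgebra Q.toQuasiBialgebra 𝒜) :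
    Carries (merge (LinearMap.mul' k 𝒜) W)
      (Q.star (fstLeg (leftOp k H 𝒜) W) (sndLeg (leftOp k H 𝒜) W)) (first W (leftOp k H 𝒜)) := by
  intro h n
  induction n using tensor_induction₃ with
  | tmul φ φ' w =>
    rw [pull_apply, merge_leftOp, ← h𝒜.smul_mul]
    simp
  | add s t hs ht => simp only [map_add, hs, ht]

theorem carries_twistedMul_rightInvOp (h𝒜 : IsBimoduleAlgebra Q.toQuasiBialgebra 𝒜) :
    Carries (Q.twistedMul 𝒜 W)
      (Q.star (sndLeg (Q.rightInvOp 𝒜) W) (fstLeg (Q.rightInvOp 𝒜) W))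
      (first W (Q.rightInvOp 𝒜)) := by
  intro h n
  -- Write `h = S(g)` and use `f Δ(S(g)) = (S ⊗ S)(Δᶜᵒᵖ(g)) f`.
  obtain ⟨g, rfl⟩ : ∃ g, Q.antipode g = h := ⟨_, Q.antipode_antipodeInv h⟩
  have key : ∀ n, first W (Q.rightInvOp 𝒜) (Q.antipode g) (merge (LinearMap.mul' k 𝒜) W n) =
      merge (LinearMap.mul' k 𝒜) W (joint (sndLeg (Q.rightInvOp 𝒜) W) (fstLeg (Q.rightInvOp 𝒜) W)
        (Q.antipodeFlip (Q.comul g)) n) := by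
    intro n
    induction n using tensor_induction₃ with
    | tmul φ φ' w =>
      rw [merge_rightInvOp, ← h𝒜.op_smul_mul]
      simp [antipodeInv_antipode]
    | add s t hs ht => simp only [map_add, hs, ht]
  rw [twistedMul_apply, twistedMul_apply, key, ← Module.End.mul_apply, ← Module.End.mul_apply,
    pull_apply, twist, ← map_mul, ← map_mul, drinfeldTwist_mul_comul_antipode]

/-- Quasi-associativity of `𝒜` for the product of the first two factors. -/
theorem merge_merge (h𝒜 : IsBimoduleAlgebra Q.toQuasiBialgebra 𝒜)
    (n : 𝒜 ⊗[k] (𝒜 ⊗[k] (𝒜 ⊗[k] W))) :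
    merge (LinearMap.mul' k 𝒜) W (merge (LinearMap.mul' k 𝒜) (𝒜 ⊗[k] W) n) =
      merge (LinearMap.mul' k 𝒜) W ((merge (LinearMap.mul' k 𝒜) W).lTensor 𝒜
        ((Q.phi (fstLeg (leftOp k H 𝒜) (𝒜 ⊗[k] W)) (sndLeg (leftOp k H 𝒜) (𝒜 ⊗[k] W))
            (shift 𝒜 (sndLeg (leftOp k H 𝒜) W)) *
          joint (shift 𝒜 (sndLeg (Q.rightInvOp 𝒜) W)) (joint (sndLeg (Q.rightInvOp 𝒜) (𝒜 ⊗[k] W))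
            (fstLeg (Q.rightInvOp 𝒜) (𝒜 ⊗[k] W))) (Q.antipodeFlip₃ (Q.reassoc⁻¹).val)) n)) := by
  have key : ∀ (φ φ' φ'' : 𝒜) (w : W) (s t : H ⊗[k] (H ⊗[k] H)),
      merge (LinearMap.mul' k 𝒜) W ((merge (LinearMap.mul' k 𝒜) W).lTensor 𝒜
        ((joint (fstLeg (leftOp k H 𝒜) (𝒜 ⊗[k] W)) (joint (sndLeg (leftOp k H 𝒜) (𝒜 ⊗[k] W))
            (shift 𝒜 (sndLeg (leftOp k H 𝒜) W))) s *
          joint (shift 𝒜 (sndLeg (Q.rightInvOp 𝒜) W)) (joint (sndLeg (Q.rightInvOp 𝒜) (𝒜 ⊗[k] W))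
            (fstLeg (Q.rightInvOp 𝒜) (𝒜 ⊗[k] W))) (Q.antipodeFlip₃ t))
          (φ ⊗ₜ (φ' ⊗ₜ (φ'' ⊗ₜ w))))) =
      LinearMap.mul' k 𝒜 (TensorProduct.map LinearMap.id (LinearMap.mul' k 𝒜)
        (leftAct₃ k 𝒜 s (rightAct₃ k 𝒜 t (φ ⊗ₜ (φ' ⊗ₜ φ''))))) ⊗ₜ w := by
    intro φ φ' φ'' w s t
    induction t using tensor_induction₃ with
    | add s t hs ht =>
      simp only [map_add, mul_add, LinearMap.add_apply, hs, ht, TensorProduct.add_tmul]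
    | tmul x y z =>
      induction s using tensor_induction₃ with
      | add s t hs ht =>
        simp only [map_add, add_mul, LinearMap.add_apply, hs, ht, TensorProduct.add_tmul]
      | tmul x' y' z' =>
        simp [leftAct₃, rightAct₃, leftAct₂, rightAct₂, leftAct, rightAct, antipodeInv_antipode]
  induction n using tensor_induction₄ with
  | add s t hs ht => simp only [map_add, hs, ht]
  | tmul φ φ' φ'' w =>
    rw [QuasiBialgebra.phi, key, ← h𝒜.quasi_assoc]
    simp

variable [SMulCommClass H Hᵐᵒᵖ 𝒜]

theorem carries_twistedMul_leftOp (h𝒜 : IsBimoduleAlgebra Q.toQuasiBialgebra 𝒜) :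
    Carries (Q.twistedMul 𝒜 W)
      (Q.star (fstLeg (leftOp k H 𝒜) W) (sndLeg (leftOp k H 𝒜) W)) (first W (leftOp k H 𝒜)) := by
  intro h n
  rw [twistedMul_apply, twistedMul_apply, carries_merge_leftOp W h𝒜, ← Module.End.mul_apply,
    ← Module.End.mul_apply]
  congr 2
  exact AlgCommute.comm (a := Q.star (fstLeg (leftOp k H 𝒜) W) (sndLeg (leftOp k H 𝒜) W))
    (b := joint (sndLeg (Q.rightInvOp 𝒜) W) (fstLeg (Q.rightInvOp 𝒜) W)) _ _

/-- The twisted products are associative up to `Φ` and the opposite of `Φ⁻¹`. -/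
theorem twistedMul_twistedMul (h𝒜 : IsBimoduleAlgebra Q.toQuasiBialgebra 𝒜)
    (n : 𝒜 ⊗[k] (𝒜 ⊗[k] (𝒜 ⊗[k] W))) :
    Q.twistedMul 𝒜 W (Q.twistedMul 𝒜 (𝒜 ⊗[k] W)
        ((Q.phi (shift 𝒜 (sndLeg (Q.rightInvOp 𝒜) W)) (sndLeg (Q.rightInvOp 𝒜) (𝒜 ⊗[k] W))
            (fstLeg (Q.rightInvOp 𝒜) (𝒜 ⊗[k] W)) *
          Q.phiInv (fstLeg (leftOp k H 𝒜) (𝒜 ⊗[k] W)) (sndLeg (leftOp k H 𝒜) (𝒜 ⊗[k] W))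
            (shift 𝒜 (sndLeg (leftOp k H 𝒜) W))) n)) =
      Q.twistedMul 𝒜 W ((Q.twistedMul 𝒜 W).lTensor 𝒜 n) := by
  have h₁₂ : ∀ n, Q.twist (sndLeg (Q.rightInvOp 𝒜) W) (fstLeg (Q.rightInvOp 𝒜) W)
      (Q.twistedMul 𝒜 (𝒜 ⊗[k] W) n) = Q.twistedMul 𝒜 (𝒜 ⊗[k] W)
        (Q.twist (shift 𝒜 (sndLeg (Q.rightInvOp 𝒜) W)) (Q.star (sndLeg (Q.rightInvOp 𝒜) (𝒜 ⊗[k] W))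
          (fstLeg (Q.rightInvOp 𝒜) (𝒜 ⊗[k] W))) n) :=
    ((Q.carries_twistedMul_shift 𝒜 (𝒜 ⊗[k] W) (first W (Q.rightInvOp 𝒜))).joint
      (carries_twistedMul_rightInvOp (𝒜 ⊗[k] W) h𝒜)) _
  have h₂₃ : ∀ n, Q.twist (sndLeg (Q.rightInvOp 𝒜) W) (fstLeg (Q.rightInvOp 𝒜) W)
      ((Q.twistedMul 𝒜 W).lTensor 𝒜 n) = (Q.twistedMul 𝒜 W).lTensor 𝒜
        (Q.twist (Q.star (shift 𝒜 (sndLeg (Q.rightInvOp 𝒜) W)) (sndLeg (Q.rightInvOp 𝒜) (𝒜 ⊗[k] W)))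
          (fstLeg (Q.rightInvOp 𝒜) (𝒜 ⊗[k] W)) n) := by
    have h := (carries_twistedMul_rightInvOp W h𝒜).shift (M := 𝒜)
    rw [shift_pull] at h
    exact (h.joint (carries_first (Q.twistedMul 𝒜 W) (Q.rightInvOp 𝒜))) _
  have hl : ∀ n, (Q.twistedMul 𝒜 W).lTensor 𝒜 n = (merge (LinearMap.mul' k 𝒜) W).lTensor 𝒜
      (Q.twist (shift 𝒜 (sndLeg (Q.rightInvOp 𝒜) W)) (sndLeg (Q.rightInvOp 𝒜) (𝒜 ⊗[k] W)) n) := by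
    intro n
    rw [twistedMul, LinearMap.lTensor_comp, LinearMap.comp_apply]
    exact congrArg _ (DFunLike.congr_fun (DFunLike.congr_fun (shift_joint (M := 𝒜)
      (sndLeg (Q.rightInvOp 𝒜) W) (fstLeg (Q.rightInvOp 𝒜) W)) Q.drinfeldTwist) n)
  rw [twistedMul_apply, h₁₂, twistedMul_apply, merge_merge W h𝒜, twistedMul_apply, h₂₃, hl]
  simp only [← Module.End.mul_apply]
  congr 3
  rw [← mul_assoc (Q.twist _ _)]
  exact Q.twist_defect _ _ _ _ _ _

end TwistedMul

end QuasiHopfAlgebra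
end QuasiHopf

namespace QuasiHopf

open MulOpposite

section Induction

variable {k : Type*} [Field k] {X Y Z V W : Type*} [AddCommGroup X] [Module k X] [AddCommGroup Y]
  [Module k Y] [AddCommGroup Z] [Module k Z] [AddCommGroup V] [Module k V] [AddCommGroup W]
  [Module k W]

@[elab_as_elim]
theorem tensor_induction₅ {p : X ⊗[k] (Y ⊗[k] (Z ⊗[k] (V ⊗[k] W))) → Prop}
    (t : X ⊗[k] (Y ⊗[k] (Z ⊗[k] (V ⊗[k] W))))
    (tmul : ∀ x y z v w, p (x ⊗ₜ (y ⊗ₜ (z ⊗ₜ (v ⊗ₜ w))))) (add : ∀ s t, p s → p t → p (s + t)) :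
    p t := by
  induction t using tensor_induction₄ with
  | tmul x y z w =>
    induction w using TensorProduct.induction_on with
    | zero => simpa using tmul 0 0 0 0 0
    | tmul v w => exact tmul x y z v w
    | add s t hs ht => simp only [TensorProduct.tmul_add]; exact add _ _ hs ht
  | add s t hs ht => exact add _ _ hs ht

end Induction

section Collect

variable {k H A R : Type*} [Field k] [Ring H] [Algebra k H] [Ring A] [Algebra k A] [Ring R]
  [Algebra k R]

/-- Moving the values of `s` to the left of those of the maps commuting with it. -/
theorem collect_right (a₁ a₂ : H →ₐ[k] R) (s : A →ₐ[k] R) (c₂ c₁ : H →ₐ[k] R) [AlgCommute a₁ s]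
    [AlgCommute a₂ s] [AlgCommute s c₂] [AlgCommute s c₁] (h₁ h₂ h₄ h₅ p q : H) (x y z : A) :
    a₁ h₁ * (a₂ h₂ * (s x * (c₂ h₄ * c₁ h₅))) * (a₂ p * (s y * c₂ q)) * s z =
      s (x * (y * z)) * (a₁ h₁ * (a₂ h₂ * (c₂ h₄ * (c₁ h₅ * (a₂ p * c₂ q))))) := by
  have e₁ : ∀ h w r, a₁ h * (s w * r) = s w * (a₁ h * r) :=
    fun h w r => (AlgCommute.comm (a := a₁) (b := s) h w).left_comm r
  have e₂ : ∀ h w r, a₂ h * (s w * r) = s w * (a₂ h * r) :=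
    fun h w r => (AlgCommute.comm (a := a₂) (b := s) h w).left_comm r
  have e₃ : ∀ h w r, c₂ h * (s w * r) = s w * (c₂ h * r) :=
    fun h w r => (AlgCommute.comm (a := s) (b := c₂) w h).symm.left_comm r
  have e₄ : ∀ h w r, c₁ h * (s w * r) = s w * (c₁ h * r) :=
    fun h w r => (AlgCommute.comm (a := s) (b := c₁) w h).symm.left_comm r
  have e₅ : ∀ h w, c₂ h * s w = s w * c₂ h :=
    fun h w => (AlgCommute.comm (a := s) (b := c₂) w h).symm
  simp only [mul_assoc, map_mul, e₁, e₂, e₃, e₄, e₅]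

end Collect

section Shift

variable {k H A : Type*} [Field k] [Ring H] [Algebra k H] [Ring A] [Algebra k A]
  (C : TwoSidedData k H A) {M W : Type*} [AddCommGroup M] [Module k M] [AddCommGroup W] [Module k W]
  (a b : H →ₐ[k] Module.End k W) (u : A →ₐ[k] Module.End k W) (d e : H →ₐ[k] Module.End k W)
  [AlgCommute a b] [AlgCommute a u] [AlgCommute a d] [AlgCommute a e] [AlgCommute b u]
  [AlgCommute b d] [AlgCommute b e] [AlgCommute u d] [AlgCommute u e] [AlgCommute d e]

theorem shift_psiInv : C.psiInv (shift M a) (shift M b) (shift M u) (shift M d) (shift M e) =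
    (C.psiInv a b u d e).lTensor M := by
  rw [TwoSidedData.psiInv, TwoSidedData.psiInv, ← shift_apply]
  simp only [shift_joint]

theorem shift_star :
    shift M (C.star a u d) = C.star (shift M a) (shift M u) (shift M d) := by
  rw [shift_pull]
  simp only [shift_joint]

theorem shift_unitHom (ε : H →ₐ[k] k) :
    shift M (unitHom ε (Module.End k W)) = unitHom ε (Module.End k (M ⊗[k] W)) := by
  ext1 h
  rw [shift_apply, unitHom_apply, unitHom_apply]
  exact (Module.End.lTensorAlgHom k W M).commutes (ε h)

end Shift

section One

variable {k H : Type*} [Field k] [Ring H] [Algebra k H] {Q : QuasiHopfAlgebra k H}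
  {𝒜 : Type*} [NonAssocRing 𝒜] [Module k 𝒜]

theorem carries_one_shift {X W : Type*} [Ring X] [Algebra k X] [AddCommGroup W] [Module k W]
    (g : X →ₐ[k] Module.End k W) : Carries (TensorProduct.mk k 𝒜 W 1) g (shift 𝒜 g) :=
  fun _ _ => rfl

variable [SMulCommClass k 𝒜 𝒜] [IsScalarTower k 𝒜 𝒜]
  [Module H 𝒜] [IsScalarTower k H 𝒜] [Module Hᵐᵒᵖ 𝒜] [IsScalarTower k Hᵐᵒᵖ 𝒜]

open QuasiHopfAlgebra

/-- The unit of a bimodule algebra spans a trivial left module. -/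
theorem carries_one_leftOp (h𝒜 : IsBimoduleAlgebra Q.toQuasiBialgebra 𝒜) (W : Type*)
    [AddCommGroup W] [Module k W] :
    Carries (TensorProduct.mk k 𝒜 W 1) (unitHom Q.counit _) (first W (leftOp k H 𝒜)) := by
  intro h n
  simp [unitHom_apply, h𝒜.smul_one, TensorProduct.smul_tmul']

/-- The unit of a bimodule algebra spans a trivial right module. -/
theorem carries_one_rightInvOp (h𝒜 : IsBimoduleAlgebra Q.toQuasiBialgebra 𝒜) (W : Type*)
    [AddCommGroup W] [Module k W] :
    Carries (TensorProduct.mk k 𝒜 W 1) (unitHom Q.counit _) (first W (Q.rightInvOp 𝒜)) := by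
  intro h n
  have : Q.counit (Q.antipodeInv h) = Q.counit h := by
    rw [← Q.counit_antipode, Q.antipode_antipodeInv]
  simp [unitHom_apply, h𝒜.op_smul_one, TensorProduct.smul_tmul', this]

end One

section LeftCrossed

variable {k H A : Type*} [Field k] [Ring H] [Algebra k H] [Ring A] [Algebra k A]
  {Q : QuasiHopfAlgebra k H} {C : TwoSidedData k H A}
  {𝒜 : Type*} [NonAssocRing 𝒜] [Module k 𝒜] [SMulCommClass k 𝒜 𝒜] [IsScalarTower k 𝒜 𝒜]
  [Module H 𝒜] [IsScalarTower k H 𝒜] [Module Hᵐᵒᵖ 𝒜] [IsScalarTower k Hᵐᵒᵖ 𝒜]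
  [SMulCommClass H Hᵐᵒᵖ 𝒜]

open QuasiHopfAlgebra

theorem leftEval_absorb (G : H ⊗[k] (H ⊗[k] (A ⊗[k] (H ⊗[k] H)))) (t : H ⊗[k] (A ⊗[k] H))
    (φ φ' : 𝒜) (y : A) :
    ((LinearMap.mul k A).flip y).lTensor 𝒜 (leftEval 𝒜 (Q.absorb
        (TensorProduct.map LinearMap.id (TensorProduct.map LinearMap.id (TensorProduct.map
          LinearMap.id (TensorProduct.map Q.antipodeInv Q.antipodeInv))) G) t) (φ ⊗ₜ φ')) =
      merge (LinearMap.mul' k 𝒜) A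
        ((joint (fstLeg (leftOp k H 𝒜) A) (joint (sndLeg (leftOp k H 𝒜) A)
            (joint (shift 𝒜 (shift 𝒜 (Algebra.lmul k A)))
              (joint (sndLeg (Q.rightInvOp 𝒜) A) (fstLeg (Q.rightInvOp 𝒜) A)))) G *
          joint (sndLeg (leftOp k H 𝒜) A) (joint (shift 𝒜 (shift 𝒜 (Algebra.lmul k A)))
            (sndLeg (Q.rightInvOp 𝒜) A)) t) (φ ⊗ₜ (φ' ⊗ₜ y))) := by
  induction G using tensor_induction₅ with
  | add s t hs ht => simp only [map_add, add_mul, LinearMap.add_apply, hs, ht]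
  | tmul h₁ h₂ a h₄ h₅ =>
    induction t using tensor_induction₃ with
    | add s t hs ht => simp only [map_add, mul_add, LinearMap.add_apply, hs, ht]
    | tmul p b q =>
      simp only [TensorProduct.map_tmul, LinearMap.id_apply]
      rw [absorb_tmul, leftEval_tmul]
      simp [mul_smul, smul_comm p, mul_assoc]

variable (C) in
/-- The product of `φ ⊗ x` with an arbitrary element, in terms of operators. -/
theorem leftCrossedMul_apply (φ : 𝒜) (x : A) (n : 𝒜 ⊗[k] A) :
    leftCrossedMul 𝒜 Q C (φ ⊗ₜ x) n = Q.twistedMul 𝒜 A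
      (C.psiInv (fstLeg (leftOp k H 𝒜) A) (sndLeg (leftOp k H 𝒜) A)
        (shift 𝒜 (shift 𝒜 (Algebra.lmul k A))) (sndLeg (Q.rightInvOp 𝒜) A)
        (fstLeg (Q.rightInvOp 𝒜) A)
        (C.star (sndLeg (leftOp k H 𝒜) A) (shift 𝒜 (shift 𝒜 (Algebra.lmul k A)))
          (sndLeg (Q.rightInvOp 𝒜) A) x (φ ⊗ₜ n))) := by
  induction n using TensorProduct.induction_on with
  | zero => simp
  | add s t hs ht => simp only [map_add, TensorProduct.tmul_add, hs, ht]
  | tmul φ' y =>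
    rw [leftCrossedMul_tmul, omega, leftEval_absorb, map_mul, joint_oneTensor, joint_oneTensor,
      joint_oneTensor, mul_assoc]
    rfl

variable (C) in
/-- The product of an element of the form `(φ φ') ⊗ y`, with the twisted product, and `n`. -/
theorem leftCrossedMul_twistedMul (φ φ' : 𝒜) (y : A) (n : 𝒜 ⊗[k] A) :
    leftCrossedMul 𝒜 Q C (Q.twistedMul 𝒜 A (φ ⊗ₜ (φ' ⊗ₜ y))) n = Q.twistedMul 𝒜 A
      (C.psiInv (fstLeg (leftOp k H 𝒜) A) (sndLeg (leftOp k H 𝒜) A)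
        (shift 𝒜 (shift 𝒜 (Algebra.lmul k A))) (sndLeg (Q.rightInvOp 𝒜) A)
        (fstLeg (Q.rightInvOp 𝒜) A)
        (C.star (sndLeg (leftOp k H 𝒜) A) (shift 𝒜 (shift 𝒜 (Algebra.lmul k A)))
          (sndLeg (Q.rightInvOp 𝒜) A) y (Q.twistedMul 𝒜 (𝒜 ⊗[k] A) (φ ⊗ₜ (φ' ⊗ₜ n))))) := by
  rw [twistedMul_apply, twistedMul_apply _ _ (𝒜 ⊗[k] A)]
  unfold twist
  generalize Q.drinfeldTwist = t
  induction t using TensorProduct.induction_on with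
  | zero => simp
  | add s t hs ht => simp only [map_add, LinearMap.add_apply, hs, ht]
  | tmul p q => simp [leftCrossedMul_apply]

/-- The product of `(φ ⊗ x) (φ' ⊗ y)` with `n`, in terms of operators. -/
theorem leftCrossedMul_leftCrossedMul (φ φ' : 𝒜) (x y : A) (n : 𝒜 ⊗[k] A) :
    leftCrossedMul 𝒜 Q C (leftCrossedMul 𝒜 Q C (φ ⊗ₜ x) (φ' ⊗ₜ y)) n = Q.twistedMul 𝒜 A
      (C.psiInv (fstLeg (leftOp k H 𝒜) A) (sndLeg (leftOp k H 𝒜) A)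
        (shift 𝒜 (shift 𝒜 (Algebra.lmul k A))) (sndLeg (Q.rightInvOp 𝒜) A)
        (fstLeg (Q.rightInvOp 𝒜) A) (Q.twistedMul 𝒜 (𝒜 ⊗[k] A)
          ((C.psiInv (fstLeg (leftOp k H 𝒜) (𝒜 ⊗[k] A)) (sndLeg (leftOp k H 𝒜) (𝒜 ⊗[k] A))
              (C.star (shift 𝒜 (sndLeg (leftOp k H 𝒜) A))
                (shift 𝒜 (shift 𝒜 (shift 𝒜 (Algebra.lmul k A))))
                (shift 𝒜 (sndLeg (Q.rightInvOp 𝒜) A)))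
              (sndLeg (Q.rightInvOp 𝒜) (𝒜 ⊗[k] A)) (fstLeg (Q.rightInvOp 𝒜) (𝒜 ⊗[k] A)) *
            C.star (sndLeg (leftOp k H 𝒜) (𝒜 ⊗[k] A))
              (C.star (shift 𝒜 (sndLeg (leftOp k H 𝒜) A))
                (shift 𝒜 (shift 𝒜 (shift 𝒜 (Algebra.lmul k A))))
                (shift 𝒜 (sndLeg (Q.rightInvOp 𝒜) A)))
              (sndLeg (Q.rightInvOp 𝒜) (𝒜 ⊗[k] A)) x *
            C.star (shift 𝒜 (sndLeg (leftOp k H 𝒜) A))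
              (shift 𝒜 (shift 𝒜 (shift 𝒜 (Algebra.lmul k A))))
              (shift 𝒜 (sndLeg (Q.rightInvOp 𝒜) A)) y) (φ ⊗ₜ (φ' ⊗ₜ n))))) := by
  have hs : ∀ w n, C.star (sndLeg (leftOp k H 𝒜) A) (shift 𝒜 (shift 𝒜 (Algebra.lmul k A)))
      (sndLeg (Q.rightInvOp 𝒜) A) w (Q.twistedMul 𝒜 (𝒜 ⊗[k] A) n) = Q.twistedMul 𝒜 (𝒜 ⊗[k] A)
        (C.star (shift 𝒜 (sndLeg (leftOp k H 𝒜) A))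
          (shift 𝒜 (shift 𝒜 (shift 𝒜 (Algebra.lmul k A))))
          (shift 𝒜 (sndLeg (Q.rightInvOp 𝒜) A)) w n) :=
    (Q.carries_twistedMul_shift 𝒜 (𝒜 ⊗[k] A) _).pull ((Q.carries_twistedMul_shift 𝒜 _ _).joint
      (Q.carries_twistedMul_shift 𝒜 _ _)) C.δ
  -- By linearity, `Ψ⁻¹` and `δ(x)` may be replaced by arbitrary tensors.
  have key : ∀ (G : H ⊗[k] (H ⊗[k] (A ⊗[k] (H ⊗[k] H)))) (t : H ⊗[k] (A ⊗[k] H)),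
      leftCrossedMul 𝒜 Q C (Q.twistedMul 𝒜 A
        ((joint (fstLeg (leftOp k H 𝒜) A) (joint (sndLeg (leftOp k H 𝒜) A)
            (joint (shift 𝒜 (shift 𝒜 (Algebra.lmul k A)))
              (joint (sndLeg (Q.rightInvOp 𝒜) A) (fstLeg (Q.rightInvOp 𝒜) A)))) G *
          joint (sndLeg (leftOp k H 𝒜) A) (joint (shift 𝒜 (shift 𝒜 (Algebra.lmul k A)))
            (sndLeg (Q.rightInvOp 𝒜) A)) t) (φ ⊗ₜ (φ' ⊗ₜ y)))) n = Q.twistedMul 𝒜 A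
      (C.psiInv (fstLeg (leftOp k H 𝒜) A) (sndLeg (leftOp k H 𝒜) A)
        (shift 𝒜 (shift 𝒜 (Algebra.lmul k A))) (sndLeg (Q.rightInvOp 𝒜) A)
        (fstLeg (Q.rightInvOp 𝒜) A) (Q.twistedMul 𝒜 (𝒜 ⊗[k] A)
          ((joint (fstLeg (leftOp k H 𝒜) (𝒜 ⊗[k] A)) (joint (sndLeg (leftOp k H 𝒜) (𝒜 ⊗[k] A))
              (joint (C.star (shift 𝒜 (sndLeg (leftOp k H 𝒜) A))
                (shift 𝒜 (shift 𝒜 (shift 𝒜 (Algebra.lmul k A))))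
                (shift 𝒜 (sndLeg (Q.rightInvOp 𝒜) A)))
              (joint (sndLeg (Q.rightInvOp 𝒜) (𝒜 ⊗[k] A))
                (fstLeg (Q.rightInvOp 𝒜) (𝒜 ⊗[k] A))))) G *
            joint (sndLeg (leftOp k H 𝒜) (𝒜 ⊗[k] A))
              (joint (C.star (shift 𝒜 (sndLeg (leftOp k H 𝒜) A))
                (shift 𝒜 (shift 𝒜 (shift 𝒜 (Algebra.lmul k A))))
                (shift 𝒜 (sndLeg (Q.rightInvOp 𝒜) A)))
              (sndLeg (Q.rightInvOp 𝒜) (𝒜 ⊗[k] A))) t *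
            C.star (shift 𝒜 (sndLeg (leftOp k H 𝒜) A))
              (shift 𝒜 (shift 𝒜 (shift 𝒜 (Algebra.lmul k A))))
              (shift 𝒜 (sndLeg (Q.rightInvOp 𝒜) A)) y) (φ ⊗ₜ (φ' ⊗ₜ n))))) := by
    intro G t
    induction G using tensor_induction₅ with
    | add s t hs ht => simp only [map_add, add_mul, LinearMap.add_apply, hs, ht]
    | tmul h₁ h₂ a h₄ h₅ =>
      induction t using tensor_induction₃ with
      | add s t hs ht => simp only [map_add, mul_add, add_mul, LinearMap.add_apply, hs, ht]
      | tmul p b q =>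
        simp only [joint_tmul]
        rw [collect_right]
        simp only [Module.End.mul_apply, fstLeg, sndLeg, first_tmul, shift_tmul]
        rw [leftCrossedMul_twistedMul, hs]
        simp
  rw [leftCrossedMul_apply C φ x]
  exact key _ _

theorem leftCrossedMul_assoc (h𝒜 : IsBimoduleAlgebra Q.toQuasiBialgebra 𝒜)
    (hC : IsTwoSidedCoaction Q.toQuasiBialgebra C) (d e n : 𝒜 ⊗[k] A) :
    leftCrossedMul 𝒜 Q C (leftCrossedMul 𝒜 Q C d e) n =
      leftCrossedMul 𝒜 Q C d (leftCrossedMul 𝒜 Q C e n) := by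
  induction d using TensorProduct.induction_on with
  | zero => simp
  | add s t hs ht => simp only [map_add, LinearMap.add_apply, hs, ht]
  | tmul φ x =>
  induction e using TensorProduct.induction_on with
  | zero => simp
  | add s t hs ht => simp only [map_add, LinearMap.add_apply, hs, ht]
  | tmul φ' y =>
  have hr := (carries_twistedMul_rightInvOp A h𝒜).shift (M := 𝒜)
  have hl := (carries_twistedMul_leftOp A h𝒜).shift (M := 𝒜)
  rw [shift_pull] at hr hl
  rw [leftCrossedMul_leftCrossedMul, crossed_assoc hC _ _ _ _ _ _ _ _ _ _ _ _
    (carries_twistedMul_leftOp (𝒜 ⊗[k] A) h𝒜) (Q.carries_twistedMul_shift 𝒜 _ _)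
    (Q.carries_twistedMul_shift 𝒜 _ _) (Q.carries_twistedMul_shift 𝒜 _ _)
    (carries_twistedMul_rightInvOp (𝒜 ⊗[k] A) h𝒜) (carries_first (Q.twistedMul 𝒜 A) _) hl
    (Q.carries_twistedMul_shift 𝒜 A _).shift hr (carries_first (Q.twistedMul 𝒜 A) _)
    (twistedMul_twistedMul A h𝒜)]
  rw [leftCrossedMul_apply C φ' y, leftCrossedMul_apply C φ x, shift_psiInv,
    ← shift_star C (sndLeg (leftOp k H 𝒜) A) (shift 𝒜 (shift 𝒜 (Algebra.lmul k A)))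
      (sndLeg (Q.rightInvOp 𝒜) A)]
  rfl

theorem leftCrossedMul_one_tmul (h𝒜 : IsBimoduleAlgebra Q.toQuasiBialgebra 𝒜)
    (hC : IsTwoSidedCoaction Q.toQuasiBialgebra C) (n : 𝒜 ⊗[k] A) :
    leftCrossedMul 𝒜 Q C (1 ⊗ₜ 1) n = n := by
  have h₁ : ∀ n, C.psiInv (fstLeg (leftOp k H 𝒜) A) (sndLeg (leftOp k H 𝒜) A)
      (shift 𝒜 (shift 𝒜 (Algebra.lmul k A))) (sndLeg (Q.rightInvOp 𝒜) A)
      (fstLeg (Q.rightInvOp 𝒜) A) ((1 : 𝒜) ⊗ₜ n) = (1 : 𝒜) ⊗ₜ C.psiInv (unitHom Q.counit _)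
        (first A (leftOp k H 𝒜)) (shift 𝒜 (Algebra.lmul k A)) (first A (Q.rightInvOp 𝒜))
        (unitHom Q.counit _) n :=
    ((carries_one_leftOp h𝒜 _).joint ((carries_one_shift _).joint ((carries_one_shift _).joint
      ((carries_one_shift _).joint (carries_one_rightInvOp h𝒜 _))))) _
  have h₂ : ∀ n, Q.twist (sndLeg (Q.rightInvOp 𝒜) A) (fstLeg (Q.rightInvOp 𝒜) A) ((1 : 𝒜) ⊗ₜ n) =
      (1 : 𝒜) ⊗ₜ Q.twist (first A (Q.rightInvOp 𝒜)) (unitHom Q.counit _) n :=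
    ((carries_one_shift _).joint (carries_one_rightInvOp h𝒜 _)) _
  rw [leftCrossedMul_apply, map_one, Module.End.one_apply, h₁,
    TwoSidedData.psiInv_unit_outer _ _ _ hC, Module.End.one_apply, twistedMul_apply, h₂,
    twist_unit_right, Module.End.one_apply]
  induction n using TensorProduct.induction_on with
  | zero => simp
  | tmul φ x => simp
  | add s t hs ht => simp only [TensorProduct.tmul_add, map_add, hs, ht]

theorem leftCrossedMul_tmul_one (h𝒜 : IsBimoduleAlgebra Q.toQuasiBialgebra 𝒜)
    (hC : IsTwoSidedCoaction Q.toQuasiBialgebra C) (φ : 𝒜) (x y : A) :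
    leftCrossedMul 𝒜 Q C (φ ⊗ₜ x) (1 ⊗ₜ y) = φ ⊗ₜ (x * y) := by
  have h₃ := carries_first (TensorProduct.mk k 𝒜 A 1) (leftOp k H 𝒜)
  have h₄ := (carries_one_leftOp h𝒜 A).shift (M := 𝒜)
  have h₅ := (carries_one_shift (𝒜 := 𝒜) (Algebra.lmul k A)).shift (M := 𝒜)
  have h₆ := (carries_one_rightInvOp h𝒜 A).shift (M := 𝒜)
  have h₇ := carries_first (TensorProduct.mk k 𝒜 A 1) (Q.rightInvOp 𝒜)
  rw [shift_unitHom] at h₄ h₆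
  have h₁ : ∀ n, C.psiInv (fstLeg (leftOp k H 𝒜) A) (sndLeg (leftOp k H 𝒜) A)
      (shift 𝒜 (shift 𝒜 (Algebra.lmul k A))) (sndLeg (Q.rightInvOp 𝒜) A)
      (fstLeg (Q.rightInvOp 𝒜) A) ((TensorProduct.mk k 𝒜 A 1).lTensor 𝒜 n) =
        (TensorProduct.mk k 𝒜 A 1).lTensor 𝒜 (C.psiInv
          (first A (leftOp k H 𝒜)) (unitHom Q.counit _) (shift 𝒜 (Algebra.lmul k A))
          (unitHom Q.counit _) (first A (Q.rightInvOp 𝒜)) n) :=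
    (h₃.joint (h₄.joint (h₅.joint (h₆.joint h₇)))) _
  have h₂ : ∀ n, Q.twist (sndLeg (Q.rightInvOp 𝒜) A) (fstLeg (Q.rightInvOp 𝒜) A)
      ((TensorProduct.mk k 𝒜 A 1).lTensor 𝒜 n) = (TensorProduct.mk k 𝒜 A 1).lTensor 𝒜
        (Q.twist (unitHom Q.counit _) (first A (Q.rightInvOp 𝒜)) n) :=
    (h₆.joint h₇) _
  have h₈ : ∀ n, C.star (sndLeg (leftOp k H 𝒜) A) (shift 𝒜 (shift 𝒜 (Algebra.lmul k A)))
      (sndLeg (Q.rightInvOp 𝒜) A) x ((TensorProduct.mk k 𝒜 A 1).lTensor 𝒜 n) =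
        (TensorProduct.mk k 𝒜 A 1).lTensor 𝒜 (C.star (unitHom Q.counit _)
          (shift 𝒜 (Algebra.lmul k A)) (unitHom Q.counit _) x n) :=
    (h₄.pull (h₅.joint h₆) C.δ) _
  have e : φ ⊗ₜ[k] ((1 : 𝒜) ⊗ₜ[k] y) = (TensorProduct.mk k 𝒜 A 1).lTensor 𝒜 (φ ⊗ₜ y) := rfl
  rw [leftCrossedMul_apply, e, h₈, h₁, TwoSidedData.psiInv_unit_inner _ _ _ hC,
    TwoSidedData.star_unit _ hC,
    Module.End.one_apply, twistedMul_apply, h₂, twist_unit_left, Module.End.one_apply]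
  simp

theorem leftCrossedIsAlgebra (h𝒜 : IsBimoduleAlgebra Q.toQuasiBialgebra 𝒜)
    (hC : IsTwoSidedCoaction Q.toQuasiBialgebra C) : LeftCrossedIsAlgebra 𝒜 Q C where
  left :=
    { assoc := leftCrossedMul_assoc h𝒜 hC
      one_mul := leftCrossedMul_one_tmul h𝒜 hC
      mul_one := fun x => by
        induction x using TensorProduct.induction_on with
        | zero => simp
        | tmul φ x => rw [leftCrossedMul_tmul_one h𝒜 hC, mul_one]
        | add s t hs ht => rw [map_add, LinearMap.add_apply, hs, ht] }
  right :=
    { map_one := rfl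
      map_mul := fun x y => (leftCrossedMul_tmul_one h𝒜 hC 1 x y).symm }

end LeftCrossed

end QuasiHopf

namespace QuasiHopf

open MulOpposite

/-! ### Contravariant operators -/

section OpOperators

variable {k : Type*} [Field k] {X Y Z : Type*} [Ring X] [Algebra k X] [Ring Y] [Algebra k Y]
  [Ring Z] [Algebra k Z]
  {M M' W N : Type*} [AddCommGroup M] [Module k M] [AddCommGroup M'] [Module k M']
  [AddCommGroup W] [Module k W] [AddCommGroup N] [Module k N]

/-- Operators on `M` with the opposite composition, acting on the first factor of `M ⊗ W`. -/
noncomputable def firstOp (W : Type*) [AddCommGroup W] [Module k W]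
    (f : X →ₐ[k] (Module.End k M)ᵐᵒᵖ) : X →ₐ[k] (Module.End k (M ⊗[k] W))ᵐᵒᵖ :=
  (AlgHom.op (Module.End.rTensorAlgHom k M W)).comp f

/-- Operators on `W` with the opposite composition, acting on the second factor of `M ⊗ W`. -/
noncomputable def shiftOp (M : Type*) [AddCommGroup M] [Module k M]
    (g : X →ₐ[k] (Module.End k W)ᵐᵒᵖ) : X →ₐ[k] (Module.End k (M ⊗[k] W))ᵐᵒᵖ :=
  (AlgHom.op (Module.End.lTensorAlgHom k W M)).comp g

theorem unop_shiftOp (g : X →ₐ[k] (Module.End k W)ᵐᵒᵖ) (x : X) :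
    (shiftOp M g x).unop = (g x).unop.lTensor M := rfl

@[simp]
theorem firstOp_tmul (f : X →ₐ[k] (Module.End k M)ᵐᵒᵖ) (x : X) (m : M) (w : W) :
    (firstOp W f x).unop (m ⊗ₜ w) = (f x).unop m ⊗ₜ w := rfl

@[simp]
theorem shiftOp_tmul (g : X →ₐ[k] (Module.End k W)ᵐᵒᵖ) (x : X) (m : M) (w : W) :
    (shiftOp M g x).unop (m ⊗ₜ w) = m ⊗ₜ (g x).unop w := rfl

instance (f : X →ₐ[k] (Module.End k M)ᵐᵒᵖ) (g : Y →ₐ[k] (Module.End k W)ᵐᵒᵖ) :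
    AlgCommute (firstOp W f) (shiftOp M g) :=
  ⟨fun x y => unop_injective (TensorProduct.ext' fun m w => by simp)⟩

instance (f : X →ₐ[k] (Module.End k M)ᵐᵒᵖ) (g : Y →ₐ[k] (Module.End k W)ᵐᵒᵖ) :
    AlgCommute (shiftOp M g) (firstOp W f) :=
  ⟨fun y x => unop_injective (TensorProduct.ext' fun m w => by simp)⟩

instance (f : X →ₐ[k] (Module.End k M)ᵐᵒᵖ) (g : Y →ₐ[k] (Module.End k M)ᵐᵒᵖ) [AlgCommute f g] :
    AlgCommute (firstOp W f) (firstOp W g) :=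
  ⟨fun x y => (AlgCommute.comm (a := f) (b := g) x y).map
    (AlgHom.op (Module.End.rTensorAlgHom k M W))⟩

instance (f : X →ₐ[k] (Module.End k W)ᵐᵒᵖ) (g : Y →ₐ[k] (Module.End k W)ᵐᵒᵖ) [AlgCommute f g] :
    AlgCommute (shiftOp M f) (shiftOp M g) :=
  ⟨fun x y => (AlgCommute.comm (a := f) (b := g) x y).map
    (AlgHom.op (Module.End.lTensorAlgHom k W M))⟩

theorem shiftOp_joint (a : X →ₐ[k] (Module.End k W)ᵐᵒᵖ) (b : Y →ₐ[k] (Module.End k W)ᵐᵒᵖ)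
    [AlgCommute a b] : shiftOp M (joint a b) = joint (shiftOp M a) (shiftOp M b) := by
  refine AlgHom.ext fun t => ?_
  induction t using TensorProduct.induction_on with
  | zero => simp
  | tmul x y =>
    refine unop_injective ?_
    rw [unop_shiftOp, joint_tmul, joint_tmul]
    exact LinearMap.lTensor_mul M (b y).unop (a x).unop
  | add s t hs ht => simp only [map_add, hs, ht]

theorem shiftOp_pull (g : Z →ₐ[k] X ⊗[k] Y) (a : X →ₐ[k] (Module.End k W)ᵐᵒᵖ)
    (b : Y →ₐ[k] (Module.End k W)ᵐᵒᵖ) [AlgCommute a b] :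
    shiftOp M (pull g a b) = pull g (shiftOp M a) (shiftOp M b) := by
  ext1 z
  exact DFunLike.congr_fun (shiftOp_joint a b) (g z)

theorem shiftOp_unitHom (ε : X →ₐ[k] k) :
    shiftOp M (unitHom ε (Module.End k W)ᵐᵒᵖ) = unitHom ε (Module.End k (M ⊗[k] W))ᵐᵒᵖ := by
  ext1 h
  exact (AlgHom.op (Module.End.lTensorAlgHom k W M)).commutes (ε h)

/-- The linear map `m` carries the operators `p` to the operators `q`. -/
def CarriesOp (m : M →ₗ[k] M') (p : X →ₐ[k] (Module.End k M)ᵐᵒᵖ)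
    (q : X →ₐ[k] (Module.End k M')ᵐᵒᵖ) : Prop :=
  ∀ x n, (q x).unop (m n) = m ((p x).unop n)

section

variable {m : M →ₗ[k] M'} {p : X →ₐ[k] (Module.End k M)ᵐᵒᵖ} {q : X →ₐ[k] (Module.End k M')ᵐᵒᵖ}
  {p' : Y →ₐ[k] (Module.End k M)ᵐᵒᵖ} {q' : Y →ₐ[k] (Module.End k M')ᵐᵒᵖ} [AlgCommute p p']
  [AlgCommute q q']

theorem CarriesOp.joint (h : CarriesOp m p q) (h' : CarriesOp m p' q') :
    CarriesOp m (joint p p') (joint q q') := by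
  intro t n
  induction t using TensorProduct.induction_on with
  | zero => simp
  | tmul x y => simp only [joint_tmul, unop_mul, Module.End.mul_apply, h' y, h x]
  | add s t hs ht => simp only [map_add, unop_add, LinearMap.add_apply, hs, ht]

theorem CarriesOp.pull (h : CarriesOp m p q) (h' : CarriesOp m p' q') (g : Z →ₐ[k] X ⊗[k] Y) :
    CarriesOp m (pull g p p') (pull g q q') :=
  fun z => h.joint h' (g z)

end

theorem CarriesOp.shift {m : W →ₗ[k] N} {p : X →ₐ[k] (Module.End k W)ᵐᵒᵖ}
    {q : X →ₐ[k] (Module.End k N)ᵐᵒᵖ} (h : CarriesOp m p q) :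
    CarriesOp (m.lTensor M) (shiftOp M p) (shiftOp M q) := by
  intro x n
  induction n using TensorProduct.induction_on with
  | zero => simp
  | tmul x y => simp [h _ _]
  | add s t hs ht => simp only [map_add, hs, ht]

theorem carriesOp_first (m : W →ₗ[k] N) (f : X →ₐ[k] (Module.End k M)ᵐᵒᵖ) :
    CarriesOp (m.lTensor M) (firstOp W f) (firstOp N f) := by
  intro x n
  induction n using TensorProduct.induction_on with
  | zero => simp
  | tmul x y => simp
  | add s t hs ht => simp only [map_add, hs, ht]

theorem carriesOp_merge_shift (μ : M ⊗[k] M →ₗ[k] M) (g : X →ₐ[k] (Module.End k W)ᵐᵒᵖ) :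
    CarriesOp (merge μ W) (shiftOp M (shiftOp M g)) (shiftOp M g) := by
  intro x n
  induction n using tensor_induction₃ with
  | tmul m m' w => simp
  | add s t hs ht => simp only [map_add, hs, ht]

end OpOperators

section OpCore

variable {k H A : Type*} [Field k] [Ring H] [Algebra k H] [Ring A] [Algebra k A]
  {Q : QuasiBialgebra k H} {C : TwoSidedData k H A}
  {N₁ N₂ N₃ : Type*} [AddCommGroup N₁] [Module k N₁] [AddCommGroup N₂] [Module k N₂]
  [AddCommGroup N₃] [Module k N₃]

/-- Associativity of a right crossed product, on the level of operators, with the notation of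
`crossed_assoc`. As the operators compose contravariantly, `Ψ` takes the place of `Ψ⁻¹`. -/
theorem crossed_assoc_op (hC : IsTwoSidedCoaction Q C)
    (a₁ a₂ a₃ : H →ₐ[k] (Module.End k N₃)ᵐᵒᵖ) (u : A →ₐ[k] (Module.End k N₃)ᵐᵒᵖ)
    (c₃ c₂ c₁ : H →ₐ[k] (Module.End k N₃)ᵐᵒᵖ)
    [AlgCommute a₁ a₂] [AlgCommute a₁ a₃] [AlgCommute a₁ u] [AlgCommute a₁ c₃] [AlgCommute a₁ c₂]
    [AlgCommute a₁ c₁] [AlgCommute a₂ a₃] [AlgCommute a₂ u] [AlgCommute a₂ c₃] [AlgCommute a₂ c₂]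
    [AlgCommute a₂ c₁] [AlgCommute a₃ u] [AlgCommute a₃ c₃] [AlgCommute a₃ c₂] [AlgCommute a₃ c₁]
    [AlgCommute u c₃] [AlgCommute u c₂] [AlgCommute u c₁] [AlgCommute c₃ c₂] [AlgCommute c₃ c₁]
    [AlgCommute c₂ c₁]
    (a₁' a₂' : H →ₐ[k] (Module.End k N₂)ᵐᵒᵖ) (u' : A →ₐ[k] (Module.End k N₂)ᵐᵒᵖ)
    (c₂' c₁' : H →ₐ[k] (Module.End k N₂)ᵐᵒᵖ)
    [AlgCommute a₁' a₂'] [AlgCommute a₁' u'] [AlgCommute a₁' c₂'] [AlgCommute a₁' c₁']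
    [AlgCommute a₂' u'] [AlgCommute a₂' c₂'] [AlgCommute a₂' c₁'] [AlgCommute u' c₂']
    [AlgCommute u' c₁'] [AlgCommute c₂' c₁']
    {m₁₂ m₂₃ : N₃ →ₗ[k] N₂} {m : N₂ →ₗ[k] N₁}
    (ha₁ : CarriesOp m₁₂ (Q.star a₁ a₂) a₁') (ha₂ : CarriesOp m₁₂ a₃ a₂') (hu : CarriesOp m₁₂ u u')
    (hc₂ : CarriesOp m₁₂ c₃ c₂') (hc₁ : CarriesOp m₁₂ (Q.star c₂ c₁) c₁')
    (ha₁' : CarriesOp m₂₃ a₁ a₁') (ha₂' : CarriesOp m₂₃ (Q.star a₂ a₃) a₂')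
    (hu' : CarriesOp m₂₃ u u') (hc₂' : CarriesOp m₂₃ (Q.star c₃ c₂) c₂')
    (hc₁' : CarriesOp m₂₃ c₁ c₁')
    (hm : ∀ n, m (m₁₂ ((Q.phi a₁ a₂ a₃ * Q.phiInv c₃ c₂ c₁).unop n)) = m (m₂₃ n))
    (x y : A) (n : N₃) :
    m ((C.psi a₁' a₂' u' c₂' c₁').unop (m₁₂ ((C.star a₃ u c₃ y *
        (C.star a₂ (C.star a₃ u c₃) c₂ x * C.psi a₁ a₂ (C.star a₃ u c₃) c₂ c₁)).unop n))) =
      m ((C.psi a₁' a₂' u' c₂' c₁').unop ((C.star a₂' u' c₂' x).unop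
        (m₂₃ ((C.star a₃ u c₃ y * C.psi a₂ a₃ u c₃ c₂).unop n)))) := by
  have h₁₂ : ∀ n, (C.psi a₁' a₂' u' c₂' c₁').unop (m₁₂ n) =
      m₁₂ ((C.psi (Q.star a₁ a₂) a₃ u c₃ (Q.star c₂ c₁)).unop n) :=
    (ha₁.joint (ha₂.joint (hu.joint (hc₂.joint hc₁)))) _
  have h₂₃ : ∀ n, (C.psi a₁' a₂' u' c₂' c₁').unop (m₂₃ n) =
      m₂₃ ((C.psi a₁ (Q.star a₂ a₃) u (Q.star c₃ c₂) c₁).unop n) :=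
    (ha₁'.joint (ha₂'.joint (hu'.joint (hc₂'.joint hc₁')))) _
  have hs : ∀ n, (C.star a₂' u' c₂' x).unop (m₂₃ n) =
      m₂₃ ((C.star (Q.star a₂ a₃) u (Q.star c₃ c₂) x).unop n) :=
    (ha₂'.pull (hu'.joint hc₂') C.δ) x
  rw [h₁₂, hs, h₂₃, ← hm]
  simp only [← Module.End.mul_apply, ← unop_mul]
  congr 4
  have hi := TwoSidedData.psi_intertwines a₂ a₃ u c₃ c₂ hC x
  have hc := TwoSidedData.psi_cocycle a₁ a₂ a₃ u c₃ c₂ c₁ hC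
  simp only [mul_assoc] at hc ⊢
  rw [← hc, ← mul_assoc (C.psi a₂ a₃ u c₃ c₂) (C.star _ _ _ x), hi]
  simp only [mul_assoc]

end OpCore

end QuasiHopf

namespace QuasiHopf

open MulOpposite

/-! ### The right crossed product -/

section Legs

variable {k X M : Type*} [Field k] [Ring X] [Algebra k X] [AddCommGroup M] [Module k M]

/-- Contravariant operators on `M`, acting on the first factor of `M ⊗ (M ⊗ W)`. -/
noncomputable abbrev fstLegOp (f : X →ₐ[k] (Module.End k M)ᵐᵒᵖ) (W : Type*) [AddCommGroup W]
    [Module k W] : X →ₐ[k] (Module.End k (M ⊗[k] (M ⊗[k] W)))ᵐᵒᵖ := firstOp (M ⊗[k] W) f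

/-- Contravariant operators on `M`, acting on the second factor of `M ⊗ (M ⊗ W)`. -/
noncomputable abbrev sndLegOp (f : X →ₐ[k] (Module.End k M)ᵐᵒᵖ) (W : Type*) [AddCommGroup W]
    [Module k W] : X →ₐ[k] (Module.End k (M ⊗[k] (M ⊗[k] W)))ᵐᵒᵖ := shiftOp M (firstOp W f)

end Legs

section Opposite

variable (k : Type*) [Field k]

/-- The right action `m ↦ m · x`, which composes contravariantly. -/
noncomputable def rightOp (X M : Type*) [Ring X] [Algebra k X] [AddCommGroup M] [Module k M]
    [Module Xᵐᵒᵖ M] [IsScalarTower k Xᵐᵒᵖ M] : X →ₐ[k] (Module.End k M)ᵐᵒᵖ :=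
  AlgHom.opComm.symm (Algebra.lsmul k k M)

@[simp]
theorem rightOp_apply {X M : Type*} [Ring X] [Algebra k X] [AddCommGroup M] [Module k M]
    [Module Xᵐᵒᵖ M] [IsScalarTower k Xᵐᵒᵖ M] (x : X) (m : M) :
    (rightOp k X M x).unop m = op x • m := rfl

/-- The multiplication `φ ⊗ φ' ↦ φ' φ`. -/
noncomputable def mulFlip (𝒜 : Type*) [NonAssocRing 𝒜] [Module k 𝒜] [SMulCommClass k 𝒜 𝒜]
    [IsScalarTower k 𝒜 𝒜] : 𝒜 ⊗[k] 𝒜 →ₗ[k] 𝒜 :=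
  LinearMap.mul' k 𝒜 ∘ₗ (TensorProduct.comm k 𝒜 𝒜).toLinearMap

@[simp]
theorem mulFlip_tmul {𝒜 : Type*} [NonAssocRing 𝒜] [Module k 𝒜] [SMulCommClass k 𝒜 𝒜]
    [IsScalarTower k 𝒜 𝒜] (φ φ' : 𝒜) : mulFlip k 𝒜 (φ ⊗ₜ φ') = φ' * φ := rfl

end Opposite

namespace QuasiHopfAlgebra

section Actions

variable {k H : Type*} [Field k] [Ring H] [Algebra k H] (Q : QuasiHopfAlgebra k H)
  (𝒜 : Type*) [NonAssocRing 𝒜] [Module k 𝒜]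

/-- The right action `φ ↦ S⁻¹(h) · φ` obtained from the left action. -/
noncomputable def leftInvOp [Module H 𝒜] [IsScalarTower k H 𝒜] : H →ₐ[k] (Module.End k 𝒜)ᵐᵒᵖ :=
  (AlgHom.op (Algebra.lsmul k k 𝒜)).comp Q.antipodeInvHom

@[simp]
theorem leftInvOp_apply [Module H 𝒜] [IsScalarTower k H 𝒜] (h : H) (φ : 𝒜) :
    (Q.leftInvOp 𝒜 h).unop φ = Q.antipodeInv h • φ := rfl

instance [Module H 𝒜] [IsScalarTower k H 𝒜] [Module Hᵐᵒᵖ 𝒜] [IsScalarTower k Hᵐᵒᵖ 𝒜]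
    [SMulCommClass H Hᵐᵒᵖ 𝒜] : AlgCommute (Q.leftInvOp 𝒜) (rightOp k H 𝒜) :=
  ⟨fun x y => unop_injective (LinearMap.ext fun φ => (smul_comm (Q.antipodeInv x) (op y) φ).symm)⟩

end Actions

section Twist

variable {k H R : Type*} [Field k] [Ring H] [Algebra k H] [Ring R] [Algebra k R]
  (Q : QuasiHopfAlgebra k H)

/-- The inverse of the Drinfeld twist in `R`, with legs mapped by `a` and `b`. -/
noncomputable def twistInv (a b : H →ₐ[k] R) [AlgCommute a b] : R :=
  joint a b (Ring.inverse Q.drinfeldTwist)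

theorem twistInv_mul_twist (a b : H →ₐ[k] R) [AlgCommute a b] :
    Q.twistInv a b * Q.twist a b = 1 := by
  rw [twistInv, twist, ← map_mul, Ring.inverse_mul_cancel _ Q.isUnit_drinfeldTwist, map_one]

theorem twist_mul_twistInv (a b : H →ₐ[k] R) [AlgCommute a b] :
    Q.twist a b * Q.twistInv a b = 1 := by
  rw [twistInv, twist, ← map_mul, Ring.mul_inverse_cancel _ Q.isUnit_drinfeldTwist, map_one]

theorem twistInv_unit_left (b : H →ₐ[k] R) : Q.twistInv (unitHom Q.counit R) b = 1 := by
  simpa [twist_unit_left] using Q.twist_mul_twistInv (unitHom Q.counit R) b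

theorem twistInv_unit_right (a : H →ₐ[k] R) : Q.twistInv a (unitHom Q.counit R) = 1 := by
  simpa [twist_unit_right] using Q.twist_mul_twistInv a (unitHom Q.counit R)

theorem comul_antipode_mul_inverse (h : H) :
    Q.comul (Q.antipode h) * Ring.inverse Q.drinfeldTwist =
      Ring.inverse Q.drinfeldTwist * Q.antipodeFlip (Q.comul h) := by
  have hf := Q.isUnit_drinfeldTwist
  rw [← Ring.inverse_mul_cancel_left _ (Q.comul (Q.antipode h)) hf,
    drinfeldTwist_mul_comul_antipode, mul_assoc, mul_assoc, Ring.mul_inverse_cancel _ hf, mul_one]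

/-- The coherence `twist_phi`, for the inverse of the twist. -/
theorem phi_mul_twistInv (a b c : H →ₐ[k] R) [AlgCommute a b] [AlgCommute a c] [AlgCommute b c] :
    Q.phi a b c * (Q.twistInv (Q.star a b) c * Q.twistInv a b) =
      Q.twistInv a (Q.star b c) * Q.twistInv b c *
        joint a (joint b c) (Q.antipodeFlip₃ Q.reassoc.val) := by
  have h := Q.twist_phi a b c
  have h₁ : Q.phi a b c = Q.twistInv a (Q.star b c) * Q.twistInv b c *
      (joint a (joint b c) (Q.antipodeFlip₃ Q.reassoc.val) * Q.twist a b *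
        Q.twist (Q.star a b) c) := by
    rw [← h, mul_assoc, mul_assoc (Q.twist b c), ← mul_assoc (Q.twistInv b c), twistInv_mul_twist,
      one_mul, ← mul_assoc, twistInv_mul_twist, one_mul]
  rw [h₁, mul_assoc, mul_assoc _ (Q.twist _ _), ← mul_assoc (Q.twist _ _) (Q.twistInv _ _),
    twist_mul_twistInv, one_mul, mul_assoc (joint _ _ _), twist_mul_twistInv, mul_one]

/-- The counterpart of `twist_defect` for the inverse of the twist. -/
theorem twistInv_defect (a₁ a₂ a₃ c₃ c₂ c₁ : H →ₐ[k] R) [AlgCommute a₁ a₂] [AlgCommute a₁ a₃]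
    [AlgCommute a₂ a₃] [AlgCommute c₃ c₂] [AlgCommute c₃ c₁] [AlgCommute c₂ c₁]
    [AlgCommute a₁ c₃] [AlgCommute a₁ c₂] [AlgCommute a₁ c₁]
    [AlgCommute a₂ c₃] [AlgCommute a₂ c₂] [AlgCommute a₂ c₁]
    [AlgCommute a₃ c₃] [AlgCommute a₃ c₂] [AlgCommute a₃ c₁] :
    Q.phi a₁ a₂ a₃ * Q.phiInv c₃ c₂ c₁ * (Q.twistInv (Q.star a₁ a₂) a₃ * Q.twistInv a₁ a₂) =
      Q.twistInv a₁ (Q.star a₂ a₃) * Q.twistInv a₂ a₃ *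
        (joint a₁ (joint a₂ a₃) (Q.antipodeFlip₃ Q.reassoc.val) * Q.phiInv c₃ c₂ c₁) := by
  have hc : ∀ t, joint (Q.star a₁ a₂) a₃ t * Q.phiInv c₃ c₂ c₁ =
      Q.phiInv c₃ c₂ c₁ * joint (Q.star a₁ a₂) a₃ t := fun t =>
    intertwines_left (joint (Q.star a₁ a₂) a₃) (joint c₃ (joint c₂ c₁)) t _
  have hc' : ∀ t, joint a₁ a₂ t * Q.phiInv c₃ c₂ c₁ = Q.phiInv c₃ c₂ c₁ * joint a₁ a₂ t :=
    fun t => intertwines_left (joint a₁ a₂) (joint c₃ (joint c₂ c₁)) t _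
  rw [← mul_assoc _ (joint _ _ _) (Q.phiInv c₃ c₂ c₁), ← Q.phi_mul_twistInv]
  simp only [mul_assoc]
  rw [twistInv, twistInv, hc', ← mul_assoc (joint _ _ _), hc, mul_assoc]

end Twist

section TwistedMulOp

variable {k H : Type*} [Field k] [Ring H] [Algebra k H] (Q : QuasiHopfAlgebra k H)
  (𝒜 : Type*) [NonAssocRing 𝒜] [Module k 𝒜] [SMulCommClass k 𝒜 𝒜] [IsScalarTower k 𝒜 𝒜]
  (W : Type*) [AddCommGroup W] [Module k W]

theorem merge_rightOp [Module Hᵐᵒᵖ 𝒜] [IsScalarTower k Hᵐᵒᵖ 𝒜] (t : H ⊗[k] H) (φ φ' : 𝒜) (w : W) :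
    merge (mulFlip k 𝒜) W
        ((joint (sndLegOp (rightOp k H 𝒜) W) (fstLegOp (rightOp k H 𝒜) W) t).unop
          (φ' ⊗ₜ (φ ⊗ₜ w))) =
      LinearMap.mul' k 𝒜 (rightAct₂ k 𝒜 t (φ ⊗ₜ φ')) ⊗ₜ w := by
  induction t using TensorProduct.induction_on with
  | zero => simp
  | tmul x y => simp [rightAct₂, rightAct]
  | add s t hs ht =>
    simp only [map_add, unop_add, LinearMap.add_apply, hs, ht, TensorProduct.add_tmul]

variable [Module H 𝒜] [IsScalarTower k H 𝒜]

theorem merge_leftInvOp (t : H ⊗[k] H) (φ φ' : 𝒜) (w : W) :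
    merge (mulFlip k 𝒜) W ((joint (fstLegOp (Q.leftInvOp 𝒜) W) (sndLegOp (Q.leftInvOp 𝒜) W)
        (Q.antipodeFlip t)).unop (φ' ⊗ₜ (φ ⊗ₜ w))) =
      LinearMap.mul' k 𝒜 (leftAct₂ k 𝒜 t (φ ⊗ₜ φ')) ⊗ₜ w := by
  induction t using TensorProduct.induction_on with
  | zero => simp
  | tmul x y => simp [leftAct₂, leftAct, antipodeInv_antipode]
  | add s t hs ht =>
    simp only [map_add, unop_add, LinearMap.add_apply, hs, ht, TensorProduct.add_tmul]

/-- The product `φ φ'` of the first two factors of `φ' ⊗ φ ⊗ w`, twisted by the action of `f⁻¹`. -/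
noncomputable def twistedMulOp : 𝒜 ⊗[k] (𝒜 ⊗[k] W) →ₗ[k] 𝒜 ⊗[k] W :=
  merge (mulFlip k 𝒜) W ∘ₗ
    (Q.twistInv (fstLegOp (Q.leftInvOp 𝒜) W) (sndLegOp (Q.leftInvOp 𝒜) W)).unop

theorem twistedMulOp_apply (n : 𝒜 ⊗[k] (𝒜 ⊗[k] W)) : Q.twistedMulOp 𝒜 W n =
    merge (mulFlip k 𝒜) W
      ((Q.twistInv (fstLegOp (Q.leftInvOp 𝒜) W) (sndLegOp (Q.leftInvOp 𝒜) W)).unop n) :=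
  rfl

theorem carriesOp_twistedMulOp_shift {X : Type*} [Ring X] [Algebra k X]
    (g : X →ₐ[k] (Module.End k W)ᵐᵒᵖ) :
    CarriesOp (Q.twistedMulOp 𝒜 W) (shiftOp 𝒜 (shiftOp 𝒜 g)) (shiftOp 𝒜 g) := by
  intro h n
  rw [twistedMulOp_apply, twistedMulOp_apply, carriesOp_merge_shift, ← Module.End.mul_apply,
    ← Module.End.mul_apply, ← unop_mul, ← unop_mul]
  congr 3
  exact AlgCommute.comm (a := joint (fstLegOp (Q.leftInvOp 𝒜) W) (sndLegOp (Q.leftInvOp 𝒜) W))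
    (b := shiftOp 𝒜 (shiftOp 𝒜 g)) _ _

variable [Module Hᵐᵒᵖ 𝒜] [IsScalarTower k Hᵐᵒᵖ 𝒜] {Q} {𝒜}

theorem carriesOp_merge_rightOp (h𝒜 : IsBimoduleAlgebra Q.toQuasiBialgebra 𝒜) :
    CarriesOp (merge (mulFlip k 𝒜) W)
      (Q.star (sndLegOp (rightOp k H 𝒜) W) (fstLegOp (rightOp k H 𝒜) W))
      (firstOp W (rightOp k H 𝒜)) := by
  intro h n
  induction n using tensor_induction₃ with
  | tmul φ φ' w =>
    rw [pull_apply, merge_rightOp, ← h𝒜.op_smul_mul]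
    simp
  | add s t hs ht => simp only [map_add, hs, ht]

theorem carriesOp_twistedMulOp_leftInvOp (h𝒜 : IsBimoduleAlgebra Q.toQuasiBialgebra 𝒜) :
    CarriesOp (Q.twistedMulOp 𝒜 W)
      (Q.star (fstLegOp (Q.leftInvOp 𝒜) W) (sndLegOp (Q.leftInvOp 𝒜) W))
      (firstOp W (Q.leftInvOp 𝒜)) := by
  intro h n
  -- Write `h = S(g)` and use `Δ(S(g)) f⁻¹ = f⁻¹ (S ⊗ S)(Δᶜᵒᵖ(g))`.
  obtain ⟨g, rfl⟩ : ∃ g, Q.antipode g = h := ⟨_, Q.antipode_antipodeInv h⟩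
  have key : ∀ n, (firstOp W (Q.leftInvOp 𝒜) (Q.antipode g)).unop (merge (mulFlip k 𝒜) W n) =
      merge (mulFlip k 𝒜) W ((joint (fstLegOp (Q.leftInvOp 𝒜) W) (sndLegOp (Q.leftInvOp 𝒜) W)
        (Q.antipodeFlip (Q.comul g))).unop n) := by
    intro n
    induction n using tensor_induction₃ with
    | tmul φ φ' w =>
      rw [merge_leftInvOp, ← h𝒜.smul_mul]
      simp [antipodeInv_antipode]
    | add s t hs ht => simp only [map_add, hs, ht]
  rw [twistedMulOp_apply, twistedMulOp_apply, key, ← Module.End.mul_apply, ← Module.End.mul_apply,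
    ← unop_mul, ← unop_mul, pull_apply, twistInv, ← map_mul, ← map_mul, comul_antipode_mul_inverse]

variable [SMulCommClass H Hᵐᵒᵖ 𝒜]

theorem carriesOp_twistedMulOp_rightOp (h𝒜 : IsBimoduleAlgebra Q.toQuasiBialgebra 𝒜) :
    CarriesOp (Q.twistedMulOp 𝒜 W)
      (Q.star (sndLegOp (rightOp k H 𝒜) W) (fstLegOp (rightOp k H 𝒜) W))
      (firstOp W (rightOp k H 𝒜)) := by
  intro h n
  rw [twistedMulOp_apply, twistedMulOp_apply, carriesOp_merge_rightOp W h𝒜, ← Module.End.mul_apply,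
    ← Module.End.mul_apply, ← unop_mul, ← unop_mul]
  congr 3
  exact AlgCommute.comm (a := joint (fstLegOp (Q.leftInvOp 𝒜) W) (sndLegOp (Q.leftInvOp 𝒜) W))
    (b := Q.star (sndLegOp (rightOp k H 𝒜) W) (fstLegOp (rightOp k H 𝒜) W)) _ _

/-- Quasi-associativity of `𝒜` for the flipped product of the first two factors. -/
theorem merge_merge_op (h𝒜 : IsBimoduleAlgebra Q.toQuasiBialgebra 𝒜)
    (n : 𝒜 ⊗[k] (𝒜 ⊗[k] (𝒜 ⊗[k] W))) :
    merge (mulFlip k 𝒜) W ((merge (mulFlip k 𝒜) W).lTensor 𝒜 n) =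
      merge (mulFlip k 𝒜) W (merge (mulFlip k 𝒜) (𝒜 ⊗[k] W)
        ((joint (fstLegOp (Q.leftInvOp 𝒜) (𝒜 ⊗[k] W)) (joint (sndLegOp (Q.leftInvOp 𝒜) (𝒜 ⊗[k] W))
            (shiftOp 𝒜 (sndLegOp (Q.leftInvOp 𝒜) W))) (Q.antipodeFlip₃ Q.reassoc.val) *
          Q.phiInv (shiftOp 𝒜 (sndLegOp (rightOp k H 𝒜) W)) (sndLegOp (rightOp k H 𝒜) (𝒜 ⊗[k] W))
            (fstLegOp (rightOp k H 𝒜) (𝒜 ⊗[k] W))).unop n)) := by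
  have key : ∀ (φ φ' φ'' : 𝒜) (w : W) (s t : H ⊗[k] (H ⊗[k] H)),
      merge (mulFlip k 𝒜) W (merge (mulFlip k 𝒜) (𝒜 ⊗[k] W)
        ((joint (fstLegOp (Q.leftInvOp 𝒜) (𝒜 ⊗[k] W)) (joint (sndLegOp (Q.leftInvOp 𝒜) (𝒜 ⊗[k] W))
            (shiftOp 𝒜 (sndLegOp (Q.leftInvOp 𝒜) W))) (Q.antipodeFlip₃ s) *
          joint (shiftOp 𝒜 (sndLegOp (rightOp k H 𝒜) W)) (joint
            (sndLegOp (rightOp k H 𝒜) (𝒜 ⊗[k] W)) (fstLegOp (rightOp k H 𝒜) (𝒜 ⊗[k] W))) t).unop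
          (φ'' ⊗ₜ (φ' ⊗ₜ (φ ⊗ₜ w))))) =
      LinearMap.mul' k 𝒜 (TensorProduct.map LinearMap.id (LinearMap.mul' k 𝒜)
        (leftAct₃ k 𝒜 s (rightAct₃ k 𝒜 t (φ ⊗ₜ (φ' ⊗ₜ φ''))))) ⊗ₜ w := by
    intro φ φ' φ'' w s t
    induction t using tensor_induction₃ with
    | add s t hs ht =>
      simp only [map_add, mul_add, unop_add, LinearMap.add_apply, hs, ht, TensorProduct.add_tmul]
    | tmul x y z =>
      induction s using tensor_induction₃ with
      | add s t hs ht =>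
        simp only [map_add, add_mul, unop_add, LinearMap.add_apply, hs, ht, TensorProduct.add_tmul]
      | tmul x' y' z' =>
        simp [leftAct₃, rightAct₃, leftAct₂, rightAct₂, leftAct, rightAct, antipodeInv_antipode,
          smul_comm x' (op x), smul_comm y' (op y), smul_comm z' (op z)]
  induction n using tensor_induction₄ with
  | add s t hs ht => simp only [map_add, hs, ht]
  | tmul φ φ' φ'' w =>
    rw [QuasiBialgebra.phiInv, key, ← h𝒜.quasi_assoc]
    simp

/-- The twisted products are associative up to `Φ` and the opposite of `Φ⁻¹`. -/
theorem twistedMulOp_twistedMulOp (h𝒜 : IsBimoduleAlgebra Q.toQuasiBialgebra 𝒜)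
    (n : 𝒜 ⊗[k] (𝒜 ⊗[k] (𝒜 ⊗[k] W))) :
    Q.twistedMulOp 𝒜 W (Q.twistedMulOp 𝒜 (𝒜 ⊗[k] W)
        ((Q.phi (fstLegOp (Q.leftInvOp 𝒜) (𝒜 ⊗[k] W)) (sndLegOp (Q.leftInvOp 𝒜) (𝒜 ⊗[k] W))
            (shiftOp 𝒜 (sndLegOp (Q.leftInvOp 𝒜) W)) *
          Q.phiInv (shiftOp 𝒜 (sndLegOp (rightOp k H 𝒜) W)) (sndLegOp (rightOp k H 𝒜) (𝒜 ⊗[k] W))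
            (fstLegOp (rightOp k H 𝒜) (𝒜 ⊗[k] W))).unop n)) =
      Q.twistedMulOp 𝒜 W ((Q.twistedMulOp 𝒜 W).lTensor 𝒜 n) := by
  have h₁₂ : ∀ n, (Q.twistInv (fstLegOp (Q.leftInvOp 𝒜) W) (sndLegOp (Q.leftInvOp 𝒜) W)).unop
      (Q.twistedMulOp 𝒜 (𝒜 ⊗[k] W) n) = Q.twistedMulOp 𝒜 (𝒜 ⊗[k] W)
        ((Q.twistInv (Q.star (fstLegOp (Q.leftInvOp 𝒜) (𝒜 ⊗[k] W))
          (sndLegOp (Q.leftInvOp 𝒜) (𝒜 ⊗[k] W)))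
          (shiftOp 𝒜 (sndLegOp (Q.leftInvOp 𝒜) W))).unop n) :=
    ((carriesOp_twistedMulOp_leftInvOp (𝒜 ⊗[k] W) h𝒜).joint
      (Q.carriesOp_twistedMulOp_shift 𝒜 (𝒜 ⊗[k] W) (firstOp W (Q.leftInvOp 𝒜)))) _
  have h₂₃ : ∀ n, (Q.twistInv (fstLegOp (Q.leftInvOp 𝒜) W) (sndLegOp (Q.leftInvOp 𝒜) W)).unop
      ((Q.twistedMulOp 𝒜 W).lTensor 𝒜 n) = (Q.twistedMulOp 𝒜 W).lTensor 𝒜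
        ((Q.twistInv (fstLegOp (Q.leftInvOp 𝒜) (𝒜 ⊗[k] W))
          (Q.star (sndLegOp (Q.leftInvOp 𝒜) (𝒜 ⊗[k] W))
            (shiftOp 𝒜 (sndLegOp (Q.leftInvOp 𝒜) W)))).unop n) := by
    have h := (carriesOp_twistedMulOp_leftInvOp W h𝒜).shift (M := 𝒜)
    rw [shiftOp_pull] at h
    exact ((carriesOp_first (Q.twistedMulOp 𝒜 W) (Q.leftInvOp 𝒜)).joint h) _
  have hl : ∀ n, (Q.twistedMulOp 𝒜 W).lTensor 𝒜 n = (merge (mulFlip k 𝒜) W).lTensor 𝒜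
      ((Q.twistInv (sndLegOp (Q.leftInvOp 𝒜) (𝒜 ⊗[k] W))
        (shiftOp 𝒜 (sndLegOp (Q.leftInvOp 𝒜) W))).unop n) := by
    intro n
    rw [twistedMulOp, LinearMap.lTensor_comp, LinearMap.comp_apply]
    exact congrArg _ (DFunLike.congr_fun (congrArg unop (DFunLike.congr_fun
      (shiftOp_joint (M := 𝒜) (fstLegOp (Q.leftInvOp 𝒜) W) (sndLegOp (Q.leftInvOp 𝒜) W))
      (Ring.inverse Q.drinfeldTwist))) n)
  rw [twistedMulOp_apply, h₁₂, twistedMulOp_apply, twistedMulOp_apply, h₂₃, hl,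
    merge_merge_op W h𝒜]
  simp only [← Module.End.mul_apply, ← unop_mul]
  congr 4
  rw [mul_assoc]
  exact Q.twistInv_defect _ _ _ _ _ _

end TwistedMulOp

end QuasiHopfAlgebra
end QuasiHopf

namespace QuasiHopf

open MulOpposite QuasiHopfAlgebra

section Collect

variable {k H A R : Type*} [Field k] [Ring H] [Algebra k H] [Ring A] [Algebra k A] [Ring R]
  [Algebra k R]

/-- Moving the values of `s` to the right of those of the maps commuting with it. -/
theorem collect_left (a₁ a₂ : H →ₐ[k] R) (s : A →ₐ[k] R) (c₂ c₁ : H →ₐ[k] R) [AlgCommute a₁ s]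
    [AlgCommute a₂ s] [AlgCommute s c₂] [AlgCommute s c₁] (h₁ h₂ h₄ h₅ p q : H) (x y z : A) :
    s z * (a₂ p * (s y * c₂ q) * (a₁ h₁ * (a₂ h₂ * (s x * (c₂ h₄ * c₁ h₅))))) =
      a₂ p * (c₂ q * (a₁ h₁ * (a₂ h₂ * (c₂ h₄ * c₁ h₅)))) * s (z * (y * x)) := by
  have e₁ : ∀ h w r, s w * (a₁ h * r) = a₁ h * (s w * r) :=
    fun h w r => (AlgCommute.comm (a := a₁) (b := s) h w).symm.left_comm r
  have e₂ : ∀ h w r, s w * (a₂ h * r) = a₂ h * (s w * r) :=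
    fun h w r => (AlgCommute.comm (a := a₂) (b := s) h w).symm.left_comm r
  have e₃ : ∀ h w r, s w * (c₂ h * r) = c₂ h * (s w * r) :=
    fun h w r => (AlgCommute.comm (a := s) (b := c₂) w h).left_comm r
  have e₄ : ∀ h w r, s w * (c₁ h * r) = c₁ h * (s w * r) :=
    fun h w r => (AlgCommute.comm (a := s) (b := c₁) w h).left_comm r
  have e₅ : ∀ h w, s w * c₁ h = c₁ h * s w :=
    fun h w => AlgCommute.comm (a := s) (b := c₁) w h
  simp only [mul_assoc, map_mul, e₁, e₂, e₃, e₄, e₅]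

theorem joint_assoc_tmul_one {X Y Z : Type*} [Ring X] [Algebra k X] [Ring Y] [Algebra k Y]
    [Ring Z] [Algebra k Z] (a : X →ₐ[k] R) (b : Y →ₐ[k] R) (c : Z →ₐ[k] R) [AlgCommute a b]
    [AlgCommute a c] [AlgCommute b c] (t : X ⊗[k] Y) :
    joint a (joint b c) (TensorProduct.assoc k X Y Z (t ⊗ₜ 1)) = joint a b t :=
  (joint_assoc_tmul a b c t 1).trans (by rw [map_one, mul_one])

end Collect

section Shift

variable {k H A : Type*} [Field k] [Ring H] [Algebra k H] [Ring A] [Algebra k A]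
  (C : TwoSidedData k H A) {M W : Type*} [AddCommGroup M] [Module k M] [AddCommGroup W] [Module k W]
  (a b : H →ₐ[k] (Module.End k W)ᵐᵒᵖ) (u : A →ₐ[k] (Module.End k W)ᵐᵒᵖ)
  (d e : H →ₐ[k] (Module.End k W)ᵐᵒᵖ)
  [AlgCommute a b] [AlgCommute a u] [AlgCommute a d] [AlgCommute a e] [AlgCommute b u]
  [AlgCommute b d] [AlgCommute b e] [AlgCommute u d] [AlgCommute u e] [AlgCommute d e]

theorem unop_psi_shiftOp :
    (C.psi (shiftOp M a) (shiftOp M b) (shiftOp M u) (shiftOp M d) (shiftOp M e)).unop =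
      (C.psi a b u d e).unop.lTensor M := by
  rw [TwoSidedData.psi, TwoSidedData.psi, ← unop_shiftOp]
  simp only [shiftOp_joint]

theorem shiftOp_star :
    shiftOp M (C.star a u d) = C.star (shiftOp M a) (shiftOp M u) (shiftOp M d) := by
  rw [shiftOp_pull]
  simp only [shiftOp_joint]

end Shift

section One

variable {k H : Type*} [Field k] [Ring H] [Algebra k H] {Q : QuasiHopfAlgebra k H}
  {𝒜 : Type*} [NonAssocRing 𝒜] [Module k 𝒜]

theorem carriesOp_one_shift {X W : Type*} [Ring X] [Algebra k X] [AddCommGroup W] [Module k W]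
    (g : X →ₐ[k] (Module.End k W)ᵐᵒᵖ) : CarriesOp (TensorProduct.mk k 𝒜 W 1) g (shiftOp 𝒜 g) :=
  fun _ _ => rfl

theorem unop_unitHom_apply {W : Type*} [AddCommGroup W] [Module k W] (ε : H →ₐ[k] k) (h : H)
    (w : W) : (unitHom ε (Module.End k W)ᵐᵒᵖ h).unop w = ε h • w := rfl

variable [SMulCommClass k 𝒜 𝒜] [IsScalarTower k 𝒜 𝒜]
  [Module H 𝒜] [IsScalarTower k H 𝒜] [Module Hᵐᵒᵖ 𝒜] [IsScalarTower k Hᵐᵒᵖ 𝒜]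

theorem carriesOp_one_leftInvOp (h𝒜 : IsBimoduleAlgebra Q.toQuasiBialgebra 𝒜) (W : Type*)
    [AddCommGroup W] [Module k W] :
    CarriesOp (TensorProduct.mk k 𝒜 W 1) (unitHom Q.counit _) (firstOp W (Q.leftInvOp 𝒜)) := by
  intro h n
  have : Q.counit (Q.antipodeInv h) = Q.counit h := by
    rw [← Q.counit_antipode, Q.antipode_antipodeInv]
  simp [unop_unitHom_apply, h𝒜.smul_one, TensorProduct.smul_tmul', this]

theorem carriesOp_one_rightOp (h𝒜 : IsBimoduleAlgebra Q.toQuasiBialgebra 𝒜) (W : Type*)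
    [AddCommGroup W] [Module k W] :
    CarriesOp (TensorProduct.mk k 𝒜 W 1) (unitHom Q.counit _) (firstOp W (rightOp k H 𝒜)) := by
  intro h n
  simp [unop_unitHom_apply, h𝒜.op_smul_one, TensorProduct.smul_tmul']

end One

section RightCrossed

variable {k H A : Type*} [Field k] [Ring H] [Algebra k H] [Ring A] [Algebra k A]
  {Q : QuasiHopfAlgebra k H} {C : TwoSidedData k H A}
  {𝒜 : Type*} [NonAssocRing 𝒜] [Module k 𝒜] [SMulCommClass k 𝒜 𝒜] [IsScalarTower k 𝒜 𝒜]
  [Module H 𝒜] [IsScalarTower k H 𝒜] [Module Hᵐᵒᵖ 𝒜] [IsScalarTower k Hᵐᵒᵖ 𝒜]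

variable (𝒜 Q C) in
/-- The multiplication of the right crossed product, with the factors of `A ⊗ 𝒜` and the
arguments interchanged. -/
noncomputable def rightCrossedFlip : 𝒜 ⊗[k] A →ₗ[k] 𝒜 ⊗[k] A →ₗ[k] 𝒜 ⊗[k] A :=
  ((rightCrossedMul 𝒜 Q C).flip.compl₁₂ (TensorProduct.comm k 𝒜 A).toLinearMap
    (TensorProduct.comm k 𝒜 A).toLinearMap).compr₂ (TensorProduct.comm k A 𝒜).toLinearMap

theorem rightCrossedFlip_apply (d n : 𝒜 ⊗[k] A) : rightCrossedFlip Q C 𝒜 d n =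
    TensorProduct.comm k A 𝒜 (rightCrossedMul 𝒜 Q C (TensorProduct.comm k 𝒜 A n)
      (TensorProduct.comm k 𝒜 A d)) := rfl

theorem rightCrossedMul_eq (x y : A ⊗[k] 𝒜) : rightCrossedMul 𝒜 Q C x y =
    TensorProduct.comm k 𝒜 A (rightCrossedFlip Q C 𝒜 (TensorProduct.comm k A 𝒜 y)
      (TensorProduct.comm k A 𝒜 x)) := by
  simp [rightCrossedFlip_apply]

variable [SMulCommClass H Hᵐᵒᵖ 𝒜]

theorem rightEval_absorb (G : H ⊗[k] (H ⊗[k] (A ⊗[k] (H ⊗[k] H)))) (t : H ⊗[k] (A ⊗[k] H))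
    (φ φ' : 𝒜) (x : A) :
    TensorProduct.comm k A 𝒜 ((LinearMap.mul k A x).rTensor 𝒜 (rightEval 𝒜 (Q.absorb'
        (TensorProduct.map Q.antipodeInv (TensorProduct.map Q.antipodeInv LinearMap.id) G) t)
        (φ ⊗ₜ φ'))) =
      merge (mulFlip k 𝒜) A
        ((joint (sndLegOp (Q.leftInvOp 𝒜) A) (joint (shiftOp 𝒜 (shiftOp 𝒜 (rightOp k A A)))
            (sndLegOp (rightOp k H 𝒜) A)) t *
          joint (fstLegOp (Q.leftInvOp 𝒜) A) (joint (sndLegOp (Q.leftInvOp 𝒜) A)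
            (joint (shiftOp 𝒜 (shiftOp 𝒜 (rightOp k A A)))
              (joint (sndLegOp (rightOp k H 𝒜) A) (fstLegOp (rightOp k H 𝒜) A)))) G).unop
            (φ' ⊗ₜ (φ ⊗ₜ x))) := by
  have hS : ∀ x y, Q.antipodeInv (x * y) = Q.antipodeInv y * Q.antipodeInv x := by
    intro x y
    simp [antiAutInvLin]
  induction G using tensor_induction₅ with
  | add s t hs ht =>
    simp only [map_add, mul_add, LinearMap.add_apply, hs, ht, unop_add]
  | tmul h₁ h₂ a h₄ h₅ =>
    induction t using tensor_induction₃ with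
    | add s t hs ht => simp only [map_add, add_mul, LinearMap.add_apply, hs, ht, unop_add]
    | tmul p b q =>
      simp only [TensorProduct.map_tmul, LinearMap.id_apply]
      rw [absorb'_tmul, rightEval_tmul]
      simp [mul_smul, smul_comm, mul_assoc]

/-- The product with `φ' ⊗ x`, in terms of operators. -/
theorem rightCrossedFlip_tmul_apply (φ' : 𝒜) (x : A) (n : 𝒜 ⊗[k] A) :
    rightCrossedFlip Q C 𝒜 (φ' ⊗ₜ x) n = Q.twistedMulOp 𝒜 A
      ((C.psi (fstLegOp (Q.leftInvOp 𝒜) A) (sndLegOp (Q.leftInvOp 𝒜) A)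
        (shiftOp 𝒜 (shiftOp 𝒜 (rightOp k A A))) (sndLegOp (rightOp k H 𝒜) A)
        (fstLegOp (rightOp k H 𝒜) A)).unop
        ((C.star (sndLegOp (Q.leftInvOp 𝒜) A) (shiftOp 𝒜 (shiftOp 𝒜 (rightOp k A A)))
          (sndLegOp (rightOp k H 𝒜) A) x).unop (φ' ⊗ₜ n))) := by
  induction n using TensorProduct.induction_on with
  | zero => simp
  | add s t hs ht => simp only [map_add, TensorProduct.tmul_add, hs, ht]
  | tmul φ y =>
    rw [rightCrossedFlip_apply, TensorProduct.comm_tmul, TensorProduct.comm_tmul,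
      rightCrossedMul_tmul, omega', rightEval_absorb, map_mul,
      joint_assoc_tmul_one (fstLegOp (Q.leftInvOp 𝒜) A) (sndLegOp (Q.leftInvOp 𝒜) A), ← mul_assoc]
    rfl

theorem rightCrossedFlip_twistedMulOp (φ φ' : 𝒜) (y : A) (n : 𝒜 ⊗[k] A) :
    rightCrossedFlip Q C 𝒜 (Q.twistedMulOp 𝒜 A (φ ⊗ₜ (φ' ⊗ₜ y))) n = Q.twistedMulOp 𝒜 A
      ((C.psi (fstLegOp (Q.leftInvOp 𝒜) A) (sndLegOp (Q.leftInvOp 𝒜) A)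
        (shiftOp 𝒜 (shiftOp 𝒜 (rightOp k A A))) (sndLegOp (rightOp k H 𝒜) A)
        (fstLegOp (rightOp k H 𝒜) A)).unop
        ((C.star (sndLegOp (Q.leftInvOp 𝒜) A) (shiftOp 𝒜 (shiftOp 𝒜 (rightOp k A A)))
          (sndLegOp (rightOp k H 𝒜) A) y).unop
            (Q.twistedMulOp 𝒜 (𝒜 ⊗[k] A) (φ ⊗ₜ (φ' ⊗ₜ n))))) := by
  rw [twistedMulOp_apply, twistedMulOp_apply _ _ (𝒜 ⊗[k] A)]
  unfold twistInv
  generalize Ring.inverse Q.drinfeldTwist = t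
  induction t using TensorProduct.induction_on with
  | zero => simp
  | add s t hs ht => simp only [map_add, unop_add, LinearMap.add_apply, hs, ht]
  | tmul p q => simp [rightCrossedFlip_tmul_apply]

/-- The product with the product of `φ' ⊗ y` and `φ ⊗ x`, in terms of operators. -/
theorem rightCrossedFlip_rightCrossedFlip (φ φ' : 𝒜) (x y : A) (n : 𝒜 ⊗[k] A) :
    rightCrossedFlip Q C 𝒜 (rightCrossedFlip Q C 𝒜 (φ ⊗ₜ x) (φ' ⊗ₜ y)) n = Q.twistedMulOp 𝒜 A
      ((C.psi (fstLegOp (Q.leftInvOp 𝒜) A) (sndLegOp (Q.leftInvOp 𝒜) A)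
        (shiftOp 𝒜 (shiftOp 𝒜 (rightOp k A A))) (sndLegOp (rightOp k H 𝒜) A)
        (fstLegOp (rightOp k H 𝒜) A)).unop (Q.twistedMulOp 𝒜 (𝒜 ⊗[k] A)
          ((C.star (shiftOp 𝒜 (sndLegOp (Q.leftInvOp 𝒜) A))
              (shiftOp 𝒜 (shiftOp 𝒜 (shiftOp 𝒜 (rightOp k A A))))
              (shiftOp 𝒜 (sndLegOp (rightOp k H 𝒜) A)) y *
            (C.star (sndLegOp (Q.leftInvOp 𝒜) (𝒜 ⊗[k] A))
              (C.star (shiftOp 𝒜 (sndLegOp (Q.leftInvOp 𝒜) A))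
                (shiftOp 𝒜 (shiftOp 𝒜 (shiftOp 𝒜 (rightOp k A A))))
                (shiftOp 𝒜 (sndLegOp (rightOp k H 𝒜) A)))
              (sndLegOp (rightOp k H 𝒜) (𝒜 ⊗[k] A)) x *
            C.psi (fstLegOp (Q.leftInvOp 𝒜) (𝒜 ⊗[k] A)) (sndLegOp (Q.leftInvOp 𝒜) (𝒜 ⊗[k] A))
              (C.star (shiftOp 𝒜 (sndLegOp (Q.leftInvOp 𝒜) A))
                (shiftOp 𝒜 (shiftOp 𝒜 (shiftOp 𝒜 (rightOp k A A))))
                (shiftOp 𝒜 (sndLegOp (rightOp k H 𝒜) A)))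
              (sndLegOp (rightOp k H 𝒜) (𝒜 ⊗[k] A))
              (fstLegOp (rightOp k H 𝒜) (𝒜 ⊗[k] A)))).unop (φ ⊗ₜ (φ' ⊗ₜ n))))) := by
  have hs : ∀ w n, (C.star (sndLegOp (Q.leftInvOp 𝒜) A) (shiftOp 𝒜 (shiftOp 𝒜 (rightOp k A A)))
      (sndLegOp (rightOp k H 𝒜) A) w).unop (Q.twistedMulOp 𝒜 (𝒜 ⊗[k] A) n) =
        Q.twistedMulOp 𝒜 (𝒜 ⊗[k] A)
        ((C.star (shiftOp 𝒜 (sndLegOp (Q.leftInvOp 𝒜) A))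
          (shiftOp 𝒜 (shiftOp 𝒜 (shiftOp 𝒜 (rightOp k A A))))
          (shiftOp 𝒜 (sndLegOp (rightOp k H 𝒜) A)) w).unop n) :=
    (Q.carriesOp_twistedMulOp_shift 𝒜 (𝒜 ⊗[k] A) _).pull
      ((Q.carriesOp_twistedMulOp_shift 𝒜 _ _).joint (Q.carriesOp_twistedMulOp_shift 𝒜 _ _)) C.δ
  -- By linearity, `Ψ` and `δ(x)` may be replaced by arbitrary tensors.
  have key : ∀ (G : H ⊗[k] (H ⊗[k] (A ⊗[k] (H ⊗[k] H)))) (t : H ⊗[k] (A ⊗[k] H)),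
      rightCrossedFlip Q C 𝒜 (Q.twistedMulOp 𝒜 A
        ((joint (sndLegOp (Q.leftInvOp 𝒜) A) (joint (shiftOp 𝒜 (shiftOp 𝒜 (rightOp k A A)))
            (sndLegOp (rightOp k H 𝒜) A)) t *
          joint (fstLegOp (Q.leftInvOp 𝒜) A) (joint (sndLegOp (Q.leftInvOp 𝒜) A)
            (joint (shiftOp 𝒜 (shiftOp 𝒜 (rightOp k A A)))
              (joint (sndLegOp (rightOp k H 𝒜) A) (fstLegOp (rightOp k H 𝒜) A)))) G).unop
                (φ ⊗ₜ (φ' ⊗ₜ y)))) n = Q.twistedMulOp 𝒜 A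
      ((C.psi (fstLegOp (Q.leftInvOp 𝒜) A) (sndLegOp (Q.leftInvOp 𝒜) A)
        (shiftOp 𝒜 (shiftOp 𝒜 (rightOp k A A))) (sndLegOp (rightOp k H 𝒜) A)
        (fstLegOp (rightOp k H 𝒜) A)).unop (Q.twistedMulOp 𝒜 (𝒜 ⊗[k] A)
          ((C.star (shiftOp 𝒜 (sndLegOp (Q.leftInvOp 𝒜) A))
              (shiftOp 𝒜 (shiftOp 𝒜 (shiftOp 𝒜 (rightOp k A A))))
              (shiftOp 𝒜 (sndLegOp (rightOp k H 𝒜) A)) y *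
            (joint (sndLegOp (Q.leftInvOp 𝒜) (𝒜 ⊗[k] A))
              (joint (C.star (shiftOp 𝒜 (sndLegOp (Q.leftInvOp 𝒜) A))
                (shiftOp 𝒜 (shiftOp 𝒜 (shiftOp 𝒜 (rightOp k A A))))
                (shiftOp 𝒜 (sndLegOp (rightOp k H 𝒜) A)))
              (sndLegOp (rightOp k H 𝒜) (𝒜 ⊗[k] A))) t *
            joint (fstLegOp (Q.leftInvOp 𝒜) (𝒜 ⊗[k] A))
              (joint (sndLegOp (Q.leftInvOp 𝒜) (𝒜 ⊗[k] A))
              (joint (C.star (shiftOp 𝒜 (sndLegOp (Q.leftInvOp 𝒜) A))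
                (shiftOp 𝒜 (shiftOp 𝒜 (shiftOp 𝒜 (rightOp k A A))))
                (shiftOp 𝒜 (sndLegOp (rightOp k H 𝒜) A)))
              (joint (sndLegOp (rightOp k H 𝒜) (𝒜 ⊗[k] A))
                (fstLegOp (rightOp k H 𝒜) (𝒜 ⊗[k] A))))) G)).unop (φ ⊗ₜ (φ' ⊗ₜ n))))) := by
    intro G t
    induction G using tensor_induction₅ with
    | add s t hs ht => simp only [map_add, mul_add, unop_add, LinearMap.add_apply, hs, ht]
    | tmul h₁ h₂ a h₄ h₅ =>
      induction t using tensor_induction₃ with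
      | add s t hs ht =>
          simp only [map_add, mul_add, add_mul, unop_add, LinearMap.add_apply, hs, ht]
      | tmul p b q =>
        simp only [joint_tmul]
        rw [collect_left]
        simp only [unop_mul, Module.End.mul_apply, fstLegOp, sndLegOp, firstOp_tmul, shiftOp_tmul]
        rw [rightCrossedFlip_twistedMulOp, hs]
        simp [mul_assoc]
  rw [rightCrossedFlip_tmul_apply φ x, ← Module.End.mul_apply, ← unop_mul]
  exact key _ _

theorem rightCrossedFlip_assoc (h𝒜 : IsBimoduleAlgebra Q.toQuasiBialgebra 𝒜)
    (hC : IsTwoSidedCoaction Q.toQuasiBialgebra C) (d e n : 𝒜 ⊗[k] A) :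
    rightCrossedFlip Q C 𝒜 (rightCrossedFlip Q C 𝒜 d e) n =
      rightCrossedFlip Q C 𝒜 d (rightCrossedFlip Q C 𝒜 e n) := by
  induction d using TensorProduct.induction_on with
  | zero => simp
  | add s t hs ht => simp only [map_add, LinearMap.add_apply, hs, ht]
  | tmul φ x =>
  induction e using TensorProduct.induction_on with
  | zero => simp
  | add s t hs ht => simp only [map_add, LinearMap.add_apply, hs, ht]
  | tmul φ' y =>
  have hr := (carriesOp_twistedMulOp_leftInvOp A h𝒜).shift (M := 𝒜)
  have hl := (carriesOp_twistedMulOp_rightOp A h𝒜).shift (M := 𝒜)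
  rw [shiftOp_pull] at hr hl
  rw [rightCrossedFlip_rightCrossedFlip, crossed_assoc_op hC _ _ _ _ _ _ _ _ _ _ _ _
    (carriesOp_twistedMulOp_leftInvOp (𝒜 ⊗[k] A) h𝒜) (Q.carriesOp_twistedMulOp_shift 𝒜 _ _)
    (Q.carriesOp_twistedMulOp_shift 𝒜 _ _) (Q.carriesOp_twistedMulOp_shift 𝒜 _ _)
    (carriesOp_twistedMulOp_rightOp (𝒜 ⊗[k] A) h𝒜) (carriesOp_first (Q.twistedMulOp 𝒜 A) _) hr
    (Q.carriesOp_twistedMulOp_shift 𝒜 A _).shift hl (carriesOp_first (Q.twistedMulOp 𝒜 A) _)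
    (twistedMulOp_twistedMulOp A h𝒜)]
  rw [rightCrossedFlip_tmul_apply φ' y, rightCrossedFlip_tmul_apply φ x, unop_mul, unop_psi_shiftOp,
    ← shiftOp_star C (sndLegOp (Q.leftInvOp 𝒜) A) (shiftOp 𝒜 (shiftOp 𝒜 (rightOp k A A)))
      (sndLegOp (rightOp k H 𝒜) A)]
  rfl

theorem rightCrossedFlip_one (h𝒜 : IsBimoduleAlgebra Q.toQuasiBialgebra 𝒜)
    (hC : IsTwoSidedCoaction Q.toQuasiBialgebra C) (n : 𝒜 ⊗[k] A) :
    rightCrossedFlip Q C 𝒜 (1 ⊗ₜ 1) n = n := by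
  have h₁ : ∀ n, (C.psi (fstLegOp (Q.leftInvOp 𝒜) A) (sndLegOp (Q.leftInvOp 𝒜) A)
      (shiftOp 𝒜 (shiftOp 𝒜 (rightOp k A A))) (sndLegOp (rightOp k H 𝒜) A)
      (fstLegOp (rightOp k H 𝒜) A)).unop ((1 : 𝒜) ⊗ₜ n) =
        (1 : 𝒜) ⊗ₜ (C.psi (unitHom Q.counit _)
        (firstOp A (Q.leftInvOp 𝒜)) (shiftOp 𝒜 (rightOp k A A)) (firstOp A (rightOp k H 𝒜))
        (unitHom Q.counit _)).unop n :=
    ((carriesOp_one_leftInvOp h𝒜 _).joint ((carriesOp_one_shift _).joint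
      ((carriesOp_one_shift _).joint
        ((carriesOp_one_shift _).joint (carriesOp_one_rightOp h𝒜 _))))) _
  have h₂ : ∀ n, (Q.twistInv (fstLegOp (Q.leftInvOp 𝒜) A) (sndLegOp (Q.leftInvOp 𝒜) A)).unop
      ((1 : 𝒜) ⊗ₜ n) =
      (1 : 𝒜) ⊗ₜ (Q.twistInv (unitHom Q.counit _) (firstOp A (Q.leftInvOp 𝒜))).unop n :=
    ((carriesOp_one_leftInvOp h𝒜 _).joint (carriesOp_one_shift _)) _
  rw [rightCrossedFlip_tmul_apply, map_one, unop_one, Module.End.one_apply, h₁,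
    TwoSidedData.psi_unit_outer _ _ _ hC, unop_one, Module.End.one_apply, twistedMulOp_apply, h₂,
    twistInv_unit_left, unop_one, Module.End.one_apply]
  induction n using TensorProduct.induction_on with
  | zero => simp
  | tmul φ x => simp
  | add s t hs ht => simp only [TensorProduct.tmul_add, map_add, hs, ht]

theorem rightCrossedFlip_tmul_one (h𝒜 : IsBimoduleAlgebra Q.toQuasiBialgebra 𝒜)
    (hC : IsTwoSidedCoaction Q.toQuasiBialgebra C) (φ : 𝒜) (x y : A) :
    rightCrossedFlip Q C 𝒜 (φ ⊗ₜ x) (1 ⊗ₜ y) = φ ⊗ₜ (y * x) := by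
  have h₃ := carriesOp_first (TensorProduct.mk k 𝒜 A 1) (Q.leftInvOp 𝒜)
  have h₄ := (carriesOp_one_leftInvOp h𝒜 A).shift (M := 𝒜)
  have h₅ := (carriesOp_one_shift (𝒜 := 𝒜) (rightOp k A A)).shift (M := 𝒜)
  have h₆ := (carriesOp_one_rightOp h𝒜 A).shift (M := 𝒜)
  have h₇ := carriesOp_first (TensorProduct.mk k 𝒜 A 1) (rightOp k H 𝒜)
  rw [shiftOp_unitHom] at h₄ h₆
  have h₁ : ∀ n, (C.psi (fstLegOp (Q.leftInvOp 𝒜) A) (sndLegOp (Q.leftInvOp 𝒜) A)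
      (shiftOp 𝒜 (shiftOp 𝒜 (rightOp k A A))) (sndLegOp (rightOp k H 𝒜) A)
      (fstLegOp (rightOp k H 𝒜) A)).unop ((TensorProduct.mk k 𝒜 A 1).lTensor 𝒜 n) =
        (TensorProduct.mk k 𝒜 A 1).lTensor 𝒜 ((C.psi
          (firstOp A (Q.leftInvOp 𝒜)) (unitHom Q.counit _) (shiftOp 𝒜 (rightOp k A A))
          (unitHom Q.counit _) (firstOp A (rightOp k H 𝒜))).unop n) :=
    (h₃.joint (h₄.joint (h₅.joint (h₆.joint h₇)))) _
  have h₂ : ∀ n, (Q.twistInv (fstLegOp (Q.leftInvOp 𝒜) A) (sndLegOp (Q.leftInvOp 𝒜) A)).unop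
      ((TensorProduct.mk k 𝒜 A 1).lTensor 𝒜 n) = (TensorProduct.mk k 𝒜 A 1).lTensor 𝒜
        ((Q.twistInv (firstOp A (Q.leftInvOp 𝒜)) (unitHom Q.counit _)).unop n) :=
    (h₃.joint h₄) _
  have h₈ : ∀ n, (C.star (sndLegOp (Q.leftInvOp 𝒜) A) (shiftOp 𝒜 (shiftOp 𝒜 (rightOp k A A)))
      (sndLegOp (rightOp k H 𝒜) A) x).unop ((TensorProduct.mk k 𝒜 A 1).lTensor 𝒜 n) =
        (TensorProduct.mk k 𝒜 A 1).lTensor 𝒜 ((C.star (unitHom Q.counit _)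
          (shiftOp 𝒜 (rightOp k A A)) (unitHom Q.counit _) x).unop n) :=
    (h₄.pull (h₅.joint h₆) C.δ) _
  have e : φ ⊗ₜ[k] ((1 : 𝒜) ⊗ₜ[k] y) = (TensorProduct.mk k 𝒜 A 1).lTensor 𝒜 (φ ⊗ₜ y) := rfl
  rw [rightCrossedFlip_tmul_apply, e, h₈, h₁, TwoSidedData.psi_unit_inner _ _ _ hC,
    TwoSidedData.star_unit _ hC, unop_one, Module.End.one_apply, twistedMulOp_apply, h₂,
    twistInv_unit_right, unop_one, Module.End.one_apply]
  simp

theorem rightCrossedIsAlgebra (h𝒜 : IsBimoduleAlgebra Q.toQuasiBialgebra 𝒜)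
    (hC : IsTwoSidedCoaction Q.toQuasiBialgebra C) : RightCrossedIsAlgebra 𝒜 Q C where
  left :=
    { assoc := fun x y z => by
        simp only [rightCrossedMul_eq, TensorProduct.comm_comm, rightCrossedFlip_assoc h𝒜 hC]
      one_mul := fun x => by
        rw [rightCrossedMul_eq, TensorProduct.comm_tmul]
        induction x using TensorProduct.induction_on with
        | zero => simp
        | tmul x φ => rw [TensorProduct.comm_tmul, rightCrossedFlip_tmul_one h𝒜 hC, one_mul,
            TensorProduct.comm_tmul]
        | add s t hs ht => simp only [map_add, LinearMap.add_apply, hs, ht]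
      mul_one := fun x => by
        rw [rightCrossedMul_eq, TensorProduct.comm_tmul, rightCrossedFlip_one h𝒜 hC,
          TensorProduct.comm_comm] }
  right :=
    { map_one := rfl
      map_mul := fun x y => by
        simp [rightCrossedMul_eq, rightCrossedFlip_tmul_one h𝒜 hC] }

end RightCrossed

end QuasiHopf

namespace QuasiHopf

/-! ### Bicomodule algebras -/

section Value

variable {k : Type*} [Field k] {X Y Z W R : Type*} [Ring X] [Algebra k X] [Ring Y] [Algebra k Y]
  [Ring Z] [Algebra k Z] [Ring W] [Algebra k W] [Ring R] [Algebra k R]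

/-- The value in `R` of an element of `X ⊗ Y ⊗ Z`, with legs mapped by `a`, `b`, `c`. It is taken on
units, so that the value of the inverse is that of `w⁻¹`. -/
noncomputable def legs (w : (X ⊗[k] (Y ⊗[k] Z))ˣ) (a : X →ₐ[k] R) (b : Y →ₐ[k] R) (c : Z →ₐ[k] R)
    [AlgCommute a b] [AlgCommute a c] [AlgCommute b c] : R :=
  joint a (joint b c) w.val

section

variable (w : (X ⊗[k] (Y ⊗[k] Z))ˣ) (a : X →ₐ[k] R) (b : Y →ₐ[k] R) (c : Z →ₐ[k] R)
  [AlgCommute a b] [AlgCommute a c] [AlgCommute b c]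

@[simp]
theorem legs_mul_inv : legs w a b c * legs w⁻¹ a b c = 1 := by
  rw [legs, legs, ← map_mul, Units.mul_inv, map_one]

@[simp]
theorem legs_inv_mul : legs w⁻¹ a b c * legs w a b c = 1 := by
  rw [legs, legs, ← map_mul, Units.inv_mul, map_one]

@[simp]
theorem legs_mul_inv_mul (r : R) : legs w a b c * (legs w⁻¹ a b c * r) = r := by
  rw [← mul_assoc, legs_mul_inv, one_mul]

@[simp]
theorem legs_inv_mul_mul (r : R) : legs w⁻¹ a b c * (legs w a b c * r) = r := by
  rw [← mul_assoc, legs_inv_mul, one_mul]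

variable {w a b c}

theorem Intertwines.legs_inv {p q : W →ₐ[k] R} (h : Intertwines (legs w a b c) p q) :
    Intertwines (legs w⁻¹ a b c) q p := by
  intro x
  rw [← mul_one (_ * _), ← legs_mul_inv w a b c, ← mul_assoc, mul_assoc (legs w⁻¹ a b c), ← h,
    legs_inv_mul_mul]

theorem Intertwines.mul_legs {a' : X →ₐ[k] R} {b' : Y →ₐ[k] R} {c' : Z →ₐ[k] R}
    [AlgCommute a' b'] [AlgCommute a' c'] [AlgCommute b' c'] {r : R} (ha : Intertwines r a a')
    (hb : Intertwines r b b') (hc : Intertwines r c c') :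
    r * legs w a b c = legs w a' b' c' * r :=
  ha.joint (hb.joint hc) _

theorem legs_intertwines_right (d : W →ₐ[k] R) [AlgCommute a d] [AlgCommute b d]
    [AlgCommute c d] : Intertwines (legs w a b c) d d :=
  intertwines_left (joint a (joint b c)) d _

theorem legs_intertwines_left (d : W →ₐ[k] R) [AlgCommute d a] [AlgCommute d b]
    [AlgCommute d c] : Intertwines (legs w a b c) d d :=
  intertwines_right d (joint a (joint b c)) _

theorem legs_inv_eq_one (h : legs w a b c = 1) : legs w⁻¹ a b c = 1 := by
  simpa [h] using legs_mul_inv w a b c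

end

end Value

namespace BicomoduleAlgebra

variable {k H A R : Type*} [Field k] [Ring H] [Algebra k H] [Ring A] [Algebra k A] [Ring R]
  [Algebra k R] {Q : QuasiBialgebra k H} (B : BicomoduleAlgebra Q A)

/-- The map `x ↦ a(x₍₋₁₎) u(x₍₀₎)` for the left coaction `λ`. -/
noncomputable abbrev lstar (a : H →ₐ[k] R) (u : A →ₐ[k] R) [AlgCommute a u] : A →ₐ[k] R :=
  pull B.lam a u

/-- The map `x ↦ u(x₍₀₎) d(x₍₁₎)` for the right coaction `ρ`. -/
noncomputable abbrev rstar (u : A →ₐ[k] R) (d : H →ₐ[k] R) [AlgCommute u d] : A →ₐ[k] R :=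
  pull B.ρ u d

section

variable (a b c : H →ₐ[k] R) (u : A →ₐ[k] R) (d e f : H →ₐ[k] R) [AlgCommute a b] [AlgCommute a c]
  [AlgCommute a u] [AlgCommute a d] [AlgCommute a e] [AlgCommute b c] [AlgCommute b u]
  [AlgCommute b d] [AlgCommute c u] [AlgCommute u d] [AlgCommute u e] [AlgCommute u f]
  [AlgCommute d e] [AlgCommute d f] [AlgCommute e f]

theorem lam_intertwines : Intertwines (legs B.Φlam a b u) (B.lstar (Q.star a b) u)
    (B.lstar a (B.lstar b u)) := by
  intro x
  have := congrArg (joint a (joint b u)) (B.lam_coassoc x)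
  simp only [map_mul] at this
  rw [joint_tensorId, joint_idTensor _ _ _ _ (fun z => (pull_apply B.lam b u z).symm)] at this
  exact this.symm

theorem ρ_intertwines : Intertwines (legs B.Φρ u d e) (B.rstar (B.rstar u d) e)
    (B.rstar u (Q.star d e)) := by
  intro x
  have := congrArg (joint u (joint d e)) (B.ρ_coassoc x)
  simp only [map_mul] at this
  rw [joint_tensorId, joint_idTensor _ _ _ _ (fun z => (pull_apply Q.comul d e z).symm)] at this
  exact this

theorem lamρ_intertwines : Intertwines (legs B.Φlamρ a u d) (B.rstar (B.lstar a u) d)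
    (B.lstar a (B.rstar u d)) := by
  intro x
  have := congrArg (joint a (joint u d)) (B.lamρ_comm x)
  simp only [map_mul] at this
  rw [joint_tensorId, joint_idTensor _ _ _ _ (fun z => (pull_apply B.ρ u d z).symm)] at this
  exact this

theorem lam_pentagon :
    legs B.Φlam b c u * legs B.Φlam a (Q.star b c) u * Q.phi a b c =
      legs B.Φlam a b (B.lstar c u) * legs B.Φlam (Q.star a b) c u := by
  have := congrArg (joint a (joint b (joint c u))) B.lam_cocycle
  simp only [map_mul] at this
  rwa [joint_oneTensor, joint_tensorOne₃, joint_tensorId,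
    joint_idTensor _ _ _ _ (fun z => joint_tensorId b c u Q.comul z),
    joint_idTensor _ _ _ _ (fun z => joint_idTensor _ _ _ _
      (fun z => (pull_apply B.lam c u z).symm) z)] at this

theorem ρ_pentagon :
    Q.phi d e f * legs B.Φρ u (Q.star d e) f * legs B.Φρ u d e =
      legs B.Φρ u d (Q.star e f) * legs B.Φρ (B.rstar u d) e f := by
  have := congrArg (joint u (joint d (joint e f))) B.ρ_cocycle
  simp only [map_mul] at this
  rwa [joint_oneTensor, joint_tensorOne₃, joint_tensorId,
    joint_idTensor _ _ _ _ (fun z => joint_tensorId d e f Q.comul z),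
    joint_idTensor _ _ _ _ (fun z => joint_idTensor _ _ _ _
      (fun z => (pull_apply Q.comul e f z).symm) z)] at this

theorem lamρ_pentagon_left :
    legs B.Φlamρ b u d * legs B.Φlamρ a (B.lstar b u) d * legs B.Φlam a b u =
      legs B.Φlam a b (B.rstar u d) * legs B.Φlamρ (Q.star a b) u d := by
  have := congrArg (joint a (joint b (joint u d))) B.lamρ_cocycle_left
  simp only [map_mul] at this
  rwa [joint_oneTensor, joint_tensorOne₃, joint_tensorId,
    joint_idTensor _ _ _ _ (fun z => joint_tensorId b u d B.lam z),
    joint_idTensor _ _ _ _ (fun z => joint_idTensor _ _ _ _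
      (fun z => (pull_apply B.ρ u d z).symm) z)] at this

theorem lamρ_pentagon_right :
    legs B.Φρ u d e * legs B.Φlamρ a (B.rstar u d) e * legs B.Φlamρ a u d =
      legs B.Φlamρ a u (Q.star d e) * legs B.Φρ (B.lstar a u) d e := by
  have := congrArg (joint a (joint u (joint d e))) B.lamρ_cocycle_right
  simp only [map_mul] at this
  rwa [joint_oneTensor, joint_tensorOne₃, joint_tensorId,
    joint_idTensor _ _ _ _ (fun z => joint_tensorId u d e B.ρ z),
    joint_idTensor _ _ _ _ (fun z => joint_idTensor _ _ _ _
      (fun z => (pull_apply Q.comul d e z).symm) z)] at this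

theorem unitHom_lstar : B.lstar (unitHom Q.counit R) u = u := by
  ext x
  rw [pull_apply, ← apply_counitLeft, B.lam_counit]

theorem rstar_unitHom : B.rstar u (unitHom Q.counit R) = u := by
  ext x
  rw [pull_apply, ← apply_counitRight, B.ρ_counit]

theorem lam_unit_mid : legs B.Φlam a (unitHom Q.counit R) u = 1 := by
  have := congrArg (joint a u) B.Φlam_normalized_mid
  rwa [joint_idTensor _ _ _ _ (apply_counitLeft Q.counit u), map_one] at this

theorem lam_unit_left : legs B.Φlam (unitHom Q.counit R) b u = 1 := by
  have := congrArg (joint b u) B.Φlam_normalized_left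
  rwa [apply_counitLeft, map_one] at this

theorem ρ_unit_mid : legs B.Φρ u (unitHom Q.counit R) e = 1 := by
  have := congrArg (joint u e) B.Φρ_normalized_mid
  rwa [joint_idTensor _ _ _ _ (apply_counitLeft Q.counit e), map_one] at this

theorem ρ_unit_right : legs B.Φρ u d (unitHom Q.counit R) = 1 := by
  have := congrArg (joint u d) B.Φρ_normalized_right
  rwa [joint_idTensor _ _ _ _ (apply_counitRight Q.counit d), map_one] at this

/-- The normalization of `Φ_{λ,ρ}` is not an axiom; it follows from the mixed pentagons. -/
theorem lamρ_unit_left : legs B.Φlamρ (unitHom Q.counit R) u d = 1 := by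
  have := B.lamρ_pentagon_left (unitHom Q.counit R) (unitHom Q.counit R) u d
  simp only [unitHom_lstar, Q.unitHom_star, lam_unit_left, mul_one, one_mul] at this
  simpa using congrArg (legs B.Φlamρ⁻¹ (unitHom Q.counit R) u d * ·) this

theorem lamρ_unit_right : legs B.Φlamρ a u (unitHom Q.counit R) = 1 := by
  have := B.lamρ_pentagon_right a u (unitHom Q.counit R) (unitHom Q.counit R)
  simp only [rstar_unitHom, Q.unitHom_star, ρ_unit_right, mul_one, one_mul] at this
  simpa using congrArg (legs B.Φlamρ⁻¹ a u (unitHom Q.counit R) * ·) this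

end

end BicomoduleAlgebra
end QuasiHopf

namespace QuasiHopf

namespace BicomoduleAlgebra

variable {k H A R : Type*} [Field k] [Ring H] [Algebra k H] [Ring A] [Algebra k A] [Ring R]
  [Algebra k R] {Q : QuasiBialgebra k H} (B : BicomoduleAlgebra Q A)

section

variable (a b : H →ₐ[k] R) (u : A →ₐ[k] R) (d e : H →ₐ[k] R) [AlgCommute a b]
  [AlgCommute a u] [AlgCommute a d] [AlgCommute a e] [AlgCommute b u]
  [AlgCommute b d] [AlgCommute b e] [AlgCommute u d] [AlgCommute u e] [AlgCommute d e]

theorem leftTwoSided_star : B.leftTwoSided.star a u d = B.rstar (B.lstar a u) d :=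
  AlgHom.ext fun x => joint_tensorId a u d B.lam (B.ρ x)

theorem rightTwoSided_star : B.rightTwoSided.star a u d = B.lstar a (B.rstar u d) :=
  AlgHom.ext fun x => joint_idTensor a _ (B.rstar u d) B.ρ (fun z => (pull_apply B.ρ u d z).symm)
    (B.lam x)

/-- The value of `Ψ_l`. -/
theorem leftTwoSided_psi : B.leftTwoSided.psi a b u d e =
    legs B.Φlamρ a (B.lstar b u) d * legs B.Φρ⁻¹ (B.lstar a (B.lstar b u)) d e *
      legs B.Φlam a b u := by
  change joint a (joint b (joint u (joint d e))) (idTensor H (tensorId B.lam (H ⊗[k] H))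
      (tensorOne₃ H A H H B.Φlamρ.val * tensorId B.lam (H ⊗[k] H) (B.Φρ⁻¹).val) *
    tensorOne₃ H H A (H ⊗[k] H) B.Φlam.val) = _
  rw [map_mul, joint_idTensor _ _ _ _ (joint_tensorId b u (joint d e) B.lam), map_mul,
    joint_tensorOne₃, joint_tensorOne₃, joint_tensorId]
  rfl

/-- The value of `Ψ_r`. -/
theorem rightTwoSided_psi : B.rightTwoSided.psi a b u d e =
    legs B.Φlamρ⁻¹ b (B.rstar u d) e * legs B.Φlam a b (B.rstar (B.rstar u d) e) *
      legs B.Φρ⁻¹ u d e := by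
  change joint a (joint b (joint u (joint d e))) (idTensor H (idTensor H (tensorId B.ρ H))
      (oneTensor H (B.Φlamρ⁻¹).val * idTensor H (idTensor H B.ρ) B.Φlam.val) *
    oneTensor H (oneTensor H (B.Φρ⁻¹).val)) = _
  rw [map_mul, joint_idTensor _ _ _ _ (joint_idTensor _ _ _ _ (joint_tensorId u d e B.ρ)), map_mul,
    joint_oneTensor, joint_oneTensor, joint_oneTensor,
    joint_idTensor _ _ _ _ (joint_idTensor _ _ _ _
      (fun z => (pull_apply B.ρ (B.rstar u d) e z).symm))]
  rfl

theorem leftTwoSided_intertwines :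
    Intertwines (B.leftTwoSided.psi a b u d e) (B.leftTwoSided.star (Q.star a b) u (Q.star d e))
      (B.leftTwoSided.star a (B.leftTwoSided.star b u d) e) := by
  simp only [leftTwoSided_star, leftTwoSided_psi]
  have h₁ := (B.lam_intertwines a b u).pull (legs_intertwines_right (Q.star d e)) B.ρ
  have h₂ := (B.ρ_intertwines (B.lstar a (B.lstar b u)) d e).legs_inv
  have h₃ := (B.lamρ_intertwines a (B.lstar b u) d).pull (legs_intertwines_right e) B.ρ
  rw [mul_assoc]
  exact (h₁.trans h₂).trans h₃

theorem rightTwoSided_intertwines :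
    Intertwines (B.rightTwoSided.psi a b u d e) (B.rightTwoSided.star (Q.star a b) u (Q.star d e))
      (B.rightTwoSided.star a (B.rightTwoSided.star b u d) e) := by
  simp only [rightTwoSided_star, rightTwoSided_psi]
  have h₁ := (legs_intertwines_left (w := B.Φρ⁻¹) (Q.star a b)).pull
    (B.ρ_intertwines u d e).legs_inv B.lam
  have h₂ := B.lam_intertwines a b (B.rstar (B.rstar u d) e)
  have h₃ := (legs_intertwines_left (w := B.Φlamρ⁻¹) a).pull
    (B.lamρ_intertwines b (B.rstar u d) e).legs_inv B.lam
  rw [mul_assoc]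
  exact (h₁.trans h₂).trans h₃

end

section

variable {M : Type*} [Monoid M]

/-- Brings the left-hand side of the cocycle condition to the normal form shared with
`cocycle_word_right`. For the left coaction `x`, `p`, `l` stand for values of `Φ_{λ,ρ}`, `Φ_ρ⁻¹`,
`Φ_λ`, for the right one for values of `Φ_{λ,ρ}⁻¹`, `Φ_λ`, `Φ_ρ⁻¹`. -/
theorem cocycle_word_left {x₁ x₂ x₂' x₃ x₄ p₁ p₂ p₂' p₃ p₄ p₅ l₁ l₂ l₃ l₄ φ ψ : M}
    (h₁ : l₁ * x₂ = x₂' * l₁) (h₂ : l₁ * p₂ = p₂' * l₁) (h₃ : l₁ * l₂ * φ = l₃ * l₄)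
    (h₄ : l₃ * l₄ * ψ = ψ * (l₃ * l₄)) (h₅ : p₁ * x₂' = x₃ * x₄ * p₃)
    (h₆ : p₃ * p₂' * ψ = p₄ * p₅) :
    x₁ * p₁ * l₁ * (x₂ * p₂ * l₂) * (φ * ψ) = x₁ * x₃ * x₄ * p₄ * p₅ * l₃ * l₄ :=
  calc x₁ * p₁ * l₁ * (x₂ * p₂ * l₂) * (φ * ψ) = x₁ * p₁ * (l₁ * x₂) * p₂ * l₂ * φ * ψ := by
        simp only [mul_assoc]
    _ = x₁ * p₁ * x₂' * (l₁ * p₂) * l₂ * φ * ψ := by rw [h₁]; simp only [mul_assoc]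
    _ = x₁ * p₁ * x₂' * p₂' * (l₁ * l₂ * φ) * ψ := by rw [h₂]; simp only [mul_assoc]
    _ = x₁ * p₁ * x₂' * p₂' * (l₃ * l₄ * ψ) := by rw [h₃]; simp only [mul_assoc]
    _ = x₁ * (p₁ * x₂') * p₂' * ψ * l₃ * l₄ := by rw [h₄]; simp only [mul_assoc]
    _ = x₁ * x₃ * x₄ * (p₃ * p₂' * ψ) * l₃ * l₄ := by rw [h₅]; simp only [mul_assoc]
    _ = _ := by rw [h₆]; simp only [mul_assoc]

/-- Brings the right-hand side of the cocycle condition to the normal form shared with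
`cocycle_word_left`. -/
theorem cocycle_word_right {x₁ x₃ x₄ x₅ x₆ p₄ p₅ p₆ p₇ p₈ l₃ l₄ l₅ : M}
    (h₁ : l₅ * x₆ = x₁ * x₄ * l₃) (h₂ : l₃ * p₇ = p₅ * l₃) (h₃ : x₁ * x₃ = x₅ * x₁)
    (h₄ : x₁ * p₈ = p₆ * x₁) (h₅ : x₄ * p₄ = p₈ * x₄) :
    x₅ * p₆ * l₅ * (x₆ * p₇ * l₄) = x₁ * x₃ * x₄ * p₄ * p₅ * l₃ * l₄ :=
  calc x₅ * p₆ * l₅ * (x₆ * p₇ * l₄) = x₅ * p₆ * (l₅ * x₆) * p₇ * l₄ := by simp only [mul_assoc]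
    _ = x₅ * (p₆ * x₁) * x₄ * (l₃ * p₇) * l₄ := by rw [h₁]; simp only [mul_assoc]
    _ = (x₅ * x₁) * (p₈ * x₄) * p₅ * l₃ * l₄ := by rw [← h₄, h₂]; simp only [mul_assoc]
    _ = _ := by rw [← h₃, ← h₅]; simp only [mul_assoc]

end

section

variable (a b c : H →ₐ[k] R) (u : A →ₐ[k] R) (d e f : H →ₐ[k] R) [AlgCommute a b] [AlgCommute a c]
  [AlgCommute a u] [AlgCommute a d] [AlgCommute a e] [AlgCommute a f]
  [AlgCommute b c] [AlgCommute b u] [AlgCommute b d] [AlgCommute b e] [AlgCommute b f]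
  [AlgCommute c u] [AlgCommute c d] [AlgCommute c e] [AlgCommute c f]
  [AlgCommute u d] [AlgCommute u e] [AlgCommute u f] [AlgCommute d e] [AlgCommute d f]
  [AlgCommute e f]

theorem ρ_inv_pentagon :
    legs B.Φρ⁻¹ u d e * legs B.Φρ⁻¹ u (Q.star d e) f * Q.phiInv d e f =
      legs B.Φρ⁻¹ (B.rstar u d) e f * legs B.Φρ⁻¹ u d (Q.star e f) := by
  refine left_inv_eq_right_inv
    (a := legs B.Φρ u d (Q.star e f) * legs B.Φρ (B.rstar u d) e f) ?_ ?_
  · rw [← B.ρ_pentagon]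
    simp [mul_assoc]
  · simp [mul_assoc]

set_option maxHeartbeats 400000 in
theorem leftTwoSided_cocycle :
    B.leftTwoSided.psi b c u d e * B.leftTwoSided.psi a (Q.star b c) u (Q.star d e) f *
      (Q.phi a b c * Q.phiInv d e f) =
    B.leftTwoSided.psi a b (B.leftTwoSided.star c u d) e f *
      B.leftTwoSided.psi (Q.star a b) c u d (Q.star e f) := by
  simp only [leftTwoSided_star, leftTwoSided_psi]
  have hl := B.lam_intertwines b c u
  have hl' := B.lam_intertwines a b (B.lstar c u)
  have hx := B.lamρ_intertwines b (B.lstar c u) d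
  have hx' := B.lamρ_intertwines a (B.lstar b (B.lstar c u)) d
  refine (cocycle_word_left (Intertwines.mul_legs (legs_intertwines_left a) hl
      (legs_intertwines_right (Q.star d e)))
    (Intertwines.mul_legs ((legs_intertwines_left a).pull hl B.lam)
      (legs_intertwines_right (Q.star d e)) (legs_intertwines_right f))
    (B.lam_pentagon a b c u) ?_ ?_ (B.ρ_inv_pentagon _ d e f)).trans
    (cocycle_word_right (B.lamρ_pentagon_left a b (B.lstar c u) d).symm
      (Intertwines.mul_legs hl' (legs_intertwines_right d) (legs_intertwines_right (Q.star e f)))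
      (Intertwines.mul_legs (legs_intertwines_left a) hx (legs_intertwines_right e))
      (Intertwines.mul_legs ((legs_intertwines_left a).pull hx B.lam) (legs_intertwines_right e)
        (legs_intertwines_right f))
      (Intertwines.mul_legs hx' (legs_intertwines_right e) (legs_intertwines_right f))).symm
  · exact Commute.mul_left (AlgCommute.comm (a := joint a (joint b (B.lstar c u)))
      (b := joint d (joint e f)) _ _)
      (AlgCommute.comm (a := joint (Q.star a b) (joint c u)) (b := joint d (joint e f)) _ _)
  · have h := B.lamρ_pentagon_right a (B.lstar b (B.lstar c u)) d e
    calc _ = legs B.Φρ⁻¹ (B.lstar b (B.lstar c u)) d e *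
          (legs B.Φlamρ a (B.lstar b (B.lstar c u)) (Q.star d e) *
            legs B.Φρ (B.lstar a (B.lstar b (B.lstar c u))) d e) *
            legs B.Φρ⁻¹ (B.lstar a (B.lstar b (B.lstar c u))) d e := by simp [mul_assoc]
      _ = _ := by
          rw [← h]
          simp [mul_assoc]

set_option maxHeartbeats 400000 in
theorem rightTwoSided_cocycle :
    B.rightTwoSided.psi b c u d e * B.rightTwoSided.psi a (Q.star b c) u (Q.star d e) f *
      (Q.phi a b c * Q.phiInv d e f) =
    B.rightTwoSided.psi a b (B.rightTwoSided.star c u d) e f *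
      B.rightTwoSided.psi (Q.star a b) c u d (Q.star e f) := by
  simp only [rightTwoSided_star, rightTwoSided_psi]
  have hr := (B.ρ_intertwines u d e).legs_inv
  have hr' := (B.ρ_intertwines (B.rstar u d) e f).legs_inv
  have hx := (B.lamρ_intertwines c (B.rstar u d) e).legs_inv
  have hx' := (B.lamρ_intertwines c (B.rstar (B.rstar u d) e) f).legs_inv
  have hφ : Q.phi a b c * Q.phiInv d e f = Q.phiInv d e f * Q.phi a b c :=
    AlgCommute.comm (a := joint a (joint b c)) (b := joint d (joint e f)) _ _
  rw [hφ]
  refine (cocycle_word_left (Intertwines.mul_legs (legs_intertwines_left (Q.star b c)) hr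
      (legs_intertwines_right f))
    (Intertwines.mul_legs (legs_intertwines_left a) (legs_intertwines_left (Q.star b c))
      (hr.pull (legs_intertwines_right f) B.ρ))
    (B.ρ_inv_pentagon u d e f) ?_ ?_ (B.lam_pentagon a b c _)).trans
    (cocycle_word_right ?_
      (Intertwines.mul_legs (legs_intertwines_left (Q.star a b)) (legs_intertwines_left c) hr')
      (Intertwines.mul_legs (legs_intertwines_left b) hx (legs_intertwines_right f))
      (Intertwines.mul_legs (legs_intertwines_left a) (legs_intertwines_left b)
        (hx.pull (legs_intertwines_right f) B.ρ))
      (Intertwines.mul_legs (legs_intertwines_left a) (legs_intertwines_left b) hx')).symm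
  · exact (Commute.mul_right (AlgCommute.comm (a := joint a (joint b c))
      (b := joint (B.rstar u d) (joint e f)) _ _)
      (AlgCommute.comm (a := joint a (joint b c)) (b := joint u (joint d (Q.star e f))) _ _)).symm
  · have h := B.lamρ_pentagon_left b c (B.rstar (B.rstar u d) e) f
    have h' : legs B.Φlam b c (B.rstar (B.rstar u d) e) =
        legs B.Φlamρ⁻¹ b (B.lstar c (B.rstar (B.rstar u d) e)) f *
          (legs B.Φlamρ⁻¹ c (B.rstar (B.rstar u d) e) f *
            (legs B.Φlam b c (B.rstar (B.rstar (B.rstar u d) e) f) *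
              legs B.Φlamρ (Q.star b c) (B.rstar (B.rstar u d) e) f)) := by
      rw [← h]
      simp [mul_assoc]
    rw [h']
    simp [mul_assoc]
  · have h := B.lamρ_pentagon_right c (B.rstar u d) e f
    have h' : legs B.Φlamρ⁻¹ c (B.rstar u d) e *
        (legs B.Φlamρ⁻¹ c (B.rstar (B.rstar u d) e) f * (legs B.Φρ⁻¹ (B.rstar u d) e f *
          (legs B.Φlamρ c (B.rstar u d) (Q.star e f) *
            legs B.Φρ (B.lstar c (B.rstar u d)) e f))) = 1 := by
      rw [← h]
      simp [mul_assoc]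
    refine (one_mul _).symm.trans ?_
    rw [← h']
    simp [mul_assoc]

end

end BicomoduleAlgebra
end QuasiHopf

namespace QuasiHopf

/-! ### The two-sided coactions of a bicomodule algebra -/

section Universal

variable {k : Type*} [Field k] {X Y X' Y' : Type*} [Ring X] [Algebra k X] [Ring Y] [Algebra k Y]
  [Ring X'] [Algebra k X'] [Ring Y'] [Algebra k Y']

theorem joint_inr_eq_inr (p : X →ₐ[k] Y') (q : Y →ₐ[k] Y') [AlgCommute p q] :
    joint (inr X' p) (inr X' q) = inr X' (joint p q) :=
  AlgHom.ext (joint_inr p q)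

theorem joint_inl_inr :
    joint (inl Y (AlgHom.id k X)) (inr X (AlgHom.id k Y)) = AlgHom.id k (X ⊗[k] Y) := by
  ext <;> simp

end Universal

namespace TwoSidedData

variable {k H A : Type*} [Field k] [Ring H] [Algebra k H] [Ring A] [Algebra k A]
  (C : TwoSidedData k H A) (Q : QuasiBialgebra k H)

/-- Coassociativity of a two-sided coaction holds if it holds for the inclusions of the tensor legs
of `H ⊗ H ⊗ A ⊗ H ⊗ H`. -/
theorem coassoc_of_intertwines
    (h : ∀ (a b : H →ₐ[k] H ⊗[k] (H ⊗[k] (A ⊗[k] (H ⊗[k] H))))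
      (u : A →ₐ[k] H ⊗[k] (H ⊗[k] (A ⊗[k] (H ⊗[k] H))))
      (d e : H →ₐ[k] H ⊗[k] (H ⊗[k] (A ⊗[k] (H ⊗[k] H))))
      [AlgCommute a b] [AlgCommute a u] [AlgCommute a d] [AlgCommute a e] [AlgCommute b u]
      [AlgCommute b d] [AlgCommute b e] [AlgCommute u d] [AlgCommute u e] [AlgCommute d e],
      Intertwines (C.psi a b u d e) (C.star (Q.star a b) u (Q.star d e))
        (C.star a (C.star b u d) e)) (x : A) :
    idTensor H (tensorId₃ C.δ H) (C.δ x) * C.Ψ.val =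
      C.Ψ.val * tensorId Q.comul (A ⊗[k] (H ⊗[k] H)) (idTensor H (idTensor A Q.comul) (C.δ x)) := by
  have := h (inl _ (AlgHom.id k H)) (inr _ (inl _ (AlgHom.id k H)))
    (inr _ (inr _ (inl _ (AlgHom.id k A)))) (inr _ (inr _ (inr _ (inl _ (AlgHom.id k H)))))
    (inr _ (inr _ (inr _ (inr _ (AlgHom.id k H))))) x
  rw [← joint_coassoc_left, ← joint_coassoc_right, psi] at this
  simp only [joint_inr_eq_inr, joint_inl_inr, AlgHom.id_apply] at this
  exact this.symm

set_option maxHeartbeats 800000 in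
/-- The cocycle condition of a two-sided coaction holds if it holds for the inclusions of the
tensor legs of `H ⊗ H ⊗ H ⊗ A ⊗ H ⊗ H ⊗ H`. -/
theorem cocycle_of_psi
    (h : ∀ (a b c : H →ₐ[k] H ⊗[k] (H ⊗[k] (H ⊗[k] (A ⊗[k] (H ⊗[k] (H ⊗[k] H))))))
      (u : A →ₐ[k] H ⊗[k] (H ⊗[k] (H ⊗[k] (A ⊗[k] (H ⊗[k] (H ⊗[k] H))))))
      (d e f : H →ₐ[k] H ⊗[k] (H ⊗[k] (H ⊗[k] (A ⊗[k] (H ⊗[k] (H ⊗[k] H))))))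
      [AlgCommute a b] [AlgCommute a c] [AlgCommute a u] [AlgCommute a d] [AlgCommute a e]
      [AlgCommute a f] [AlgCommute b c] [AlgCommute b u] [AlgCommute b d] [AlgCommute b e]
      [AlgCommute b f] [AlgCommute c u] [AlgCommute c d] [AlgCommute c e] [AlgCommute c f]
      [AlgCommute u d] [AlgCommute u e] [AlgCommute u f] [AlgCommute d e] [AlgCommute d f]
      [AlgCommute e f],
      C.psi b c u d e * C.psi a (Q.star b c) u (Q.star d e) f * (Q.phi a b c * Q.phiInv d e f) =
        C.psi a b (C.star c u d) e f * C.psi (Q.star a b) c u d (Q.star e f)) :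
    oneTensor H (tensorOne₅ H H A H H H C.Ψ.val) *
        idTensor H ((tensorId Q.comul (A ⊗[k] (H ⊗[k] (H ⊗[k] H)))).comp
          (idTensor H (idTensor A (tensorId Q.comul H)))) C.Ψ.val *
        (tensorOne₃ H H H (A ⊗[k] (H ⊗[k] (H ⊗[k] H))) Q.reassoc.val *
          oneTensor H (oneTensor H (oneTensor H (oneTensor A (Q.reassoc⁻¹).val)))) =
      idTensor H (idTensor H (tensorId₃ C.δ (H ⊗[k] H))) C.Ψ.val *
        tensorId Q.comul (H ⊗[k] (A ⊗[k] (H ⊗[k] (H ⊗[k] H))))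
          (idTensor H (idTensor H (idTensor A (idTensor H Q.comul))) C.Ψ.val) := by
  have := h (inl _ (AlgHom.id k H)) (inr _ (inl _ (AlgHom.id k H)))
    (inr _ (inr _ (inl _ (AlgHom.id k H)))) (inr _ (inr _ (inr _ (inl _ (AlgHom.id k A)))))
    (inr _ (inr _ (inr _ (inr _ (inl _ (AlgHom.id k H))))))
    (inr _ (inr _ (inr _ (inr _ (inr _ (inl _ (AlgHom.id k H)))))))
    (inr _ (inr _ (inr _ (inr _ (inr _ (inr _ (AlgHom.id k H)))))))
  rw [joint_cocycle_left, joint_cocycle_right] at this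
  simp only [joint_inr_eq_inr, joint_inl_inr, AlgHom.id_apply] at this
  exact this

theorem normalized_inner_of_psi
    (h : ∀ (a : H →ₐ[k] H ⊗[k] (A ⊗[k] H)) (u : A →ₐ[k] H ⊗[k] (A ⊗[k] H))
      (e : H →ₐ[k] H ⊗[k] (A ⊗[k] H)) [AlgCommute a u] [AlgCommute a e] [AlgCommute u e],
      C.psi a (unitHom Q.counit _) u (unitHom Q.counit _) e = 1) :
    idTensor H ((idTensor A (counitLeft Q.counit H)).comp
      (counitLeft Q.counit (A ⊗[k] (H ⊗[k] H)))) C.Ψ.val = 1 := by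
  have := h (inl _ (AlgHom.id k H)) (inr _ (inl _ (AlgHom.id k A))) (inr _ (inr _ (AlgHom.id k H)))
  rw [psi_inner] at this
  simpa only [joint_inr_eq_inr, joint_inl_inr, AlgHom.id_apply] using this

theorem normalized_outer_of_psi
    (h : ∀ (b : H →ₐ[k] H ⊗[k] (A ⊗[k] H)) (u : A →ₐ[k] H ⊗[k] (A ⊗[k] H))
      (d : H →ₐ[k] H ⊗[k] (A ⊗[k] H)) [AlgCommute b u] [AlgCommute b d] [AlgCommute u d],
      C.psi (unitHom Q.counit _) b u d (unitHom Q.counit _) = 1) :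
    idTensor H (idTensor A (counitRight Q.counit H))
      (counitLeft Q.counit (H ⊗[k] (A ⊗[k] (H ⊗[k] H))) C.Ψ.val) = 1 := by
  have := h (inl _ (AlgHom.id k H)) (inr _ (inl _ (AlgHom.id k A))) (inr _ (inr _ (AlgHom.id k H)))
  rw [psi_outer] at this
  simpa only [joint_inr_eq_inr, joint_inl_inr, AlgHom.id_apply] using this

theorem counit_of_star
    (h : C.star (unitHom Q.counit A) (AlgHom.id k A) (unitHom Q.counit A) = AlgHom.id k A) (x : A) :
    counitRight Q.counit A (counitLeft Q.counit (A ⊗[k] H) (C.δ x)) = x := by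
  rw [← AlgHom.id_apply (R := k) (counitRight _ _ _), apply_counitRight, apply_counitLeft]
  exact DFunLike.congr_fun h x

end TwoSidedData

namespace BicomoduleAlgebra

variable {k H A : Type*} [Field k] [Ring H] [Algebra k H] [Ring A] [Algebra k A]
  {Q : QuasiBialgebra k H} (B : BicomoduleAlgebra Q A)

theorem isTwoSidedCoaction_leftTwoSided : IsTwoSidedCoaction Q B.leftTwoSided where
  coassoc := TwoSidedData.coassoc_of_intertwines _ _ fun a b u d e =>
    B.leftTwoSided_intertwines a b u d e
  cocycle := TwoSidedData.cocycle_of_psi _ _ fun a b c u d e f =>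
    B.leftTwoSided_cocycle a b c u d e f
  counit := TwoSidedData.counit_of_star _ _ (by
    rw [leftTwoSided_star]
    simp only [unitHom_lstar, rstar_unitHom])
  normalized_inner := TwoSidedData.normalized_inner_of_psi _ _ fun a u e _ _ _ => by
    rw [leftTwoSided_psi]
    simp only [lamρ_unit_right, legs_inv_eq_one (ρ_unit_mid _ _ _), lam_unit_mid, mul_one]
  normalized_outer := TwoSidedData.normalized_outer_of_psi _ _ fun b u d _ _ _ => by
    rw [leftTwoSided_psi]
    simp only [lamρ_unit_left, legs_inv_eq_one (ρ_unit_right _ _ _), lam_unit_left, mul_one]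

theorem isTwoSidedCoaction_rightTwoSided : IsTwoSidedCoaction Q B.rightTwoSided where
  coassoc := TwoSidedData.coassoc_of_intertwines _ _ fun a b u d e =>
    B.rightTwoSided_intertwines a b u d e
  cocycle := TwoSidedData.cocycle_of_psi _ _ fun a b c u d e f =>
    B.rightTwoSided_cocycle a b c u d e f
  counit := TwoSidedData.counit_of_star _ _ (by
    rw [rightTwoSided_star]
    simp only [unitHom_lstar, rstar_unitHom])
  normalized_inner := TwoSidedData.normalized_inner_of_psi _ _ fun a u e _ _ _ => by
    rw [rightTwoSided_psi]
    simp only [legs_inv_eq_one (lamρ_unit_left _ _ _), legs_inv_eq_one (ρ_unit_mid _ _ _),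
      lam_unit_mid, mul_one]
  normalized_outer := TwoSidedData.normalized_outer_of_psi _ _ fun b u d _ _ _ => by
    rw [rightTwoSided_psi]
    simp only [legs_inv_eq_one (lamρ_unit_right _ _ _), legs_inv_eq_one (ρ_unit_right _ _ _),
      lam_unit_left, mul_one]

end BicomoduleAlgebra

section Injective

variable {k M N : Type*} [Field k] [AddCommGroup M] [Module k M] [AddCommGroup N] [Module k N]

/-- Over a field, some functional takes the value `1` at `m`. -/
theorem tmul_left_injective {m : M} (hm : m ≠ 0) :
    Function.Injective (fun n : N => m ⊗ₜ[k] n) := by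
  obtain ⟨ξ, hξ⟩ := Module.Projective.exists_dual_eq_one k hm
  intro x y h
  simpa [hξ] using congrArg (TensorProduct.lid k N ∘ ξ.rTensor N) h

theorem tmul_right_injective {m : M} (hm : m ≠ 0) :
    Function.Injective (fun n : N => n ⊗ₜ[k] m) := fun _ _ h =>
  tmul_left_injective hm (congrArg (TensorProduct.comm k N M) h)

end Injective
end QuasiHopf

theorem mainTheorem1 {k H A 𝒜 : Type*} [Field k] [Ring H] [Algebra k H]
    (Q : QuasiHopf.QuasiHopfAlgebra k H) [Ring A] [Algebra k A]
    [NonAssocRing 𝒜] [Module k 𝒜] [SMulCommClass k 𝒜 𝒜] [IsScalarTower k 𝒜 𝒜]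
    [Module H 𝒜] [IsScalarTower k H 𝒜] [Module Hᵐᵒᵖ 𝒜] [IsScalarTower k Hᵐᵒᵖ 𝒜]
    [SMulCommClass H Hᵐᵒᵖ 𝒜]
    (h𝒜 : QuasiHopf.IsBimoduleAlgebra Q.toQuasiBialgebra 𝒜) :
    IsUnit Q.drinfeldTwist ∧
    (∀ C : QuasiHopf.TwoSidedData k H A,
      QuasiHopf.IsTwoSidedCoaction Q.toQuasiBialgebra C →
        QuasiHopf.LeftCrossedIsAlgebra 𝒜 Q C ∧ QuasiHopf.RightCrossedIsAlgebra 𝒜 Q C) ∧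
    (∀ B : QuasiHopf.BicomoduleAlgebra Q.toQuasiBialgebra A,
      (QuasiHopf.IsTwoSidedCoaction Q.toQuasiBialgebra B.leftTwoSided ∧
        QuasiHopf.IsTwoSidedCoaction Q.toQuasiBialgebra B.rightTwoSided) ∧
      QuasiHopf.LeftCrossedIsAlgebra 𝒜 Q B.leftTwoSided ∧
      QuasiHopf.LeftCrossedIsAlgebra 𝒜 Q B.rightTwoSided ∧
      QuasiHopf.RightCrossedIsAlgebra 𝒜 Q B.leftTwoSided ∧
      QuasiHopf.RightCrossedIsAlgebra 𝒜 Q B.rightTwoSided) ∧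
    (Nontrivial 𝒜 → Function.Injective (fun u : A => (1 : 𝒜) ⊗ₜ[k] u) ∧
      Function.Injective (fun u : A => u ⊗ₜ[k] (1 : 𝒜))) := by
  have hl := fun (C : QuasiHopf.TwoSidedData k H A)
      (hC : QuasiHopf.IsTwoSidedCoaction Q.toQuasiBialgebra C) =>
    QuasiHopf.leftCrossedIsAlgebra (𝒜 := 𝒜) h𝒜 hC
  have hr := fun (C : QuasiHopf.TwoSidedData k H A)
      (hC : QuasiHopf.IsTwoSidedCoaction Q.toQuasiBialgebra C) =>
    QuasiHopf.rightCrossedIsAlgebra (𝒜 := 𝒜) h𝒜 hC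
  refine ⟨Q.isUnit_drinfeldTwist, fun C hC => ⟨hl C hC, hr C hC⟩, fun B => ?_, fun _ =>
    ⟨QuasiHopf.tmul_left_injective one_ne_zero, QuasiHopf.tmul_right_injective one_ne_zero⟩⟩
  have h₁ := B.isTwoSidedCoaction_leftTwoSided
  have h₂ := B.isTwoSidedCoaction_rightTwoSided
  exact ⟨⟨h₁, h₂⟩, hl _ h₁, hl _ h₂, hr _ h₁, hr _ h₂⟩
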